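/- **Setting.** Let $X,A$ be finite state and action spaces, $X$ being partitioned into layers $X_0,\dots,X_L$ ($L\ge1$) with $X_0=\{x_0\}$, $X_L=\{x_L\}$; let $P(x'|x,a)$ be a transition function with $P(x'|x,a)>0$ only if $x\in X_k$, $x'\in X_{k+1}$ for some $k<L$. Let $m\ge1$, $\alpha\in[0,L]^m$. In each episode a reward vector in $[0,1]^{X\times A}$ and cost vectors in $[0,1]^{X\times A}$, $i\in[m]$, are drawn from a fixed joint law, independently of the past and of the trajectory; their means are $r$ and $g_i$. For a policy $\pi$ let $V^{\pi,P}(v)=\mathbb E_{\pi,P}\big[\sum_{k<L}v(x_k,a_k)\big]$, $V^\pi=V^{\pi,P}$ for the true $P$, and let $q^{P,\pi}(x,a)$ be the probability that $(x,a)$ is visited. Assume Slater's condition: some policy has $V^\pi(g_i)<\alpha_i$ for all $i$. Put $\rho=\max_\pi\min_i(\alpha_i-V^\pi(g_i))>0$. **Algorithm CPD-PO** (inputs $T$, $\rho$, $\delta\in(0,1)$). In episode $t=1,\dots,T$ let $N(x,a)$, $M(x,a,x')$ be the numbers of earlier episodes (those before $t$) in which $(x,a)$, respectively $(x,a)$ followed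 by $x'$, was visited; let $\widehat r_t,\widehat g_{t,i}$ be the averages of the rewards and costs observed at $(x,a)$ in those episodes ($0$ if there are none), $\widehat P_t=M/\max\{1,N\}$, $\phi_t=\min\{1,\sqrt{4\ln(T|X||A|/\delta)/\max\{1,N\}}\}$, $\xi_t=\min\{1,\sqrt{4\ln(T|X||A|m/\delta)/\max\{1,N\}}\}$, $\overline r_t=\widehat r_t+\phi_t$, $\underline g_{t,i}=\widehat g_{t,i}-\xi_t$. With the current policy $\pi_t$, set $\lambda_{t,i}=\frac{L+1}{\rho}$ if $V^{\pi_t,\widehat P_t}(\underline g_{t,i})>\alpha_i$ and $\lambda_{t,i}=0$ otherwise, and $$\ell_t(x,a)=\tfrac{(L+1)m}{\rho}-\Big[\overline r_t(x,a)-\sum_i\lambda_{t,i}\big(\underline g_{t,i}(x,a)-\tfrac{\alpha_i}{L}\big)\Big]\in\Big[-\tfrac{(L+1)m}{\rho}-2,\ \tfrac{2(L+1)m}{\rho}\Big].$$ Play $\pi_t$, observe the trajectory and the rewards and costs along it, and feed the trajectory with the values along it of $\tilde\ell_t$, the affine rescaling of $\ell_t$ from the above interval to $[0,1]$, to PO-DB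 (Luo, Wei and Lee), which produces $\pi_{t+1}$. Here PO-DB is the following: $\eta=\min\{\frac1{24L^3},\frac1{\sqrt{|X||A|LT}}\}$, $\gamma=2\eta L$, $\pi_t(a|x)\propto\exp\big(-\eta\sum_{s<t}(\widehat Q_s-B_s)(x,a)\big)$; $\widehat Q_t(x,a)=\frac{\mathbf 1[(x_k,a_k)=(x,a)]}{\overline q_t(x,a)+\gamma}\sum_{j\ge k}\tilde\ell_t(x_j,a_j)$ for $x\in X_k$; $\overline q_t,\underline q_t$ are the maximum and minimum of $q^{\widehat P,\pi_t}$ over the transition functions $\widehat P$ in the current confidence set $\mathcal P$; $b_t(x)=\sum_a\pi_t(a|x)\frac{3\gamma L+L(\overline q_t-\underline q_t)(x,a)}{\overline q_t(x,a)+\gamma}$; $B_t(x,a)=b_t(x)+(1+\frac1L)\max_{\widehat P\in\mathcal P}\sum_{x'}\widehat P(x'|x,a)\sum_{a'}\pi_t(a'|x')B_t(x',a')$, $B_t(x_L,\cdot)=0$; $\mathcal P$ is the set of transition functions with $|\widehat P-\overline P|(x'|x,a)\le4\sqrt{\overline P(x'|x,a)\ln(T|X||A|/\delta)/\max\{1,N\}}+\frac{28\ln(T|X||A|/\delta)}{3\max\{1,N\}}$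 for $x'$ in the layer after that of $x$, where $\overline P$ and $N$ are the empirical transition function and the counters at the beginning of the current epoch, and a new epoch begins after each episode in which the counter of some visited pair reaches at least $\max\{1,2N\}$. **Theorem 2.** There are absolute constants $C>0$ and $p,q\in\mathbb N$ such that for every such problem, every $\delta\in(0,1)$ and every $T\ge(|X||A|)^q$, with probability at least $1-C\delta$ the strong cumulative constraint violation of CPD-PO satisfies $$V_T:=\max_{i\in[m]}\sum_{t=1}^T\big[V^{\pi_t}(g_i)-\alpha_i\big]^+\ \le\ C\,\Big(\ln\frac{T|X||A|m}{\delta}\Big)^p\Big(L^3m|X|\sqrt{|A|T}+L^5m\Big),$$ that is, $V_T\le\widetilde{\mathcal O}(L^3m|X|\sqrt{|A|T}+L^5m)$, with no dependence on $\rho$. -/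

import Mathlib

open MeasureTheory

noncomputable section

open scoped Classical

namespace CMDP

/-- A partition of the state space into layers `X_0, …, X_L`, the first and the last of which are
singletons. -/
structure Layering (X : Type*) (L : ℕ) where
  layer : X → ℕ
  layer_le : ∀ x, layer x ≤ L
  start : X
  last : X
  layer_eq_zero : ∀ x, layer x = 0 ↔ x = start
  layer_eq_last : ∀ x, layer x = L ↔ x = last

/-- A reward vector together with `m` cost vectors. -/
abbrev Outcome (X A : Type*) (m : ℕ) := (X → A → ℝ) × (Fin m → X → A → ℝ)

/-- The states `x_0, …, x_L` and the actions `a_0, …, a_{L-1}` of one episode. -/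
structure Trajectory (X A : Type*) (L : ℕ) where
  state : Fin (L + 1) → X
  act : Fin L → A

instance (X A : Type*) (L : ℕ) : MeasurableSpace (Trajectory X A L) := ⊤

/-- What happens in one episode: the trajectory, and the sampled reward and cost vectors. -/
abbrev Episode (X A : Type*) (L m : ℕ) := Trajectory X A L × Outcome X A m

section Basic

variable {X A : Type*} [Fintype X] [Fintype A] {L m : ℕ}

/-- Loop-free transition functions. No transition leaves the last layer. -/
def IsTransition (𝓛 : Layering X L) (P : X → A → X → ℝ) : Prop :=
  (∀ x a x', 0 ≤ P x a x') ∧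
  (∀ x a x', 0 < P x a x' → 𝓛.layer x' = 𝓛.layer x + 1) ∧
  (∀ x a, 𝓛.layer x < L → ∑ x', P x a x' = 1)

/-- `π x a` is the probability of the action `a` in the state `x`. -/
def IsPolicy (π : X → A → ℝ) : Prop :=
  ∀ x, (∀ a, 0 ≤ π x a) ∧ ∑ a, π x a = 1

/-- The probability that `x_k = x` when `π` is played under `P` from the initial state. -/
def stateProb (𝓛 : Layering X L) (P : X → A → X → ℝ) (π : X → A → ℝ) : ℕ → X → ℝ
  | 0 => fun x => if x = 𝓛.start then 1 else 0
  | k + 1 => fun x' => ∑ x, ∑ a, stateProb 𝓛 P π k x * π x a * P x a x'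

/-- The occupancy measure: the probability that the pair `(x, a)` is visited in an episode. -/
def occ (𝓛 : Layering X L) (P : X → A → X → ℝ) (π : X → A → ℝ) (x : X) (a : A) : ℝ :=
  stateProb 𝓛 P π (𝓛.layer x) x * π x a

/-- The value `V^{π,P}(v)`, the expectation of `∑_{k<L} v(x_k, a_k)`. It is also used for the
empirical transition function, whose rows are zero at the pairs that have not been visited. -/
def value (𝓛 : Layering X L) (P : X → A → X → ℝ) (π : X → A → ℝ) (v : X → A → ℝ) : ℝ :=
  ∑ k ∈ Finset.range L, ∑ x, ∑ a, stateProb 𝓛 P π k x * π x a * v x a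

/-- The probability of a trajectory when `π` is played under `P`. -/
def trajProb (𝓛 : Layering X L) (P : X → A → X → ℝ) (π : X → A → ℝ)
    (τ : Trajectory X A L) : ℝ :=
  (if τ.state 0 = 𝓛.start then 1 else 0) *
    ∏ k : Fin L, π (τ.state k.castSucc) (τ.act k) *
      P (τ.state k.castSucc) (τ.act k) (τ.state k.succ)

end Basic

/-- A loop-free constrained Markov decision process with stochastic rewards and costs. The measure
`law` is the joint law of the reward vector and the cost vectors of one episode; no independence
between the reward vector and the cost vectors is required. -/
structure Model (X A : Type*) [Fintype X] [Fintype A] (L m : ℕ) where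
  lay : Layering X L
  P : X → A → X → ℝ
  isTransition : IsTransition lay P
  law : Measure (Outcome X A m)
  isProb : IsProbabilityMeasure law
  reward_mem : ∀ᵐ o ∂law, ∀ x a, o.1 x a ∈ Set.Icc (0 : ℝ) 1
  cost_mem : ∀ᵐ o ∂law, ∀ i x a, o.2 i x a ∈ Set.Icc (0 : ℝ) 1
  thr : Fin m → ℝ
  thr_mem : ∀ i, thr i ∈ Set.Icc (0 : ℝ) L

section Problem

variable {X A : Type*} [Fintype X] [Fintype A] {L m : ℕ} (M : Model X A L m)

/-- The expected costs `g_i`. -/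
def cost (i : Fin m) (x : X) (a : A) : ℝ := ∫ o, o.2 i x a ∂M.law

/-- Slater's condition: some policy satisfies every constraint strictly. -/
def Slater : Prop :=
  ∃ π : X → A → ℝ, IsPolicy π ∧ ∀ i, value M.lay M.P π (cost M i) < M.thr i

/-- The Slater parameter `ρ = max_π min_i (α_i - V^π(g_i))`. -/
def rho : ℝ :=
  sSup ((fun π : X → A → ℝ => ⨅ i, (M.thr i - value M.lay M.P π (cost M i))) ''
    {π | IsPolicy π})

end Problem

/-! Estimators. A sequence `h` of episodes is indexed from `0`, and `t` is the number of episodes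
that have been completed; everything below depends only on `h 0, …, h (t - 1)` and, of the sampled
vectors, only on the entries at visited pairs. -/

section Estimators

variable {X A : Type*} [Fintype X] [Fintype A] {L m : ℕ}

/-- The pair `(x, a)` is visited in the episode `e`. -/
def Visited (e : Episode X A L m) (x : X) (a : A) : Prop :=
  ∃ k : Fin L, e.1.state k.castSucc = x ∧ e.1.act k = a

/-- The pair `(x, a)` is visited in the episode `e` and the next state is `x'`. -/
def VisitedTo (e : Episode X A L m) (x : X) (a : A) (x' : X) : Prop :=
  ∃ k : Fin L, e.1.state k.castSucc = x ∧ e.1.act k = a ∧ e.1.state k.succ = x'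

def visits (h : ℕ → Episode X A L m) (t : ℕ) (x : X) (a : A) : ℕ :=
  ((Finset.range t).filter fun s => Visited (h s) x a).card

def transits (h : ℕ → Episode X A L m) (t : ℕ) (x : X) (a : A) (x' : X) : ℕ :=
  ((Finset.range t).filter fun s => VisitedTo (h s) x a x').card

/-- The denominator `max {1, N_t(x,a)}`. -/
def den (h : ℕ → Episode X A L m) (t : ℕ) (x : X) (a : A) : ℝ :=
  max 1 (visits h t x a : ℝ)

def rHat (h : ℕ → Episode X A L m) (t : ℕ) (x : X) (a : A) : ℝ :=
  (∑ s ∈ Finset.range t, if Visited (h s) x a then (h s).2.1 x a else 0) / den h t x a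

def gHat (h : ℕ → Episode X A L m) (t : ℕ) (i : Fin m) (x : X) (a : A) : ℝ :=
  (∑ s ∈ Finset.range t, if Visited (h s) x a then (h s).2.2 i x a else 0) / den h t x a

/-- The empirical transition function. -/
def pHat (h : ℕ → Episode X A L m) (t : ℕ) (x : X) (a : A) (x' : X) : ℝ :=
  (transits h t x a x' : ℝ) / den h t x a

/-- The confidence width `φ_t` of the rewards. -/
def phi (T : ℕ) (δ : ℝ) (h : ℕ → Episode X A L m) (t : ℕ) (x : X) (a : A) : ℝ :=
  min 1 √(4 * Real.log (T * Fintype.card X * Fintype.card A / δ) / den h t x a)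

/-- The confidence width `ξ_t` of the costs. -/
def xi (T : ℕ) (δ : ℝ) (h : ℕ → Episode X A L m) (t : ℕ) (x : X) (a : A) : ℝ :=
  min 1 √(4 * Real.log (T * Fintype.card X * Fintype.card A * m / δ) / den h t x a)

/-- Optimistic rewards. -/
def rUp (T : ℕ) (δ : ℝ) (h : ℕ → Episode X A L m) (t : ℕ) (x : X) (a : A) : ℝ :=
  rHat h t x a + phi T δ h t x a

/-- Optimistic costs. -/
def gLow (T : ℕ) (δ : ℝ) (h : ℕ → Episode X A L m) (t : ℕ) (i : Fin m) (x : X) (a : A) : ℝ :=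
  gHat h t i x a - xi T δ h t x a

end Estimators

section Dual

variable {X A : Type*} [Fintype X] [Fintype A] {L m : ℕ} (M : Model X A L m) (T : ℕ) (δ : ℝ)

/-- The dual variable: the maximizer over `{0, (L+1)/ρ}` of `λ (V^{π,P̂}(g̲_i) - α_i)`, with ties
broken in favour of `0`. -/
def dual (h : ℕ → Episode X A L m) (t : ℕ) (π : X → A → ℝ) (i : Fin m) : ℝ :=
  if M.thr i < value M.lay (pHat h t) π (gLow T δ h t i) then ((L : ℝ) + 1) / rho M else 0

/-- The Lagrangian loss. -/
def loss (h : ℕ → Episode X A L m) (t : ℕ) (π : X → A → ℝ) (x : X) (a : A) : ℝ :=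
  ((L : ℝ) + 1) * m / rho M -
    (rUp T δ h t x a - ∑ i, dual M T δ h t π i * (gLow T δ h t i x a - M.thr i / L))

/-- The Lagrangian loss takes its values in
`[-(L+1)m/ρ - 2, 2(L+1)m/ρ]`; this is its image under the increasing affine map of that interval
onto `[0, 1]`, the range of losses for which `PO-DB` is designed. -/
def scaledLoss (h : ℕ → Episode X A L m) (t : ℕ) (π : X → A → ℝ) (x : X) (a : A) : ℝ :=
  (loss M T δ h t π x a + (((L : ℝ) + 1) * m / rho M + 2)) /
    (3 * (((L : ℝ) + 1) * m / rho M) + 2)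

end Dual

/-! Policy optimization with dilated bonuses (`PO-DB`) of Luo, Wei and Lee. -/

section PODB

variable {X A : Type*} [Fintype X] [Fintype A] {L m : ℕ}

/-- The learning rate. -/
def eta (X A : Type*) [Fintype X] [Fintype A] (L T : ℕ) : ℝ :=
  min (1 / (24 * (L : ℝ) ^ 3)) (1 / √((Fintype.card X : ℝ) * Fintype.card A * L * T))

/-- The implicit exploration parameter. -/
def gam (X A : Type*) [Fintype X] [Fintype A] (L T : ℕ) : ℝ := 2 * eta X A L T * L

/-- The number of episodes completed at the beginning of the epoch to which the episode played
after `t` completed episodes belongs. An epoch ends with the episode in which the number of visits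
to some pair reaches twice its value at the beginning of the epoch (or reaches one). -/
def epochStart (h : ℕ → Episode X A L m) : ℕ → ℕ
  | 0 => 0
  | t + 1 =>
    if ∃ x a, Visited (h t) x a ∧
        max 1 (2 * visits h (epochStart h t) x a) ≤ visits h (t + 1) x a
    then t + 1 else epochStart h t

def confWidth (T : ℕ) (δ : ℝ) (h : ℕ → Episode X A L m) (n : ℕ) (x : X) (a : A) (x' : X) : ℝ :=
  4 * √(pHat h n x a x' * Real.log (T * Fintype.card X * Fintype.card A / δ) / den h n x a) +
    28 * Real.log (T * Fintype.card X * Fintype.card A / δ) / (3 * den h n x a)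

/-- The confidence set of transition functions in the current epoch. In the first epoch the widths
exceed one, so that it consists of all transition functions. -/
def confSet (𝓛 : Layering X L) (T : ℕ) (δ : ℝ) (h : ℕ → Episode X A L m) (t : ℕ) :
    Set (X → A → X → ℝ) :=
  {P | IsTransition 𝓛 P ∧ ∀ x a x', 𝓛.layer x' = 𝓛.layer x + 1 →
    |P x a x' - pHat h (epochStart h t) x a x'| ≤ confWidth T δ h (epochStart h t) x a x'}

/-- Upper occupancy bound: the largest occupancy over the confidence set `S`. -/
def occUp (𝓛 : Layering X L) (S : Set (X → A → X → ℝ)) (π : X → A → ℝ) (x : X) (a : A) : ℝ :=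
  sSup ((fun P => occ 𝓛 P π x a) '' S)

/-- Lower occupancy bound: the smallest occupancy over the confidence set `S`. -/
def occLow (𝓛 : Layering X L) (S : Set (X → A → X → ℝ)) (π : X → A → ℝ) (x : X) (a : A) : ℝ :=
  sInf ((fun P => occ 𝓛 P π x a) '' S)

/-- The local bonus `b_t(x)`. -/
def localBonus (𝓛 : Layering X L) (γ : ℝ) (S : Set (X → A → X → ℝ)) (π : X → A → ℝ)
    (x : X) : ℝ :=
  ∑ a, π x a * ((3 * γ * L + L * (occUp 𝓛 S π x a - occLow 𝓛 S π x a)) /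
    (occUp 𝓛 S π x a + γ))

/-- The dilated bonus at a state from which `n` steps remain. -/
def bonusAux (𝓛 : Layering X L) (γ : ℝ) (S : Set (X → A → X → ℝ)) (π : X → A → ℝ) :
    ℕ → X → A → ℝ
  | 0 => fun _ _ => 0
  | n + 1 => fun x a => localBonus 𝓛 γ S π x + (1 + 1 / (L : ℝ)) *
      sSup ((fun P : X → A → X → ℝ =>
        ∑ x', P x a x' * ∑ a', π x' a' * bonusAux 𝓛 γ S π n x' a') '' S)

/-- The dilated bonus `B_t(x,a)`. -/
def bonus (𝓛 : Layering X L) (γ : ℝ) (S : Set (X → A → X → ℝ)) (π : X → A → ℝ)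
    (x : X) (a : A) : ℝ :=
  bonusAux 𝓛 γ S π (L - 𝓛.layer x) x a

/-- The estimator of the `Q`-function from the trajectory `τ` when the losses are `ℓ`: the loss
suffered from the visit to `(x, a)` on, divided by `occUp + γ`, and zero if there is no visit. -/
def qEst (𝓛 : Layering X L) (γ : ℝ) (S : Set (X → A → X → ℝ)) (π : X → A → ℝ)
    (τ : Trajectory X A L) (ℓ : X → A → ℝ) (x : X) (a : A) : ℝ :=
  ∑ k : Fin L, if τ.state k.castSucc = x ∧ τ.act k = a then
    (∑ j ∈ Finset.Ici k, ℓ (τ.state j.castSucc) (τ.act j)) / (occUp 𝓛 S π x a + γ) else 0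

/-- Exponential weights. -/
def expWeights (η : ℝ) (W : X → A → ℝ) (x : X) (a : A) : ℝ :=
  Real.exp (-η * W x a) / ∑ b, Real.exp (-η * W x b)

variable (M : Model X A L m) (T : ℕ) (δ : ℝ)

/-- The sum of `Q`-estimates minus bonuses over the first `t` episodes, when `PO-DB` is fed with
the rescaled Lagrangian losses. -/
def cumLoss (h : ℕ → Episode X A L m) : ℕ → X → A → ℝ
  | 0 => fun _ _ => 0
  | t + 1 => fun x a =>
    cumLoss h t x a +
      (qEst M.lay (gam X A L T) (confSet M.lay T δ h t)
          (expWeights (eta X A L T) (cumLoss h t)) (h t).1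
          (scaledLoss M T δ h t (expWeights (eta X A L T) (cumLoss h t))) x a -
        bonus M.lay (gam X A L T) (confSet M.lay T δ h t)
          (expWeights (eta X A L T) (cumLoss h t)) x a)

/-- The policy that `CPD-PO` plays after `t` completed episodes. -/
def policy (h : ℕ → Episode X A L m) (t : ℕ) : X → A → ℝ :=
  expWeights (eta X A L T) (cumLoss M T δ h t)

end PODB

section Run

variable {X A : Type*} [Fintype X] [Fintype A] {L m : ℕ} {Ω : Type*}

/-- The `σ`-algebra generated by the first `t` episodes. -/
abbrev past (H : ℕ → Ω → Episode X A L m) (t : ℕ) : MeasurableSpace Ω :=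
  ⨆ s : Fin t, MeasurableSpace.comap (H s) inferInstance

/-- `H 0, …, H (T-1)` are the episodes of a run of `CPD-PO` over `T` episodes: given the past, the
trajectory of the next episode is that of the current policy under the true transition function,
and the reward and cost vectors are drawn from their law independently of the trajectory. -/
structure IsRun [MeasurableSpace Ω] (M : Model X A L m) (T : ℕ) (δ : ℝ) (μ : Measure Ω)
    (H : ℕ → Ω → Episode X A L m) : Prop where
  measurable : ∀ t < T, Measurable (H t)
  step : ∀ t < T, ∀ (τ : Trajectory X A L) (B : Set (Outcome X A m)), MeasurableSet B →
    μ[Set.indicator {ω | (H t ω).1 = τ ∧ (H t ω).2 ∈ B} (fun _ => (1 : ℝ)) | past H t] =ᵐ[μ]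
      fun ω => trajProb M.lay M.P (policy M T δ (fun s => H s ω) t) τ * M.law.real B

/-- The strong cumulative constraint violation `V_T = max_i ∑_t [V^{π_t}(g_i) - α_i]⁺` along a
sequence of episodes. -/
def violation (M : Model X A L m) (T : ℕ) (δ : ℝ) (h : ℕ → Episode X A L m) : ℝ :=
  ⨆ i : Fin m, ∑ t ∈ Finset.range T,
    max 0 (value M.lay M.P (policy M T δ h t) (cost M i) - M.thr i)

end Run

end CMDP

end

open MeasureTheory

noncomputable section

open scoped Classical

set_option linter.unusedSectionVars false

namespace CMDP

/-! ### Values, occupancies and trajectories -/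

section Values

variable {X A : Type*} [Fintype X] [Fintype A] {L : ℕ}

/-! The core is a deterministic inequality for one episode. Let `σ` be a feasible policy of maximal
reward. If a policy `π` violates every constraint by at most `w`, mixing it with an almost optimal
Slater policy gives a feasible policy, whence `ρ (V^π(r) - V^σ(r)) ≤ L w` (`exists_comparator`). The
regret of `π` against `σ` in the Lagrangian loss is a reward gap plus dual terms. The dual terms of
`σ` have the favourable sign, by feasibility and by optimism of the cost estimates. Those of `π` are
at least `(L+1)/ρ` times the violations, up to estimation errors; this includes the inactive
constraints, since an estimated value within the threshold forces a small violation (`dual_mul_ge`).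
If `W` is the sum of the violations, then after multiplication by `ρ` the dual terms give `(L+1) W`
while the reward can gain at most `L W`, so `W` itself is bounded by regret and errors
(`episode_violation`). Positive parts are taken episode by episode, so violations never cancel. The
loss range of order `L m / ρ` has been multiplied by `ρ`, and `ρ ≤ L`, so no `1/ρ` survives.

It remains to bound the regret for losses in `[0, 1]` (`podb_regret`). The performance difference
lemma reduces it to a regret in each state, weighted by the occupancy of `σ`. In one state the
analysis of exponential weights applies to the estimates minus the bonuses (`hedge_regret`).
Implicit exploration makes the comparator's estimates harmless, and the bias and variance of the
policy's own estimates are covered by the local bonus (`state_regret`). These local bonuses are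
still weighted by the occupancy of `σ`; the dilated bonuses exchange this weight for the occupancy
of the current policy (`dilated_bonus`). There the denominator `occUp + γ` cancels, leaving only `γ`
and the widths `occUp - occLow` (`avgBonus_start_le`).

The widths are controlled by applying the simulation lemma twice (`abs_occ_sub_occ_le`). The
first-order part sums to order `L |X| √(|A| T)` up to logarithms, and the second-order part is
absorbed because `T` is at least a power of `|X| |A|` (`sum_width_le`). All these sums reduce to the
expected visits discounted by the past counters, which are logarithmic per pair (`VisitGood`).

The probabilistic input is the conditional law of an episode given the past. It makes products of
suitable exponentials supermartingales (`IsRun.lintegral_prod_le_one`), and the exponential Markov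
inequality then gives Bernstein, Hoeffding and Freedman bounds for the four good events `TransGood`,
`MeanGood`, `VisitGood` and `QHatGood`. -/

/-- The value-to-go with `n` remaining steps. -/
def vgo (P : X → A → X → ℝ) (π : X → A → ℝ) (v : X → A → ℝ) : ℕ → X → ℝ
  | 0 => fun _ => 0
  | n + 1 => fun x => ∑ a, π x a * (v x a + ∑ y, P x a y * vgo P π v n y)

/-- The action value, with `n` steps remaining after the current one. -/
def qgo (P : X → A → X → ℝ) (π : X → A → ℝ) (v : X → A → ℝ) (n : ℕ) (x : X) (a : A) : ℝ :=
  v x a + ∑ y, P x a y * vgo P π v n y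

/-- One step of the state distribution. -/
def push (P : X → A → X → ℝ) (π : X → A → ℝ) (f : X → ℝ) (x' : X) : ℝ :=
  ∑ x, ∑ a, f x * (π x a * P x a x')

theorem stateProb_succ_apply (𝓛 : Layering X L) (P : X → A → X → ℝ) (π : X → A → ℝ) (k : ℕ)
    (x' : X) :
    stateProb 𝓛 P π (k + 1) x' = ∑ x, ∑ a, stateProb 𝓛 P π k x * π x a * P x a x' := rfl

theorem stateProb_succ (𝓛 : Layering X L) (P : X → A → X → ℝ) (π : X → A → ℝ) (k : ℕ) :
    stateProb 𝓛 P π (k + 1) = push P π (stateProb 𝓛 P π k) := by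
  funext x'
  simp only [stateProb_succ_apply, push, mul_assoc]

theorem stateProb_eq_iterate (𝓛 : Layering X L) (P : X → A → X → ℝ) (π : X → A → ℝ) (k : ℕ) :
    stateProb 𝓛 P π k = (push P π)^[k] (stateProb 𝓛 P π 0) := by
  induction k with
  | zero => rfl
  | succ k ih => rw [Function.iterate_succ_apply', ← ih, stateProb_succ]

/-- Duality between moving a state distribution forward and averaging a function backward; the
telescoping identities rest on it. -/
theorem sum_push_mul (P : X → A → X → ℝ) (π : X → A → ℝ) (f g : X → ℝ) :
    ∑ x', push P π f x' * g x' = ∑ x, f x * ∑ a, π x a * ∑ x', P x a x' * g x' := by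
  simp only [push, Finset.sum_mul, Finset.mul_sum]
  rw [Finset.sum_comm]
  refine Finset.sum_congr rfl fun x _ => ?_
  rw [Finset.sum_comm]
  refine Finset.sum_congr rfl fun a _ => Finset.sum_congr rfl fun x' _ => ?_
  ring

theorem sum_stateProb_zero_mul (𝓛 : Layering X L) (P : X → A → X → ℝ) (π : X → A → ℝ)
    (g : X → ℝ) : ∑ x, stateProb 𝓛 P π 0 x * g x = g 𝓛.start := by
  simp [stateProb]

/-- Telescoping along the state distributions. -/
theorem sum_stateProb_telescope (𝓛 : Layering X L) (P : X → A → X → ℝ) (π : X → A → ℝ)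
    (f : ℕ → X → ℝ) (hf : ∀ x, f L x = 0) :
    f 0 𝓛.start = ∑ k ∈ Finset.range L, ∑ x, stateProb 𝓛 P π k x *
      (f k x - ∑ a, π x a * ∑ x', P x a x' * f (k + 1) x') := by
  have h := Finset.sum_range_sub' (fun k => ∑ x, stateProb 𝓛 P π k x * f k x) L
  rw [sum_stateProb_zero_mul] at h
  simp only [hf, mul_zero, Finset.sum_const_zero, sub_zero] at h
  rw [← h]
  refine Finset.sum_congr rfl fun k _ => ?_
  rw [stateProb_succ, sum_push_mul, ← Finset.sum_sub_distrib]
  refine Finset.sum_congr rfl fun x _ => ?_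
  ring

theorem vgo_sub_succ (P : X → A → X → ℝ) (π : X → A → ℝ) (v : X → A → ℝ) {k : ℕ} (hk : k < L)
    (x : X) :
    vgo P π v (L - k) x = ∑ a, π x a * qgo P π v (L - (k + 1)) x a := by
  have h : L - k = (L - (k + 1)) + 1 := by omega
  rw [h]
  rfl

/-- The performance difference lemma. -/
theorem vgo_sub_value (𝓛 : Layering X L) (P : X → A → X → ℝ) (π π' : X → A → ℝ)
    (v : X → A → ℝ) :
    vgo P π v L 𝓛.start - value 𝓛 P π' v =
      ∑ k ∈ Finset.range L, ∑ x, stateProb 𝓛 P π' k x *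
        ∑ a, (π x a - π' x a) * qgo P π v (L - (k + 1)) x a := by
  have h := sum_stateProb_telescope 𝓛 P π' (fun k => vgo P π v (L - k)) (by simp [vgo])
  simp only [Nat.sub_zero] at h
  rw [h, value, ← Finset.sum_sub_distrib]
  refine Finset.sum_congr rfl fun k hk => ?_
  rw [← Finset.sum_sub_distrib]
  refine Finset.sum_congr rfl fun x _ => ?_
  rw [vgo_sub_succ P π v (Finset.mem_range.1 hk)]
  simp only [mul_assoc, ← Finset.mul_sum, ← mul_sub, ← Finset.sum_sub_distrib]
  congr 1
  refine Finset.sum_congr rfl fun a _ => ?_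
  simp only [qgo]
  ring

theorem value_eq_vgo (𝓛 : Layering X L) (P : X → A → X → ℝ) (π : X → A → ℝ) (v : X → A → ℝ) :
    value 𝓛 P π v = vgo P π v L 𝓛.start := by
  have h := vgo_sub_value 𝓛 P π π v
  simp only [sub_self, zero_mul, Finset.sum_const_zero, mul_zero] at h
  linarith

/-- The simulation lemma. -/
theorem value_sub_value (𝓛 : Layering X L) (P P' : X → A → X → ℝ) (π : X → A → ℝ)
    (v : X → A → ℝ) :
    value 𝓛 P' π v - value 𝓛 P π v =
      ∑ k ∈ Finset.range L, ∑ x, ∑ a, stateProb 𝓛 P π k x * π x a *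
        ∑ x', (P' x a x' - P x a x') * vgo P' π v (L - (k + 1)) x' := by
  have h := sum_stateProb_telescope 𝓛 P π (fun k => vgo P' π v (L - k)) (by simp [vgo])
  simp only [Nat.sub_zero] at h
  rw [value_eq_vgo 𝓛 P', h, value, ← Finset.sum_sub_distrib]
  refine Finset.sum_congr rfl fun k hk => ?_
  rw [← Finset.sum_sub_distrib]
  refine Finset.sum_congr rfl fun x _ => ?_
  rw [vgo_sub_succ P' π v (Finset.mem_range.1 hk)]
  simp only [mul_assoc, ← Finset.mul_sum, ← mul_sub, ← Finset.sum_sub_distrib]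
  congr 1
  refine Finset.sum_congr rfl fun a _ => ?_
  simp only [qgo, sub_mul, Finset.sum_sub_distrib]
  ring

theorem value_add (𝓛 : Layering X L) (P : X → A → X → ℝ) (π : X → A → ℝ) (v w : X → A → ℝ) :
    value 𝓛 P π (fun x a => v x a + w x a) = value 𝓛 P π v + value 𝓛 P π w := by
  simp only [value, mul_add, Finset.sum_add_distrib]

theorem value_smul (𝓛 : Layering X L) (P : X → A → X → ℝ) (π : X → A → ℝ) (c : ℝ)
    (v : X → A → ℝ) :
    value 𝓛 P π (fun x a => c * v x a) = c * value 𝓛 P π v := by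
  simp only [value, Finset.mul_sum]
  refine Finset.sum_congr rfl fun k _ => Finset.sum_congr rfl fun x _ =>
    Finset.sum_congr rfl fun a _ => ?_
  ring

theorem value_sum {ι : Type*} (s : Finset ι) (𝓛 : Layering X L) (P : X → A → X → ℝ)
    (π : X → A → ℝ) (v : ι → X → A → ℝ) :
    value 𝓛 P π (fun x a => ∑ i ∈ s, v i x a) = ∑ i ∈ s, value 𝓛 P π (v i) := by
  induction s using Finset.induction_on with
  | empty => simp [value]
  | insert i s hi ih => simp only [Finset.sum_insert hi, value_add, ih]

section Stochastic

variable {𝓛 : Layering X L} {P : X → A → X → ℝ} {π : X → A → ℝ}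

theorem IsTransition.eq_zero (hP : IsTransition 𝓛 P) {x : X} {a : A} {x' : X}
    (h : 𝓛.layer x' ≠ 𝓛.layer x + 1) : P x a x' = 0 :=
  le_antisymm (not_lt.1 fun h' => h (hP.2.1 x a x' h')) (hP.1 x a x')

theorem IsTransition.sum_le_one (hP : IsTransition 𝓛 P) (x : X) (a : A) :
    ∑ x', P x a x' ≤ 1 := by
  by_cases h : 𝓛.layer x < L
  · exact (hP.2.2 x a h).le
  · refine (Finset.sum_eq_zero fun x' _ => hP.eq_zero ?_).trans_le zero_le_one
    have := 𝓛.layer_le x'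
    omega

theorem IsTransition.le_one (hP : IsTransition 𝓛 P) (x : X) (a : A) (x' : X) :
    P x a x' ≤ 1 :=
  (Finset.single_le_sum (fun x' _ => hP.1 x a x') (Finset.mem_univ x')).trans
    (hP.sum_le_one x a)

theorem IsPolicy.le_one (hπ : IsPolicy π) (x : X) (a : A) : π x a ≤ 1 :=
  (Finset.single_le_sum (fun b _ => (hπ x).1 b) (Finset.mem_univ a)).trans_eq (hπ x).2

theorem stateProb_nonneg (hP : ∀ x a x', 0 ≤ P x a x') (hπ : IsPolicy π) (k : ℕ) (x : X) :
    0 ≤ stateProb 𝓛 P π k x := by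
  induction k generalizing x with
  | zero => simp only [stateProb]; split_ifs <;> norm_num
  | succ k ih =>
    exact Finset.sum_nonneg fun y _ => Finset.sum_nonneg fun a _ =>
      mul_nonneg (mul_nonneg (ih y) ((hπ y).1 a)) (hP _ _ _)

theorem stateProb_eq_zero (hP : IsTransition 𝓛 P) {k : ℕ} {x : X} (h : 𝓛.layer x ≠ k) :
    stateProb 𝓛 P π k x = 0 := by
  induction k generalizing x with
  | zero =>
    have : x ≠ 𝓛.start := fun h' => h ((𝓛.layer_eq_zero x).2 h')
    simp [stateProb, this]
  | succ k ih =>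
    refine Finset.sum_eq_zero fun y _ => Finset.sum_eq_zero fun a _ => ?_
    by_cases hy : 𝓛.layer y = k
    · rw [hP.eq_zero (by omega), mul_zero]
    · rw [ih hy, zero_mul, zero_mul]

theorem sum_stateProb (hP : IsTransition 𝓛 P) (hπ : IsPolicy π) {k : ℕ} (hk : k ≤ L) :
    ∑ x, stateProb 𝓛 P π k x = 1 := by
  induction k with
  | zero => simp [stateProb]
  | succ k ih =>
    have h := sum_push_mul P π (stateProb 𝓛 P π k) (fun _ => 1)
    simp only [mul_one] at h
    rw [stateProb_succ, h, ← ih (by omega)]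
    refine Finset.sum_congr rfl fun x _ => ?_
    by_cases hx : 𝓛.layer x = k
    · simp only [hP.2.2 x _ (show 𝓛.layer x < L by omega), mul_one, (hπ x).2]
    · rw [stateProb_eq_zero hP hx, zero_mul]

theorem stateProb_le_one (hP : IsTransition 𝓛 P) (hπ : IsPolicy π) {k : ℕ} (hk : k ≤ L) (x : X) :
    stateProb 𝓛 P π k x ≤ 1 :=
  (Finset.single_le_sum (fun y _ => stateProb_nonneg hP.1 hπ k y) (Finset.mem_univ x)).trans_eq
    (sum_stateProb hP hπ hk)

theorem occ_nonneg (hP : IsTransition 𝓛 P) (hπ : IsPolicy π) (x : X) (a : A) :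
    0 ≤ occ 𝓛 P π x a :=
  mul_nonneg (stateProb_nonneg hP.1 hπ _ _) ((hπ x).1 a)

theorem occ_le_one (hP : IsTransition 𝓛 P) (hπ : IsPolicy π) (x : X) (a : A) :
    occ 𝓛 P π x a ≤ 1 :=
  mul_le_one₀ (stateProb_le_one hP hπ (𝓛.layer_le x) x) ((hπ x).1 a) (hπ.le_one x a)

/-- The pairs outside the last layer. -/
def Layering.inner (𝓛 : Layering X L) : Finset X := Finset.univ.filter fun x => 𝓛.layer x < L

theorem Layering.mem_inner {𝓛 : Layering X L} {x : X} : x ∈ 𝓛.inner ↔ 𝓛.layer x < L := by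
  simp [Layering.inner]

/-- A state carries mass only at the time equal to its layer, so the sum over times collapses. The
last layer drops out because the times stop before `L`. -/
theorem sum_range_sum_stateProb (hP : IsTransition 𝓛 P) (f : ℕ → X → ℝ) :
    ∑ k ∈ Finset.range L, ∑ x, stateProb 𝓛 P π k x * f k x =
      ∑ x ∈ 𝓛.inner, stateProb 𝓛 P π (𝓛.layer x) x * f (𝓛.layer x) x := by
  rw [Finset.sum_comm, Layering.inner, Finset.sum_filter]
  refine Finset.sum_congr rfl fun x _ => ?_
  split_ifs with h
  · refine Finset.sum_eq_single_of_mem _ (Finset.mem_range.2 h) fun k _ hk => ?_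
    rw [stateProb_eq_zero hP (Ne.symm hk), zero_mul]
  · refine Finset.sum_eq_zero fun k hk => ?_
    have := Finset.mem_range.1 hk
    rw [stateProb_eq_zero hP (by omega), zero_mul]

theorem value_eq_sum_occ (hP : IsTransition 𝓛 P) (v : X → A → ℝ) :
    value 𝓛 P π v = ∑ x ∈ 𝓛.inner, ∑ a, occ 𝓛 P π x a * v x a := by
  have h := sum_range_sum_stateProb (π := π) hP (fun _ x => ∑ a, π x a * v x a)
  simp only [value, occ, mul_assoc, ← Finset.mul_sum] at h ⊢
  exact h

theorem value_mono {v w : X → A → ℝ} (hP : ∀ x a x', 0 ≤ P x a x') (hπ : IsPolicy π)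
    (h : ∀ x a, v x a ≤ w x a) : value 𝓛 P π v ≤ value 𝓛 P π w :=
  Finset.sum_le_sum fun k _ => Finset.sum_le_sum fun x _ => Finset.sum_le_sum fun a _ =>
    mul_le_mul_of_nonneg_left (h x a) (mul_nonneg (stateProb_nonneg hP hπ k x) ((hπ x).1 a))

theorem value_nonneg {v : X → A → ℝ} (hP : ∀ x a x', 0 ≤ P x a x') (hπ : IsPolicy π)
    (h : ∀ x a, 0 ≤ v x a) : 0 ≤ value 𝓛 P π v :=
  Finset.sum_nonneg fun k _ => Finset.sum_nonneg fun x _ => Finset.sum_nonneg fun a _ =>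
    mul_nonneg (mul_nonneg (stateProb_nonneg hP hπ k x) ((hπ x).1 a)) (h x a)

theorem value_const (hP : IsTransition 𝓛 P) (hπ : IsPolicy π) (c : ℝ) :
    value 𝓛 P π (fun _ _ => c) = L * c := by
  simp only [value, mul_assoc, ← Finset.mul_sum, ← Finset.sum_mul, (hπ _).2, one_mul]
  rw [Finset.sum_congr rfl fun k hk => sum_stateProb hP hπ (Finset.mem_range.1 hk).le]
  simp

theorem value_le (hP : IsTransition 𝓛 P) (hπ : IsPolicy π) {v : X → A → ℝ} {c : ℝ}
    (h : ∀ x a, v x a ≤ c) : value 𝓛 P π v ≤ L * c :=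
  (value_mono hP.1 hπ h).trans_eq (value_const hP hπ c)

theorem vgo_mono {v w : X → A → ℝ} (hP : ∀ x a x', 0 ≤ P x a x') (hπ : IsPolicy π)
    (h : ∀ x a, v x a ≤ w x a) (n : ℕ) (x : X) : vgo P π v n x ≤ vgo P π w n x := by
  induction n generalizing x with
  | zero => exact le_rfl
  | succ n ih =>
    exact Finset.sum_le_sum fun a _ => mul_le_mul_of_nonneg_left (add_le_add (h x a)
      (Finset.sum_le_sum fun x' _ => mul_le_mul_of_nonneg_left (ih x') (hP _ _ _))) ((hπ x).1 a)

theorem vgo_zero (n : ℕ) (x : X) : vgo P π (fun _ _ => 0) n x = 0 := by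
  induction n generalizing x with
  | zero => rfl
  | succ n ih => simp [vgo, ih]

theorem vgo_nonneg {v : X → A → ℝ} (hP : ∀ x a x', 0 ≤ P x a x') (hπ : IsPolicy π)
    (h : ∀ x a, 0 ≤ v x a) (n : ℕ) (x : X) : 0 ≤ vgo P π v n x :=
  (vgo_zero n x).symm.le.trans (vgo_mono hP hπ h n x)

theorem vgo_add (v w : X → A → ℝ) (n : ℕ) (x : X) :
    vgo P π (fun x a => v x a + w x a) n x = vgo P π v n x + vgo P π w n x := by
  induction n generalizing x with
  | zero => simp [vgo]
  | succ n ih =>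
    simp only [vgo, ih, mul_add, Finset.sum_add_distrib]
    ring

theorem vgo_smul (c : ℝ) (v : X → A → ℝ) (n : ℕ) (x : X) :
    vgo P π (fun x a => c * v x a) n x = c * vgo P π v n x := by
  induction n generalizing x with
  | zero => simp [vgo]
  | succ n ih =>
    simp only [vgo, ih, mul_add, Finset.sum_add_distrib, Finset.mul_sum, mul_left_comm c]

theorem vgo_sum {ι : Type*} (s : Finset ι) (v : ι → X → A → ℝ) (n : ℕ) (x : X) :
    vgo P π (fun x a => ∑ i ∈ s, v i x a) n x = ∑ i ∈ s, vgo P π (v i) n x := by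
  induction s using Finset.induction_on with
  | empty => simp [vgo_zero]
  | insert i s hi ih => simp only [Finset.sum_insert hi, vgo_add, ih]

/-- Rows need only have mass at most one, so that the bound covers the empirical transition
function, whose unvisited rows vanish. -/
theorem abs_vgo_le {v : X → A → ℝ} (hP : ∀ x a x', 0 ≤ P x a x')
    (hP' : ∀ x a, ∑ x', P x a x' ≤ 1) (hπ : IsPolicy π)
    (h : ∀ x a, |v x a| ≤ 1) (n : ℕ) (x : X) : |vgo P π v n x| ≤ n := by
  induction n generalizing x with
  | zero => simp [vgo]
  | succ n ih =>
    calc |vgo P π v (n + 1) x| ≤ ∑ a, π x a * (1 + n) := by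
          refine (Finset.abs_sum_le_sum_abs _ _).trans (Finset.sum_le_sum fun a _ => ?_)
          rw [abs_mul, abs_of_nonneg ((hπ x).1 a)]
          refine mul_le_mul_of_nonneg_left ((abs_add_le _ _).trans
            (add_le_add (h x a) ?_)) ((hπ x).1 a)
          calc |∑ x', P x a x' * vgo P π v n x'| ≤ ∑ x', P x a x' * n := by
                refine (Finset.abs_sum_le_sum_abs _ _).trans (Finset.sum_le_sum fun x' _ => ?_)
                rw [abs_mul, abs_of_nonneg (hP x a x')]
                exact mul_le_mul_of_nonneg_left (ih x') (hP x a x')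
            _ = (∑ x', P x a x') * n := by rw [Finset.sum_mul]
            _ ≤ 1 * n := mul_le_mul_of_nonneg_right (hP' x a) (Nat.cast_nonneg n)
            _ = n := one_mul _
      _ = ((n + 1 : ℕ) : ℝ) := by rw [← Finset.sum_mul, (hπ x).2]; push_cast; ring

theorem qgo_nonneg {v : X → A → ℝ} (hP : ∀ x a x', 0 ≤ P x a x') (hπ : IsPolicy π)
    (h : ∀ x a, 0 ≤ v x a) (n : ℕ) (x : X) (a : A) : 0 ≤ qgo P π v n x a :=
  add_nonneg (h x a) (Finset.sum_nonneg fun x' _ => mul_nonneg (hP _ _ _)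
    (vgo_nonneg hP hπ h n x'))

theorem qgo_le {v : X → A → ℝ} (hP : IsTransition 𝓛 P) (hπ : IsPolicy π)
    (h0 : ∀ x a, 0 ≤ v x a) (h : ∀ x a, v x a ≤ 1) (n : ℕ) (x : X) (a : A) :
    qgo P π v n x a ≤ n + 1 := by
  have hv : ∀ x', vgo P π v n x' ≤ n := fun x' => (le_abs_self _).trans
    (abs_vgo_le hP.1 hP.sum_le_one hπ (fun x a => abs_le.2 ⟨by linarith [h0 x a], h x a⟩) n x')
  calc qgo P π v n x a ≤ 1 + ∑ x', P x a x' * n :=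
        add_le_add (h x a) (Finset.sum_le_sum fun x' _ =>
          mul_le_mul_of_nonneg_left (hv x') (hP.1 x a x'))
    _ ≤ 1 + 1 * n := by
        rw [← Finset.sum_mul]
        gcongr
        exact hP.sum_le_one x a
    _ = n + 1 := by ring

end Stochastic

end Values

/-! ### Sums over paths and the Markov property -/

section Paths

variable {X A : Type*} [Fintype X] [Fintype A] {L : ℕ}

/-- The sum over all paths with `n` steps of a functional, the initial weights being `f₀`. -/
def pathSum (P : X → A → X → ℝ) (π : X → A → ℝ) (n : ℕ) (f₀ : X → ℝ)
    (F : (Fin (n + 1) → X) → (Fin n → A) → ℝ) : ℝ :=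
  ∑ s : Fin (n + 1) → X, ∑ b : Fin n → A, f₀ (s 0) *
    (∏ k : Fin n, π (s k.castSucc) (b k) * P (s k.castSucc) (b k) (s k.succ)) * F s b

/-- Peeling off the first transition turns it into new initial weights. This is why the weights `f₀`
are arbitrary: identities over paths become inductions on the length with `f₀` generalized. -/
theorem pathSum_succ (P : X → A → X → ℝ) (π : X → A → ℝ) (n : ℕ) (f₀ : X → ℝ)
    (F : (Fin (n + 2) → X) → (Fin (n + 1) → A) → ℝ) :
    pathSum P π (n + 1) f₀ F = ∑ x, ∑ a, pathSum P π n (fun y => f₀ x * (π x a * P x a y))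
      (fun s b => F (Fin.cons x s) (Fin.cons a b)) := by
  simp only [pathSum]
  rw [← (Fin.consEquiv fun _ : Fin (n + 2) => X).sum_comp, Fintype.sum_prod_type]
  refine Finset.sum_congr rfl fun x _ => ?_
  rw [Finset.sum_comm]
  rw [← (Fin.consEquiv fun _ : Fin (n + 1) => A).sum_comp, Fintype.sum_prod_type]
  refine Finset.sum_congr rfl fun a _ => ?_
  rw [Finset.sum_comm]
  refine Finset.sum_congr rfl fun s _ => Finset.sum_congr rfl fun b _ => ?_
  have e : F ((Fin.consEquiv fun _ => X) (x, s)) ((Fin.consEquiv fun _ => A) (a, b)) =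
    F (Fin.cons x s) (Fin.cons a b) := rfl
  rw [e]
  simp only [Fin.consEquiv_apply, Fin.prod_univ_succ, Fin.cons_zero, Fin.cons_succ,
    Fin.castSucc_zero, Fin.castSucc_succ]
  ring

theorem pathSum_add (P : X → A → X → ℝ) (π : X → A → ℝ) (n : ℕ) (f₀ : X → ℝ)
    (F G : (Fin (n + 1) → X) → (Fin n → A) → ℝ) :
    pathSum P π n f₀ (fun s b => F s b + G s b) = pathSum P π n f₀ F + pathSum P π n f₀ G := by
  simp only [pathSum, mul_add, Finset.sum_add_distrib]

theorem pathSum_smul (P : X → A → X → ℝ) (π : X → A → ℝ) (n : ℕ) (f₀ : X → ℝ) (c : ℝ)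
    (F : (Fin (n + 1) → X) → (Fin n → A) → ℝ) :
    pathSum P π n f₀ (fun s b => c * F s b) = c * pathSum P π n f₀ F := by
  simp only [pathSum, Finset.mul_sum, mul_left_comm c]

theorem pathSum_head (P : X → A → X → ℝ) (π : X → A → ℝ) (n : ℕ) (f₀ g : X → ℝ)
    (F : (Fin (n + 1) → X) → (Fin n → A) → ℝ) :
    pathSum P π n f₀ (fun s b => g (s 0) * F s b) = pathSum P π n (fun y => f₀ y * g y) F := by
  refine Finset.sum_congr rfl fun s _ => Finset.sum_congr rfl fun b _ => ?_
  ring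

theorem sum_pathSum {ι : Type*} (u : Finset ι) (P : X → A → X → ℝ) (π : X → A → ℝ) (n : ℕ)
    (f₀ : ι → X → ℝ) (F : (Fin (n + 1) → X) → (Fin n → A) → ℝ) :
    ∑ i ∈ u, pathSum P π n (f₀ i) F = pathSum P π n (fun y => ∑ i ∈ u, f₀ i y) F := by
  simp only [pathSum, Finset.sum_mul]
  rw [Finset.sum_comm]
  refine Finset.sum_congr rfl fun s _ => ?_
  rw [Finset.sum_comm]

theorem pathSum_tail (P : X → A → X → ℝ) (π : X → A → ℝ) (n : ℕ) (f₀ : X → ℝ)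
    (F : (Fin (n + 1) → X) → (Fin n → A) → ℝ) :
    ∑ x, ∑ a, pathSum P π n (fun y => f₀ x * (π x a * P x a y)) F =
      pathSum P π n (push P π f₀) F := by
  simp only [sum_pathSum]
  rfl

variable {𝓛 : Layering X L} {P : X → A → X → ℝ} {π : X → A → ℝ}

/-- Weights living `n` layers before the last one guarantee stochastic rows for all `n` remaining
steps; the induction needs this condition to survive one step. -/
theorem push_layer (hP : IsTransition 𝓛 P) {n : ℕ} {f₀ : X → ℝ}
    (hf : ∀ x, f₀ x ≠ 0 → 𝓛.layer x + (n + 1) = L) :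
    ∀ x, push P π f₀ x ≠ 0 → 𝓛.layer x + n = L := by
  intro x' h
  obtain ⟨x, -, h⟩ := Finset.exists_ne_zero_of_sum_ne_zero h
  obtain ⟨a, -, h⟩ := Finset.exists_ne_zero_of_sum_ne_zero h
  have h1 := hf x (left_ne_zero_of_mul h)
  have h2 := right_ne_zero_of_mul (right_ne_zero_of_mul h)
  have h3 := hP.2.1 x a x' (lt_of_le_of_ne (hP.1 _ _ _) (Ne.symm h2))
  omega

theorem sum_push (hP : IsTransition 𝓛 P) (hπ : IsPolicy π) {n : ℕ} {f₀ : X → ℝ}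
    (hf : ∀ x, f₀ x ≠ 0 → 𝓛.layer x + (n + 1) = L) :
    ∑ x, push P π f₀ x = ∑ x, f₀ x := by
  have h := sum_push_mul P π f₀ (fun _ => 1)
  simp only [mul_one] at h
  rw [h]
  refine Finset.sum_congr rfl fun x _ => ?_
  by_cases hx : f₀ x = 0
  · simp [hx]
  · have := hf x hx
    simp only [hP.2.2 x _ (show 𝓛.layer x < L by omega), mul_one, (hπ x).2]

theorem pathSum_one (hP : IsTransition 𝓛 P) (hπ : IsPolicy π) (n : ℕ) (f₀ : X → ℝ)
    (hf : ∀ x, f₀ x ≠ 0 → 𝓛.layer x + n = L) :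
    pathSum P π n f₀ (fun _ _ => 1) = ∑ x, f₀ x := by
  induction n generalizing f₀ with
  | zero =>
    simp only [pathSum, Finset.univ_eq_empty, Finset.prod_empty, mul_one, Finset.sum_const,
      Finset.card_univ, Fintype.card_pi, one_smul]
    exact (Equiv.funUnique (Fin 1) X).sum_comp f₀
  | succ n ih =>
    rw [pathSum_succ, pathSum_tail, ih _ (push_layer hP hf), sum_push hP hπ hf]

theorem pathSum_total (hP : IsTransition 𝓛 P) (hπ : IsPolicy π) (v : X → A → ℝ) (n : ℕ)
    (f₀ : X → ℝ) (hf : ∀ x, f₀ x ≠ 0 → 𝓛.layer x + n = L) :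
    pathSum P π n f₀ (fun s b => ∑ j : Fin n, v (s j.castSucc) (b j)) =
      ∑ x, f₀ x * vgo P π v n x := by
  induction n generalizing f₀ with
  | zero => simp [pathSum, vgo]
  | succ n ih =>
    simp only [pathSum_succ, Fin.sum_univ_succ, Fin.castSucc_zero, Fin.cons_zero, Fin.cons_succ,
      Fin.castSucc_succ, pathSum_add, Finset.sum_add_distrib]
    rw [pathSum_tail, ih _ (push_layer hP hf), sum_push_mul, ← Finset.sum_add_distrib]
    refine Finset.sum_congr rfl fun x _ => ?_
    have : ∀ a, pathSum P π n (fun y => f₀ x * (π x a * P x a y)) (fun _ _ => v x a) =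
        f₀ x * (π x a * v x a) := by
      intro a
      have h := pathSum_smul P π n (fun y => f₀ x * (π x a * P x a y)) (v x a) (fun _ _ => 1)
      simp only [mul_one] at h
      by_cases hx : f₀ x = 0
      · simp [pathSum, hx]
      have hl := hf x hx
      rw [h, pathSum_one hP hπ, ← Finset.mul_sum, ← Finset.mul_sum,
        hP.2.2 x a (by omega)]
      · ring
      · intro y hy
        have h2 := right_ne_zero_of_mul (right_ne_zero_of_mul hy)
        have := hP.2.1 x a y (lt_of_le_of_ne (hP.1 _ _ _) (Ne.symm h2))
        omega
    simp only [this, vgo]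
    rw [← Finset.mul_sum, ← mul_add, ← Finset.sum_add_distrib]
    simp only [mul_add]

/-- The Markov property at a visit of `(x, a)` at time `k`. -/
theorem pathSum_hit (hP : IsTransition 𝓛 P) (hπ : IsPolicy π) (v : X → A → ℝ) (f : X → ℝ)
    (x : X) (a : A) (n k : ℕ) (hk : k < n)
    (f₀ : X → ℝ) (hf : ∀ x, f₀ x ≠ 0 → 𝓛.layer x + n = L) :
    pathSum P π n f₀ (fun s b => ∑ i : Fin n,
      if (i : ℕ) = k ∧ s i.castSucc = x ∧ b i = a then
        f (s i.succ) + ∑ j : Fin n, (if i < j then v (s j.castSucc) (b j) else 0) else 0) =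
      ((push P π)^[k] f₀) x * π x a * ∑ y, P x a y * (f y + vgo P π v (n - (k + 1)) y) := by
  induction n generalizing f₀ k with
  | zero => omega
  | succ n ih =>
    cases k with
    -- A visit at a positive time does not involve the first transition: after peeling it off, the
    -- functional is the same one on the shorter path, at time `k`.
    | succ k =>
      rw [pathSum_succ, Function.iterate_succ_apply]
      have h : ∀ y c, (fun (s : Fin (n + 1) → X) (b : Fin n → A) => ∑ i : Fin (n + 1),
          if (i : ℕ) = k + 1 ∧ (Fin.cons y s : Fin (n + 2) → X) i.castSucc = x ∧
            (Fin.cons c b : Fin (n + 1) → A) i = a then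
          f ((Fin.cons y s : Fin (n + 2) → X) i.succ) + ∑ j : Fin (n + 1), (if i < j then
            v ((Fin.cons y s : Fin (n + 2) → X) j.castSucc)
              ((Fin.cons c b : Fin (n + 1) → A) j) else 0) else 0) =
          fun s b => ∑ i : Fin n, if (i : ℕ) = k ∧ s i.castSucc = x ∧ b i = a then
          f (s i.succ) + ∑ j : Fin n, (if i < j then v (s j.castSucc) (b j) else 0) else 0 := by
        intro y c
        funext s b
        simp [Fin.sum_univ_succ, Fin.castSucc_succ, Fin.succ_lt_succ_iff]
      simp only [h]
      rw [pathSum_tail, ih k (by omega) _ (push_layer hP hf)]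
      simp only [Nat.succ_sub_succ]
    -- The visit happens in the first step. The weights concentrate on `x` and `a`, and what is left
    -- is `f` at the first state of the tail plus the total payoff of the tail.
    | zero =>
      have h : ∀ y c, (fun (s : Fin (n + 1) → X) (b : Fin n → A) => ∑ i : Fin (n + 1),
          if (i : ℕ) = 0 ∧ (Fin.cons y s : Fin (n + 2) → X) i.castSucc = x ∧
            (Fin.cons c b : Fin (n + 1) → A) i = a then
          f ((Fin.cons y s : Fin (n + 2) → X) i.succ) + ∑ j : Fin (n + 1), (if i < j then
            v ((Fin.cons y s : Fin (n + 2) → X) j.castSucc)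
              ((Fin.cons c b : Fin (n + 1) → A) j) else 0) else 0) =
          fun s b => (if y = x ∧ c = a then 1 else 0) *
            (f (s 0) * 1 + ∑ j : Fin n, v (s j.castSucc) (b j)) := by
        intro y c
        funext s b
        simp [Fin.sum_univ_succ, Fin.castSucc_succ]
      rw [pathSum_succ]
      simp only [h]
      simp only [pathSum_smul]
      simp only [ite_and, ite_mul, one_mul, zero_mul, Finset.sum_ite_eq',
        Finset.mem_univ, if_true, Finset.sum_ite_irrel, Finset.sum_const_zero]
      have hl : ∀ y, f₀ x * (π x a * P x a y) ≠ 0 → 𝓛.layer y + n = L := by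
        intro y hy
        have h1 := hf x (left_ne_zero_of_mul hy)
        have h2 := right_ne_zero_of_mul (right_ne_zero_of_mul hy)
        have := hP.2.1 x a y (lt_of_le_of_ne (hP.1 _ _ _) (Ne.symm h2))
        omega
      rw [pathSum_add, pathSum_head, pathSum_total hP hπ v n _ hl, pathSum_one hP hπ n _
        (fun y hy => hl y (left_ne_zero_of_mul hy)), ← Finset.sum_add_distrib]
      simp only [Function.iterate_zero, id_eq, zero_add, Nat.add_sub_cancel, Finset.mul_sum]
      refine Finset.sum_congr rfl fun y _ => ?_
      ring

end Paths

/-! ### Trajectories, visits and their expectations -/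

section Trajectories

variable {X A : Type*} [Fintype X] [Fintype A] {L m : ℕ}

/-- A trajectory as a pair of functions. -/
def trajEquiv (X A : Type*) (L : ℕ) : Trajectory X A L ≃ (Fin (L + 1) → X) × (Fin L → A) where
  toFun τ := (τ.state, τ.act)
  invFun p := ⟨p.1, p.2⟩
  left_inv _ := rfl
  right_inv _ := rfl

instance : Fintype (Trajectory X A L) := Fintype.ofEquiv _ (trajEquiv X A L).symm

/-- The expectation of a functional of the trajectory. -/
def texp (𝓛 : Layering X L) (P : X → A → X → ℝ) (π : X → A → ℝ)
    (F : Trajectory X A L → ℝ) : ℝ := ∑ τ, trajProb 𝓛 P π τ * F τ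

/-- The trajectory starts in the initial state and makes only transitions of positive
probability. -/
def Follows (𝓛 : Layering X L) (P : X → A → X → ℝ) (τ : Trajectory X A L) : Prop :=
  τ.state 0 = 𝓛.start ∧ ∀ k : Fin L, 0 < P (τ.state k.castSucc) (τ.act k) (τ.state k.succ)

/-- The trajectory visits the pair `(x, a)`. -/
def Hits (τ : Trajectory X A L) (x : X) (a : A) : Prop :=
  ∃ k : Fin L, τ.state k.castSucc = x ∧ τ.act k = a

/-- The trajectory visits the pair `(x, a)` and moves to `y`. -/
def HitsTo (τ : Trajectory X A L) (x : X) (a : A) (y : X) : Prop :=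
  ∃ k : Fin L, τ.state k.castSucc = x ∧ τ.act k = a ∧ τ.state k.succ = y

/-- The sum of `f` at the successor of a visit of `(x, a)` and of `v` at the later pairs. -/
def hitSum (𝓛 : Layering X L) (f : X → ℝ) (v : X → A → ℝ) (x : X) (a : A)
    (τ : Trajectory X A L) : ℝ :=
  ∑ i : Fin L, if (i : ℕ) = 𝓛.layer x ∧ τ.state i.castSucc = x ∧ τ.act i = a then
    f (τ.state i.succ) + ∑ j : Fin L, (if i < j then v (τ.state j.castSucc) (τ.act j) else 0)
    else 0

theorem texp_eq_pathSum (𝓛 : Layering X L) (P : X → A → X → ℝ) (π : X → A → ℝ)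
    (F : Trajectory X A L → ℝ) :
    texp 𝓛 P π F = pathSum P π L (stateProb 𝓛 P π 0) (fun s b => F ⟨s, b⟩) := by
  rw [texp, ← (trajEquiv X A L).symm.sum_comp, Fintype.sum_prod_type]
  rfl

variable {𝓛 : Layering X L} {P : X → A → X → ℝ} {π : X → A → ℝ}

theorem trajProb_nonneg (hP : IsTransition 𝓛 P) (hπ : IsPolicy π) (τ : Trajectory X A L) :
    0 ≤ trajProb 𝓛 P π τ :=
  mul_nonneg (by split_ifs <;> norm_num)
    (Finset.prod_nonneg fun k _ => mul_nonneg ((hπ _).1 _) (hP.1 _ _ _))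

theorem follows_of_trajProb_ne_zero (hP : IsTransition 𝓛 P) {τ : Trajectory X A L}
    (h : trajProb 𝓛 P π τ ≠ 0) : Follows 𝓛 P τ := by
  refine ⟨?_, fun k => ?_⟩
  · by_contra h'
    exact h (by simp [trajProb, h'])
  · have h1 := right_ne_zero_of_mul h
    have h2 := (Finset.prod_ne_zero_iff.1 h1) k (Finset.mem_univ k)
    exact lt_of_le_of_ne (hP.1 _ _ _) (right_ne_zero_of_mul h2).symm

theorem Follows.layer_state (hP : IsTransition 𝓛 P) {τ : Trajectory X A L}
    (h : Follows 𝓛 P τ) (k : Fin (L + 1)) : 𝓛.layer (τ.state k) = k := by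
  induction k using Fin.induction with
  | zero => rw [h.1]; exact (𝓛.layer_eq_zero _).2 rfl
  | succ i ih => rw [hP.2.1 _ _ _ (h.2 i), ih]; simp

/-- Only trajectories of positive probability matter; on them the time of a state is its layer, so a
pair is visited at one possible time. -/
theorem texp_congr (hP : IsTransition 𝓛 P) {F G : Trajectory X A L → ℝ}
    (h : ∀ τ, Follows 𝓛 P τ → F τ = G τ) : texp 𝓛 P π F = texp 𝓛 P π G := by
  refine Finset.sum_congr rfl fun τ _ => ?_
  by_cases hτ : trajProb 𝓛 P π τ = 0
  · simp [hτ]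
  · rw [h τ (follows_of_trajProb_ne_zero hP hτ)]

theorem texp_mono (hP : IsTransition 𝓛 P) (hπ : IsPolicy π) {F G : Trajectory X A L → ℝ}
    (h : ∀ τ, Follows 𝓛 P τ → F τ ≤ G τ) : texp 𝓛 P π F ≤ texp 𝓛 P π G := by
  refine Finset.sum_le_sum fun τ _ => ?_
  by_cases hτ : trajProb 𝓛 P π τ = 0
  · simp [hτ]
  · exact mul_le_mul_of_nonneg_left (h τ (follows_of_trajProb_ne_zero hP hτ))
      (trajProb_nonneg hP hπ τ)

theorem texp_add (F G : Trajectory X A L → ℝ) :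
    texp 𝓛 P π (fun τ => F τ + G τ) = texp 𝓛 P π F + texp 𝓛 P π G := by
  simp only [texp, mul_add, Finset.sum_add_distrib]

theorem texp_smul (c : ℝ) (F : Trajectory X A L → ℝ) :
    texp 𝓛 P π (fun τ => c * F τ) = c * texp 𝓛 P π F := by
  simp only [texp, Finset.mul_sum, mul_left_comm c]

theorem texp_sum {ι : Type*} (s : Finset ι) (F : ι → Trajectory X A L → ℝ) :
    texp 𝓛 P π (fun τ => ∑ i ∈ s, F i τ) = ∑ i ∈ s, texp 𝓛 P π (F i) := by
  simp only [texp, Finset.mul_sum]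
  rw [Finset.sum_comm]

theorem stateProb_zero_layer (x : X) (h : stateProb 𝓛 P π 0 x ≠ 0) : 𝓛.layer x + L = L := by
  have : x = 𝓛.start := by
    by_contra h'
    exact h (by simp [stateProb, h'])
  rw [this, (𝓛.layer_eq_zero _).2 rfl, zero_add]

theorem sum_trajProb (hP : IsTransition 𝓛 P) (hπ : IsPolicy π) :
    ∑ τ, trajProb 𝓛 P π τ = 1 := by
  have h := texp_eq_pathSum 𝓛 P π (fun _ => 1)
  rw [pathSum_one hP hπ L _ stateProb_zero_layer, sum_stateProb hP hπ (Nat.zero_le L)] at h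
  simpa [texp] using h

theorem texp_const (hP : IsTransition 𝓛 P) (hπ : IsPolicy π) (c : ℝ) :
    texp 𝓛 P π (fun _ => c) = c := by
  rw [texp, ← Finset.sum_mul, sum_trajProb hP hπ, one_mul]

/-- One formula for all first moments that occur: `f = 1`, `v = 0` counts visits, an indicator `f`
counts transitions, and `v = ℓ` gives the loss from the visit on. -/
theorem texp_hitSum (hP : IsTransition 𝓛 P) (hπ : IsPolicy π) (f : X → ℝ) (v : X → A → ℝ)
    {x : X} (a : A) (hx : 𝓛.layer x < L) :
    texp 𝓛 P π (hitSum 𝓛 f v x a) =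
      occ 𝓛 P π x a * ∑ y, P x a y * (f y + vgo P π v (L - (𝓛.layer x + 1)) y) := by
  rw [texp_eq_pathSum]
  have h := pathSum_hit hP hπ v f x a L (𝓛.layer x) hx (stateProb 𝓛 P π 0) stateProb_zero_layer
  rw [← stateProb_eq_iterate] at h
  exact h

/-- A visit of `(x, a)` takes place at the time given by the layer of `x`. -/
theorem hitSum_eq (τ : Trajectory X A L)
    (f : X → ℝ) (v : X → A → ℝ) (x : X) (a : A) {k : Fin L} (hk : (k : ℕ) = 𝓛.layer x) :
    hitSum 𝓛 f v x a τ = if τ.state k.castSucc = x ∧ τ.act k = a then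
      f (τ.state k.succ) + ∑ j : Fin L, (if k < j then v (τ.state j.castSucc) (τ.act j) else 0)
      else 0 := by
  rw [hitSum, Finset.sum_eq_single_of_mem k (Finset.mem_univ k)]
  · simp [hk]
  · intro i _ hi
    have : ¬ (i : ℕ) = 𝓛.layer x := fun h' => hi (Fin.ext (h'.trans hk.symm))
    simp [this]

theorem Follows.eq_layer (hP : IsTransition 𝓛 P) {τ : Trajectory X A L} (h : Follows 𝓛 P τ)
    {x : X} {k : Fin L} (hk : τ.state k.castSucc = x) : (k : ℕ) = 𝓛.layer x := by
  rw [← hk, h.layer_state hP]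
  rfl

theorem Follows.hits_iff (hP : IsTransition 𝓛 P) {τ : Trajectory X A L} (h : Follows 𝓛 P τ)
    (x : X) (a : A) {k : Fin L} (hk : (k : ℕ) = 𝓛.layer x) :
    Hits τ x a ↔ τ.state k.castSucc = x ∧ τ.act k = a := by
  constructor
  · rintro ⟨i, hi, ha⟩
    have : i = k := Fin.ext ((h.eq_layer hP hi).trans hk.symm)
    rw [← this]
    exact ⟨hi, ha⟩
  · exact fun h' => ⟨k, h'⟩

theorem Follows.hitsTo_iff (hP : IsTransition 𝓛 P) {τ : Trajectory X A L} (h : Follows 𝓛 P τ)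
    (x : X) (a : A) (x' : X) {k : Fin L} (hk : (k : ℕ) = 𝓛.layer x) :
    HitsTo τ x a x' ↔ (τ.state k.castSucc = x ∧ τ.act k = a) ∧ τ.state k.succ = x' := by
  constructor
  · rintro ⟨i, hi, ha, hx'⟩
    have : i = k := Fin.ext ((h.eq_layer hP hi).trans hk.symm)
    rw [← this]
    exact ⟨⟨hi, ha⟩, hx'⟩
  · exact fun h' => ⟨k, h'.1.1, h'.1.2, h'.2⟩

theorem Follows.ite_hits (hP : IsTransition 𝓛 P) {τ : Trajectory X A L} (h : Follows 𝓛 P τ)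
    {x : X} (a : A) (hx : 𝓛.layer x < L) :
    (if Hits τ x a then (1 : ℝ) else 0) = hitSum 𝓛 (fun _ => 1) (fun _ _ => 0) x a τ := by
  have hk : ((⟨𝓛.layer x, hx⟩ : Fin L) : ℕ) = 𝓛.layer x := rfl
  rw [hitSum_eq τ _ _ x a hk]
  simp [h.hits_iff hP x a hk]

theorem Follows.ite_hitsTo (hP : IsTransition 𝓛 P) {τ : Trajectory X A L} (h : Follows 𝓛 P τ)
    {x : X} (a : A) (x' : X) (hx : 𝓛.layer x < L) :
    (if HitsTo τ x a x' then (1 : ℝ) else 0) =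
      hitSum 𝓛 (fun y => if y = x' then 1 else 0) (fun _ _ => 0) x a τ := by
  have hk : ((⟨𝓛.layer x, hx⟩ : Fin L) : ℕ) = 𝓛.layer x := rfl
  rw [hitSum_eq τ _ _ x a hk]
  simp only [h.hitsTo_iff hP x a x' hk, ite_and]
  simp

theorem texp_hits (hP : IsTransition 𝓛 P) (hπ : IsPolicy π) {x : X} (a : A)
    (hx : 𝓛.layer x < L) :
    texp 𝓛 P π (fun τ => if Hits τ x a then (1 : ℝ) else 0) = occ 𝓛 P π x a := by
  rw [texp_congr hP fun τ hτ => hτ.ite_hits hP a hx, texp_hitSum hP hπ _ _ a hx]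
  simp [vgo_zero, hP.2.2 x a hx]

theorem texp_hitsTo (hP : IsTransition 𝓛 P) (hπ : IsPolicy π) {x : X} (a : A) (x' : X)
    (hx : 𝓛.layer x < L) :
    texp 𝓛 P π (fun τ => if HitsTo τ x a x' then (1 : ℝ) else 0) =
      occ 𝓛 P π x a * P x a x' := by
  rw [texp_congr hP fun τ hτ => hτ.ite_hitsTo hP a x' hx, texp_hitSum hP hπ _ _ a hx]
  simp [vgo_zero]

theorem HitsTo.hits {τ : Trajectory X A L} {x : X} {a : A} {x' : X} (h : HitsTo τ x a x') :
    Hits τ x a := by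
  obtain ⟨k, h1, h2, -⟩ := h
  exact ⟨k, h1, h2⟩

/-- The loss suffered from the visit of `(x, a)` on. -/
def lossFrom (ℓ : X → A → ℝ) (x : X) (a : A) (τ : Trajectory X A L) : ℝ :=
  ∑ k : Fin L, if τ.state k.castSucc = x ∧ τ.act k = a then
    ∑ j ∈ Finset.Ici k, ℓ (τ.state j.castSucc) (τ.act j) else 0

theorem qEst_eq (γ : ℝ) (S : Set (X → A → X → ℝ)) (τ : Trajectory X A L)
    (ℓ : X → A → ℝ) (x : X) (a : A) :
    qEst 𝓛 γ S π τ ℓ x a = lossFrom ℓ x a τ / (occUp 𝓛 S π x a + γ) := by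
  rw [qEst, lossFrom, Finset.sum_div]
  refine Finset.sum_congr rfl fun k _ => ?_
  split_ifs <;> simp

theorem Follows.lossFrom_eq (hP : IsTransition 𝓛 P) {τ : Trajectory X A L} (h : Follows 𝓛 P τ)
    (ℓ : X → A → ℝ) {x : X} (a : A) {k : Fin L} (hk : (k : ℕ) = 𝓛.layer x) :
    lossFrom ℓ x a τ = if τ.state k.castSucc = x ∧ τ.act k = a then
      ∑ j ∈ Finset.Ici k, ℓ (τ.state j.castSucc) (τ.act j) else 0 := by
  rw [lossFrom, Finset.sum_eq_single_of_mem k (Finset.mem_univ k)]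
  intro i _ hi
  refine if_neg fun h' => hi (Fin.ext ((h.eq_layer hP h'.1).trans hk.symm))

theorem Follows.lossFrom_eq_hitSum (hP : IsTransition 𝓛 P) {τ : Trajectory X A L}
    (h : Follows 𝓛 P τ) (ℓ : X → A → ℝ) {x : X} (a : A) (hx : 𝓛.layer x < L) :
    lossFrom ℓ x a τ = hitSum 𝓛 (fun _ => ℓ x a) ℓ x a τ := by
  have hk : ((⟨𝓛.layer x, hx⟩ : Fin L) : ℕ) = 𝓛.layer x := rfl
  rw [hitSum_eq τ _ _ x a hk, h.lossFrom_eq hP ℓ a hk]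
  refine if_ctx_congr Iff.rfl (fun h' => ?_) fun _ => rfl
  -- The loss at the visited pair is a constant on the event, so it is carried by the function of
  -- the successor; the remaining losses have indices strictly above `k`.
  rw [← Finset.Ioi_insert, Finset.sum_insert (by simp), h'.1, h'.2, ← Finset.sum_filter]
  congr 2
  ext j
  simp

/-- Dividing by the true occupancy would give an unbiased estimator of the action value. The
algorithm divides by `occUp + γ` instead, and the local bonus pays for the discrepancy. -/
theorem texp_lossFrom (hP : IsTransition 𝓛 P) (hπ : IsPolicy π) (ℓ : X → A → ℝ) {x : X} (a : A)
    (hx : 𝓛.layer x < L) :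
    texp 𝓛 P π (lossFrom ℓ x a) = occ 𝓛 P π x a * qgo P π ℓ (L - (𝓛.layer x + 1)) x a := by
  rw [texp_congr hP fun τ hτ => hτ.lossFrom_eq_hitSum hP ℓ a hx, texp_hitSum hP hπ _ _ a hx]
  simp only [mul_add, Finset.sum_add_distrib, ← Finset.sum_mul, hP.2.2 x a hx, one_mul, qgo]

theorem Follows.lossFrom_mem (hP : IsTransition 𝓛 P) {τ : Trajectory X A L}
    (h : Follows 𝓛 P τ) {ℓ : X → A → ℝ} (h0 : ∀ x a, 0 ≤ ℓ x a) (h1 : ∀ x a, ℓ x a ≤ 1) {x : X}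
    (a : A) (hx : 𝓛.layer x < L) :
    0 ≤ lossFrom ℓ x a τ ∧ lossFrom ℓ x a τ ≤ L * (if Hits τ x a then 1 else 0) := by
  have hk : ((⟨𝓛.layer x, hx⟩ : Fin L) : ℕ) = 𝓛.layer x := rfl
  rw [h.lossFrom_eq hP ℓ a hk]
  simp only [h.hits_iff hP x a hk]
  split_ifs
  · refine ⟨Finset.sum_nonneg fun j _ => h0 _ _, ?_⟩
    calc _ ≤ ∑ j ∈ Finset.Ici (⟨𝓛.layer x, hx⟩ : Fin L), (1 : ℝ) :=
          Finset.sum_le_sum fun j _ => h1 _ _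
      _ ≤ ∑ j : Fin L, (1 : ℝ) := Finset.sum_le_sum_of_subset_of_nonneg (Finset.subset_univ _)
          fun _ _ _ => zero_le_one
      _ = L * 1 := by simp
  · simp

end Trajectories

/-! ### Compactness of the confidence sets and measurability of the policies -/

section Compact

variable {X A : Type*} [Fintype X] [Fintype A] {L m : ℕ}

theorem isClosed_isTransition (𝓛 : Layering X L) :
    IsClosed {P : X → A → X → ℝ | IsTransition 𝓛 P} := by
  have hc : ∀ x a x', Continuous fun P : X → A → X → ℝ => P x a x' := fun x a x' => by fun_prop
  simp only [IsTransition, Set.ofPred_and, Set.ofPred_forall]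
  refine IsClosed.inter ?_ (IsClosed.inter ?_ ?_)
  · exact isClosed_iInter fun x => isClosed_iInter fun a => isClosed_iInter fun x' =>
      isClosed_le continuous_const (hc x a x')
  · refine isClosed_iInter fun x => isClosed_iInter fun a => isClosed_iInter fun x' => ?_
    -- Although stated with a strict inequality, the layer condition is closed: for layers that are
    -- not consecutive it says that the entry is at most zero.
    by_cases h : 𝓛.layer x' = 𝓛.layer x + 1
    · simp [h]
    · simp only [h, imp_false, not_lt]
      exact isClosed_le (hc x a x') continuous_const
  · refine isClosed_iInter fun x => isClosed_iInter fun a => isClosed_iInter fun _ => ?_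
    exact isClosed_eq (continuous_finsetSum _ fun x' _ => hc x a x') continuous_const

/-- Compactness is used twice: extrema over the set depend continuously on parameters, which makes
the policies measurable, and suprema are attained, which yields an optimistic transition function
for the bonus. -/
theorem isCompact_confSet (𝓛 : Layering X L) (T : ℕ) (δ : ℝ) (h : ℕ → Episode X A L m) (t : ℕ) :
    IsCompact (confSet 𝓛 T δ h t) := by
  refine (isCompact_Icc (a := (0 : X → A → X → ℝ)) (b := 1)).of_isClosed_subset ?_
    fun P hP => ⟨fun x a x' => hP.1.1 x a x', fun x a x' => hP.1.le_one x a x'⟩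
  rw [confSet, Set.ofPred_and]
  refine (isClosed_isTransition 𝓛).inter ?_
  simp only [Set.ofPred_forall]
  refine isClosed_iInter fun x => isClosed_iInter fun a => isClosed_iInter fun x' =>
    isClosed_iInter fun _ => isClosed_le ?_ continuous_const
  fun_prop

theorem continuous_stateProb (𝓛 : Layering X L) (k : ℕ) (x : X) :
    Continuous fun p : (X → A → ℝ) × (X → A → X → ℝ) => stateProb 𝓛 p.2 p.1 k x := by
  induction k generalizing x with
  | zero => exact continuous_const
  | succ k ih =>
    simp only [stateProb_succ_apply]
    fun_prop

theorem continuous_occ (𝓛 : Layering X L) (x : X) (a : A) :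
    Continuous fun p : (X → A → ℝ) × (X → A → X → ℝ) => occ 𝓛 p.2 p.1 x a :=
  (continuous_stateProb 𝓛 _ x).mul (by fun_prop)

theorem continuous_occUp (𝓛 : Layering X L) {S : Set (X → A → X → ℝ)} (hS : IsCompact S) (x : X)
    (a : A) : Continuous fun π : X → A → ℝ => occUp 𝓛 S π x a :=
  hS.continuous_sSup (f := fun π P => occ 𝓛 P π x a) (continuous_occ 𝓛 x a)

theorem continuous_occLow (𝓛 : Layering X L) {S : Set (X → A → X → ℝ)} (hS : IsCompact S) (x : X)
    (a : A) : Continuous fun π : X → A → ℝ => occLow 𝓛 S π x a :=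
  hS.continuous_sInf (f := fun π P => occ 𝓛 P π x a) (continuous_occ 𝓛 x a)

theorem measurable_localBonus (𝓛 : Layering X L) (γ : ℝ) {S : Set (X → A → X → ℝ)}
    (hS : IsCompact S) (x : X) : Measurable fun π : X → A → ℝ => localBonus 𝓛 γ S π x := by
  have h1 := fun a => (continuous_occUp 𝓛 hS x a).measurable
  have h2 := fun a => (continuous_occLow 𝓛 hS x a).measurable
  simp only [localBonus]
  fun_prop

/-- The supremum of linear functionals over a compact set is continuous in the vector of next
values, hence can be composed with the values already known to be measurable. -/
theorem measurable_bonusAux (𝓛 : Layering X L) (γ : ℝ) {S : Set (X → A → X → ℝ)}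
    (hS : IsCompact S) (n : ℕ) (x : X) (a : A) :
    Measurable fun π : X → A → ℝ => bonusAux 𝓛 γ S π n x a := by
  induction n generalizing x a with
  | zero => exact measurable_const
  | succ n ih =>
    have h1 := measurable_localBonus 𝓛 γ hS x
    have h2 : Continuous fun w : X → ℝ => sSup ((fun P : X → A → X → ℝ =>
        ∑ x', P x a x' * w x') '' S) :=
      hS.continuous_sSup (f := fun (w : X → ℝ) (P : X → A → X → ℝ) => ∑ x', P x a x' * w x')
        (by fun_prop)
    have h3 : Measurable fun (π : X → A → ℝ) (x' : X) =>
        ∑ a', π x' a' * bonusAux 𝓛 γ S π n x' a' := by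
      refine measurable_pi_lambda _ fun x' => Finset.measurable_sum _ fun a' _ => ?_
      exact Measurable.mul (by fun_prop) (ih x' a')
    exact h1.add ((h2.measurable.comp h3).const_mul _)

end Compact

/-! ### Dependence of counters and confidence sets on past trajectories only -/

section Dependence

variable {X A : Type*} [Fintype X] [Fintype A] {L m : ℕ} {h h' : ℕ → Episode X A L m} {t : ℕ}

theorem visited_congr {e e' : Episode X A L m} (he : e.1 = e'.1) (x : X) (a : A) :
    Visited e x a ↔ Visited e' x a := by simp only [Visited, he]

theorem visitedTo_congr {e e' : Episode X A L m} (he : e.1 = e'.1) (x : X) (a : A) (x' : X) :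
    VisitedTo e x a x' ↔ VisitedTo e' x a x' := by simp only [VisitedTo, he]

theorem visits_congr (hh : ∀ s < t, (h s).1 = (h' s).1) : visits h t = visits h' t := by
  funext x a
  refine congrArg _ (Finset.filter_congr fun s hs => ?_)
  exact visited_congr (hh s (Finset.mem_range.1 hs)) x a

theorem transits_congr (hh : ∀ s < t, (h s).1 = (h' s).1) : transits h t = transits h' t := by
  funext x a x'
  refine congrArg _ (Finset.filter_congr fun s hs => ?_)
  exact visitedTo_congr (hh s (Finset.mem_range.1 hs)) x a x'

theorem den_congr (hh : ∀ s < t, (h s).1 = (h' s).1) : den h t = den h' t := by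
  funext x a
  simp only [den, visits_congr hh]

theorem pHat_congr (hh : ∀ s < t, (h s).1 = (h' s).1) : pHat h t = pHat h' t := by
  funext x a x'
  simp only [pHat, den_congr hh, transits_congr hh]

theorem epochStart_le (h : ℕ → Episode X A L m) (t : ℕ) : epochStart h t ≤ t := by
  induction t with
  | zero => exact le_rfl
  | succ t ih =>
    rw [epochStart]
    split_ifs
    · exact le_rfl
    · omega

theorem epochStart_congr (hh : ∀ s < t, (h s).1 = (h' s).1) :
    epochStart h t = epochStart h' t := by
  induction t with
  | zero => rfl
  | succ t ih =>
    have ih' := ih fun s hs => hh s (by omega)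
    have h1 : visits h (epochStart h t) = visits h' (epochStart h t) :=
      visits_congr fun s hs => hh s (by have := epochStart_le h t; omega)
    rw [epochStart, epochStart, ← ih', h1, visits_congr hh]
    simp only [visited_congr (hh t (by omega))]

theorem confSet_congr (𝓛 : Layering X L) (T : ℕ) (δ : ℝ)
    (hh : ∀ s < t, (h s).1 = (h' s).1) : confSet 𝓛 T δ h t = confSet 𝓛 T δ h' t := by
  have hh' : ∀ s < epochStart h t, (h s).1 = (h' s).1 := fun s hs =>
    hh s (hs.trans_le (epochStart_le h t))
  simp only [confSet, confWidth, ← epochStart_congr hh, pHat_congr hh', den_congr hh']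

end Dependence

/-! ### Measurability of the estimators and policies -/

section Measurability

variable {X A : Type*} [Fintype X] [Fintype A] {L m : ℕ} {Ω : Type*} [MeasurableSpace Ω]
  {h : Ω → ℕ → Episode X A L m} {t : ℕ}

/-- A function that depends on the history only through the trajectories is measurable. -/
theorem measurable_of_traj {E : Type*} [MeasurableSpace E] {u : Ω → E}
    (hh : ∀ s < t, Measurable fun ω => h ω s) (g : (ℕ → Episode X A L m) → E → ℝ)
    (hg : ∀ k k' : ℕ → Episode X A L m, (∀ s < t, (k s).1 = (k' s).1) → g k = g k')
    (hu : Measurable u) (hgu : ∀ ω, Measurable (g (h ω))) :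
    Measurable fun ω => g (h ω) (u ω) := by
  have htr : Measurable fun ω => (fun s : Fin t => (h ω s).1) :=
    measurable_pi_lambda _ fun s => measurable_fst.comp (hh s s.2)
  intro B hB
  -- There are finitely many initial segments of trajectories. On each fibre `g (h ω)` is one fixed
  -- measurable function, read off at any point `ω₀` of the fibre.
  have : (fun ω => g (h ω) (u ω)) ⁻¹' B = ⋃ c : Fin t → Trajectory X A L,
      {ω | (fun s : Fin t => (h ω s).1) = c} ∩
        {ω | ∃ ω₀, (fun s : Fin t => (h ω₀ s).1) = c ∧ g (h ω₀) (u ω) ∈ B} := by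
    ext ω
    simp only [Set.mem_preimage, Set.mem_iUnion, Set.mem_inter_iff, Set.mem_ofPred_eq,
      exists_eq_left']
    constructor
    · exact fun h1 => ⟨ω, rfl, h1⟩
    · rintro ⟨ω₀, h1, h2⟩
      rwa [hg (h ω) (h ω₀) fun s hs => (congrFun h1 ⟨s, hs⟩).symm]
  rw [this]
  refine MeasurableSet.iUnion fun c => ?_
  by_cases hc : ∃ ω₀, (fun s : Fin t => (h ω₀ s).1) = c
  · obtain ⟨ω₀, h0⟩ := hc
    have : {ω | ∃ ω₀, (fun s : Fin t => (h ω₀ s).1) = c ∧ g (h ω₀) (u ω) ∈ B} =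
        u ⁻¹' (g (h ω₀) ⁻¹' B) := by
      ext ω
      constructor
      · rintro ⟨ω₁, h1, h2⟩
        rwa [hg (h ω₁) (h ω₀) fun s hs => congrFun (h1.trans h0.symm) ⟨s, hs⟩] at h2
      · exact fun h1 => ⟨ω₀, h0, h1⟩
    rw [this]
    exact (htr (measurableSet_singleton c)).inter (hu (hgu ω₀ hB))
  · convert MeasurableSet.empty
    ext ω
    simp only [Set.mem_inter_iff, Set.mem_ofPred_eq, Set.mem_empty_iff_false, iff_false]
    exact fun h' => hc ⟨ω, h'.1⟩

theorem measurable_of_traj' (hh : ∀ s < t, Measurable fun ω => h ω s)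
    (g : (ℕ → Episode X A L m) → ℝ)
    (hg : ∀ k k' : ℕ → Episode X A L m, (∀ s < t, (k s).1 = (k' s).1) → g k = g k') :
    Measurable fun ω => g (h ω) :=
  measurable_of_traj hh (fun k (_ : Unit) => g k) (fun k k' hk => by simp only [hg k k' hk])
    (measurable_const (a := ())) fun _ => measurable_const

theorem measurable_den (hh : ∀ s < t, Measurable fun ω => h ω s) (x : X) (a : A) :
    Measurable fun ω => den (h ω) t x a :=
  measurable_of_traj' hh (fun k => den k t x a) fun k k' hk => by rw [den_congr hk]

theorem measurable_pHat (hh : ∀ s < t, Measurable fun ω => h ω s) (x : X) (a : A) (x' : X) :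
    Measurable fun ω => pHat (h ω) t x a x' :=
  measurable_of_traj' hh (fun k => pHat k t x a x') fun k k' hk => by rw [pHat_congr hk]

theorem measurableSet_visited (x : X) (a : A) :
    MeasurableSet {e : Episode X A L m | Visited e x a} :=
  measurable_fst (show MeasurableSet {τ : Trajectory X A L | Hits τ x a} from trivial)

theorem measurable_reward (x : X) (a : A) :
    Measurable fun e : Episode X A L m => e.2.1 x a := by fun_prop

theorem measurable_costs (i : Fin m) (x : X) (a : A) :
    Measurable fun e : Episode X A L m => e.2.2 i x a := by fun_prop

theorem measurable_rHat (hh : ∀ s < t, Measurable fun ω => h ω s) (x : X) (a : A) :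
    Measurable fun ω => rHat (h ω) t x a := by
  refine Measurable.div (Finset.measurable_sum _ fun s hs => ?_) (measurable_den hh x a)
  have hs := hh s (Finset.mem_range.1 hs)
  exact Measurable.ite (hs (measurableSet_visited x a)) ((measurable_reward x a).comp hs)
    measurable_const

theorem measurable_gHat (hh : ∀ s < t, Measurable fun ω => h ω s) (i : Fin m) (x : X) (a : A) :
    Measurable fun ω => gHat (h ω) t i x a := by
  refine Measurable.div (Finset.measurable_sum _ fun s hs => ?_) (measurable_den hh x a)
  have hs := hh s (Finset.mem_range.1 hs)
  exact Measurable.ite (hs (measurableSet_visited x a)) ((measurable_costs i x a).comp hs)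
    measurable_const

theorem measurable_rUp (T : ℕ) (δ : ℝ) (hh : ∀ s < t, Measurable fun ω => h ω s) (x : X) (a : A) :
    Measurable fun ω => rUp T δ (h ω) t x a := by
  have h1 := measurable_den hh x a
  have h2 := measurable_rHat hh x a
  simp only [rUp, phi]
  exact h2.add (measurable_const.min (Real.continuous_sqrt.measurable.comp (h1.const_div _)))

theorem measurable_gLow (T : ℕ) (δ : ℝ) (hh : ∀ s < t, Measurable fun ω => h ω s) (i : Fin m)
    (x : X) (a : A) : Measurable fun ω => gLow T δ (h ω) t i x a := by
  have h1 := measurable_den hh x a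
  have h2 := measurable_gHat hh i x a
  simp only [gLow, xi]
  exact h2.sub (measurable_const.min (Real.continuous_sqrt.measurable.comp (h1.const_div _)))

theorem measurable_stateProb (𝓛 : Layering X L) {P : Ω → X → A → X → ℝ} {π : Ω → X → A → ℝ}
    (hP : ∀ x a x', Measurable fun ω => P ω x a x') (hπ : ∀ x a, Measurable fun ω => π ω x a)
    (k : ℕ) (x : X) : Measurable fun ω => stateProb 𝓛 (P ω) (π ω) k x := by
  induction k generalizing x with
  | zero => exact measurable_const
  | succ k ih =>
    simp only [stateProb_succ_apply]
    exact Finset.measurable_sum _ fun y _ => Finset.measurable_sum _ fun a _ =>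
      ((ih y).mul (hπ y a)).mul (hP y a x)

theorem measurable_value (𝓛 : Layering X L) {P : Ω → X → A → X → ℝ} {π v : Ω → X → A → ℝ}
    (hP : ∀ x a x', Measurable fun ω => P ω x a x') (hπ : ∀ x a, Measurable fun ω => π ω x a)
    (hv : ∀ x a, Measurable fun ω => v ω x a) :
    Measurable fun ω => value 𝓛 (P ω) (π ω) (v ω) :=
  Finset.measurable_sum _ fun k _ => Finset.measurable_sum _ fun x _ =>
    Finset.measurable_sum _ fun a _ =>
      ((measurable_stateProb 𝓛 hP hπ k x).mul (hπ x a)).mul (hv x a)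

variable (M : Model X A L m) (T : ℕ) (δ : ℝ)

theorem measurable_scaledLoss (hh : ∀ s < t, Measurable fun ω => h ω s) {π : Ω → X → A → ℝ}
    (hπ : ∀ x a, Measurable fun ω => π ω x a) (x : X) (a : A) :
    Measurable fun ω => scaledLoss M T δ (h ω) t (π ω) x a := by
  have hd : ∀ i, Measurable fun ω => dual M T δ (h ω) t (π ω) i := fun i =>
    Measurable.ite (measurableSet_lt measurable_const (measurable_value M.lay
      (measurable_pHat hh) hπ (measurable_gLow T δ hh i))) measurable_const measurable_const
  have hr := measurable_rUp T δ hh x a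
  have hg := fun i => measurable_gLow T δ hh i x a
  simp only [scaledLoss, loss]
  fun_prop

theorem measurable_occUp (hh : ∀ s < t, Measurable fun ω => h ω s) {π : Ω → X → A → ℝ}
    (hπ : ∀ x a, Measurable fun ω => π ω x a) (x : X) (a : A) :
    Measurable fun ω => occUp M.lay (confSet M.lay T δ (h ω) t) (π ω) x a :=
  measurable_of_traj hh (fun k π => occUp M.lay (confSet M.lay T δ k t) π x a)
    (fun k k' hk => by rw [confSet_congr M.lay T δ hk])
    (measurable_pi_lambda _ fun x => measurable_pi_lambda _ (hπ x))
    fun ω => (continuous_occUp M.lay (isCompact_confSet M.lay T δ _ _) x a).measurable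

theorem measurable_bonus (γ : ℝ) (hh : ∀ s < t, Measurable fun ω => h ω s) {π : Ω → X → A → ℝ}
    (hπ : ∀ x a, Measurable fun ω => π ω x a) (x : X) (a : A) :
    Measurable fun ω => bonus M.lay γ (confSet M.lay T δ (h ω) t) (π ω) x a :=
  measurable_of_traj hh (fun k π => bonus M.lay γ (confSet M.lay T δ k t) π x a)
    (fun k k' hk => by rw [confSet_congr M.lay T δ hk])
    (measurable_pi_lambda _ fun x => measurable_pi_lambda _ (hπ x))
    fun ω => measurable_bonusAux M.lay γ (isCompact_confSet M.lay T δ _ _) _ x a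

theorem measurable_lossFrom {ℓ : Ω → X → A → ℝ} (hℓ : ∀ x a, Measurable fun ω => ℓ ω x a)
    (x : X) (a : A) (τ : Trajectory X A L) : Measurable fun ω => lossFrom (ℓ ω) x a τ := by
  simp only [lossFrom]
  refine Finset.measurable_sum _ fun k _ => ?_
  split_ifs
  · exact Finset.measurable_sum _ fun j _ => hℓ _ _
  · exact measurable_const

theorem measurable_expWeights (η : ℝ) {W : Ω → X → A → ℝ}
    (hW : ∀ x a, Measurable fun ω => W ω x a) (x : X) (a : A) :
    Measurable fun ω => expWeights η (W ω) x a := by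
  simp only [expWeights]
  fun_prop

/-- The recursion involves only the past: the confidence set enters through trajectories, and the
latest trajectory ranges over a finite set, so joint measurability follows from measurability for
each fixed trajectory. -/
theorem measurable_cumLoss (hh : ∀ s < t, Measurable fun ω => h ω s) (x : X) (a : A) :
    Measurable fun ω => cumLoss M T δ (h ω) t x a := by
  induction t generalizing x a with
  | zero => exact measurable_const
  | succ t ih =>
    have hh' : ∀ s < t, Measurable fun ω => h ω s := fun s hs => hh s (by omega)
    have hπ := measurable_expWeights (eta X A L T) (ih hh')
    have hℓ := measurable_scaledLoss M T δ hh' hπ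
    simp only [cumLoss, qEst_eq]
    refine (ih hh' x a).add (Measurable.sub (Measurable.div ?_
      ((measurable_occUp M T δ hh' hπ x a).add_const _)) (measurable_bonus M T δ _ hh' hπ x a))
    have h1 : Measurable fun ω => (h ω t).1 := measurable_fst.comp (hh t (by omega))
    have h2 : Measurable fun p : Ω × Trajectory X A L => lossFrom
        (scaledLoss M T δ (h p.1) t (expWeights (eta X A L T) (cumLoss M T δ (h p.1) t))) x a
        p.2 :=
      measurable_from_prod_countable_left fun τ => measurable_lossFrom hℓ x a τ
    exact h2.comp (measurable_id.prodMk h1)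

theorem measurable_policy (hh : ∀ s < t, Measurable fun ω => h ω s) (x : X) (a : A) :
    Measurable fun ω => policy M T δ (h ω) t x a :=
  measurable_expWeights _ (measurable_cumLoss M T δ hh) x a

theorem measurable_trajProb (𝓛 : Layering X L) (P : X → A → X → ℝ) {π : Ω → X → A → ℝ}
    (hπ : ∀ x a, Measurable fun ω => π ω x a) (τ : Trajectory X A L) :
    Measurable fun ω => trajProb 𝓛 P (π ω) τ := by
  simp only [trajProb]
  fun_prop

end Measurability

theorem isPolicy_expWeights {X A : Type*} [Fintype A] [Nonempty A] (η : ℝ)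
    (W : X → A → ℝ) : IsPolicy (expWeights η W) := by
  have hpos : ∀ x, 0 < ∑ b, Real.exp (-η * W x b) := fun x =>
    Finset.sum_pos (fun b _ => Real.exp_pos _) Finset.univ_nonempty
  refine fun x => ⟨fun a => div_nonneg (Real.exp_pos _).le (hpos x).le, ?_⟩
  simp only [expWeights]
  rw [← Finset.sum_div, div_self (ne_of_gt (hpos x))]

/-! ### The conditional law of an episode and exponential supermartingales -/

/-- Integration against a conditional law given on rectangles. -/
theorem setLIntegral_eq_of_rectangles {Ω Ω' O : Type*} [MeasurableSpace Ω] [MeasurableSpace Ω']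
    [MeasurableSpace O] {μ : Measure Ω} [IsFiniteMeasure μ] {ν : Measure O}
    [IsProbabilityMeasure ν] {p : Ω → Ω'} {Z : Ω → O} {E : Set Ω} {w : Ω' → ENNReal}
    (hp : Measurable p) (hZ : Measurable Z) (hw : Measurable w)
    (h : ∀ s B, MeasurableSet s → MeasurableSet B →
      μ (E ∩ p ⁻¹' s ∩ Z ⁻¹' B) = (∫⁻ ω in p ⁻¹' s, w (p ω) ∂μ) * ν B)
    {F : Ω' × O → ENNReal} (hF : Measurable F) :
    ∫⁻ ω in E, F (p ω, Z ω) ∂μ = ∫⁻ ω, w (p ω) * ∫⁻ o, F (p ω, o) ∂ν ∂μ := by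
  -- Finiteness is needed for the uniqueness of the product measure on rectangles; the total mass is
  -- that of `E`.
  have hfin : IsFiniteMeasure ((μ.map p).withDensity w) := by
    refine isFiniteMeasure_withDensity ?_
    have h1 := h Set.univ Set.univ .univ .univ
    simp only [Set.preimage_univ, Set.inter_univ, Measure.restrict_univ, measure_univ,
      mul_one] at h1
    rw [lintegral_map hw hp, ← h1]
    exact measure_ne_top μ E
  have hprod : ((μ.map p).withDensity w).prod ν =
      (μ.restrict E).map (fun ω => (p ω, Z ω)) := by
    refine Measure.prod_eq fun s B hs hB => ?_
    rw [Measure.map_apply (hp.prodMk hZ) (hs.prod hB), withDensity_apply _ hs,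
      setLIntegral_map hs hw hp, ← h s B hs hB, Measure.restrict_apply
        ((hp.prodMk hZ) (hs.prod hB))]
    congr 1
    ext ω
    simp only [Set.mem_inter_iff, Set.mem_preimage, Set.mem_prod]
    tauto
  have h1 : ∫⁻ z, F z ∂((μ.map p).withDensity w).prod ν = ∫⁻ ω in E, F (p ω, Z ω) ∂μ := by
    rw [hprod, lintegral_map hF (hp.prodMk hZ)]
  rw [← h1, lintegral_prod _ hF.aemeasurable,
    lintegral_withDensity_eq_lintegral_mul _ hw hF.lintegral_prod_right',
    lintegral_map (hw.mul hF.lintegral_prod_right') hp]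
  rfl

section Run

variable {X A : Type*} [Fintype X] [Fintype A] {L m : ℕ} {Ω : Type*}

theorem measurable_past {H : ℕ → Ω → Episode X A L m} {s t : ℕ} (hs : s < t) :
    Measurable[past H t] (H s) :=
  Measurable.mono (comap_measurable (H s))
    (le_iSup (fun s : Fin t => MeasurableSpace.comap (H s) inferInstance) ⟨s, hs⟩) le_rfl

theorem past_mono {H : ℕ → Ω → Episode X A L m} {s t : ℕ} (hs : s ≤ t) :
    past H s ≤ past H t :=
  iSup_le fun i => (measurable_past (i.2.trans_le hs)).comap_le

variable [MeasurableSpace Ω] {M : Model X A L m} {T : ℕ} {δ : ℝ} {μ : Measure Ω}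
  {H : ℕ → Ω → Episode X A L m}

/-- The policy played after `t` episodes, as a function on the sample space. -/
abbrev runPolicy (M : Model X A L m) (T : ℕ) (δ : ℝ) (H : ℕ → Ω → Episode X A L m) (t : ℕ)
    (ω : Ω) : X → A → ℝ := policy M T δ (fun s => H s ω) t

theorem IsRun.past_le (hH : IsRun M T δ μ H) {t : ℕ} (ht : t ≤ T) :
    past H t ≤ (inferInstance : MeasurableSpace Ω) :=
  iSup_le fun s => (hH.measurable s (s.2.trans_le ht)).comap_le

theorem measurable_runPolicy (M : Model X A L m) (T : ℕ) (δ : ℝ) (H : ℕ → Ω → Episode X A L m)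
    (t : ℕ) (x : X) (a : A) : Measurable[past H t] fun ω => runPolicy M T δ H t ω x a :=
  @measurable_policy X A _ _ L m Ω (past H t) (fun ω s => H s ω) t M T δ
    (fun _ hs => measurable_past hs) x a

theorem measurable_run_trajProb (M : Model X A L m) (T : ℕ) (δ : ℝ)
    (H : ℕ → Ω → Episode X A L m) (t : ℕ) (τ : Trajectory X A L) :
    Measurable[past H t] fun ω => trajProb M.lay M.P (runPolicy M T δ H t ω) τ :=
  @measurable_trajProb X A _ _ L Ω (past H t) M.lay M.P _ (measurable_runPolicy M T δ H t) τ

theorem isPolicy_runPolicy [Nonempty A] (M : Model X A L m) (T : ℕ) (δ : ℝ)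
    (H : ℕ → Ω → Episode X A L m) (t : ℕ) (ω : Ω) : IsPolicy (runPolicy M T δ H t ω) :=
  isPolicy_expWeights _ _

variable [IsProbabilityMeasure μ] [Nonempty A]

/-- A run specifies conditional expectations of indicators only. Integrated over past events these
give the law on rectangles, and rectangles determine the integral of every function measurable
jointly in the past and the new sample. -/
theorem IsRun.setLIntegral_step (hH : IsRun M T δ μ H) {t : ℕ} (ht : t < T)
    (τ : Trajectory X A L) {F : Ω × Outcome X A m → ENNReal}
    (hF : Measurable[(past H t).prod inferInstance] F) :
    ∫⁻ ω in {ω | (H t ω).1 = τ}, F (ω, (H t ω).2) ∂μ =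
      ∫⁻ ω, ENNReal.ofReal (trajProb M.lay M.P (runPolicy M T δ H t ω) τ) *
        ∫⁻ o, F (ω, o) ∂M.law ∂μ := by
  have := M.isProb
  have hm := hH.past_le ht.le
  have hw := measurable_run_trajProb M T δ H t τ
  have hw0 : ∀ ω, 0 ≤ trajProb M.lay M.P (runPolicy M T δ H t ω) τ := fun ω =>
    trajProb_nonneg M.isTransition (isPolicy_runPolicy M T δ H t ω) τ
  have hmeasE : MeasurableSet {ω | (H t ω).1 = τ} :=
    (measurable_fst.comp (hH.measurable t ht)) (show MeasurableSet {τ} from trivial)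
  refine @setLIntegral_eq_of_rectangles Ω Ω (Outcome X A m) _ (past H t) _ μ _ M.law _ id
    (fun ω => (H t ω).2) {ω | (H t ω).1 = τ}
    (fun ω => ENNReal.ofReal (trajProb M.lay M.P (runPolicy M T δ H t ω) τ))
    (measurable_id'' hm) (measurable_snd.comp (hH.measurable t ht)) hw.ennreal_ofReal ?_ F hF
  intro s B hs hB
  have hZ : MeasurableSet {ω | (H t ω).1 = τ ∧ (H t ω).2 ∈ B} :=
    hmeasE.inter ((measurable_snd.comp (hH.measurable t ht)) hB)
  have hs' : MeasurableSet s := hm s hs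
  have h1 := setIntegral_condExp (μ := μ) hm (f := Set.indicator
    {ω | (H t ω).1 = τ ∧ (H t ω).2 ∈ B} (fun _ => (1 : ℝ)))
    ((integrable_const 1).indicator hZ) hs
  rw [setIntegral_congr_ae hs' ((hH.step t ht τ B hB).mono fun ω h _ => h),
    integral_mul_const, setIntegral_indicator hZ, setIntegral_const, smul_eq_mul, mul_one] at h1
  have h2 : {ω | (H t ω).1 = τ} ∩ id ⁻¹' s ∩ (fun ω => (H t ω).2) ⁻¹' B =
      s ∩ {ω | (H t ω).1 = τ ∧ (H t ω).2 ∈ B} := by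
    ext ω
    simp only [Set.mem_inter_iff, Set.mem_ofPred_eq, Set.mem_preimage, id]
    tauto
  have h_int : ∫⁻ ω in s, ENNReal.ofReal (trajProb M.lay M.P (runPolicy M T δ H t ω) τ) ∂μ ≠ ⊤ := by
    have hle : ∀ ω, trajProb M.lay M.P (runPolicy M T δ H t ω) τ ≤ 1 := fun ω =>
      (Finset.single_le_sum (fun τ _ => trajProb_nonneg M.isTransition
        (isPolicy_runPolicy M T δ H t ω) τ) (Finset.mem_univ τ)).trans_eq
        (sum_trajProb M.isTransition (isPolicy_runPolicy M T δ H t ω))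
    refine ne_top_of_le_ne_top (measure_ne_top μ s) ?_
    calc _ ≤ ∫⁻ ω in s, 1 ∂μ := lintegral_mono fun ω => by
            rw [← ENNReal.ofReal_one]; exact ENNReal.ofReal_le_ofReal (hle ω)
      _ = μ s := by simp
  rw [h2]
  change μ _ = (∫⁻ ω in s, ENNReal.ofReal (trajProb M.lay M.P (runPolicy M T δ H t ω) τ) ∂μ) *
    M.law B
  rw [← ENNReal.toReal_eq_toReal_iff' (measure_ne_top _ _)
    (ENNReal.mul_ne_top h_int (measure_ne_top _ _)), ENNReal.toReal_mul]
  change μ.real _ = _ * M.law.real B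
  rw [← h1, integral_eq_lintegral_of_nonneg_ae (Filter.Eventually.of_forall hw0)
    (hw.mono hm le_rfl).aestronglyMeasurable]

/-- The expectation of `F` at the next episode, given the past. -/
def condExpect (M : Model X A L m) (π : X → A → ℝ) (F : Episode X A L m → ENNReal) : ENNReal :=
  ∑ τ, ENNReal.ofReal (trajProb M.lay M.P π τ) * ∫⁻ o, F (τ, o) ∂M.law

/-- Joint measurability with respect to the past and the next episode. -/
def StepMeasurable (H : ℕ → Ω → Episode X A L m) (t : ℕ) {E : Type*} [MeasurableSpace E]
    (F : Ω → Episode X A L m → E) : Prop :=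
  ∀ τ, Measurable[(past H t).prod inferInstance]
    fun p : Ω × Outcome X A m => F p.1 (τ, p.2)

theorem StepMeasurable.comp_episode {E : Type*} [MeasurableSpace E] {t : ℕ}
    {F : Ω → Episode X A L m → E} (hF : StepMeasurable H t F) :
    Measurable[past H (t + 1)] fun ω => F ω (H t ω) := by
  have h1 : @Measurable ((Ω × Outcome X A m) × Trajectory X A L) _
      (((past H t).prod inferInstance).prod inferInstance) _
      (fun p => F p.1.1 (p.2, p.1.2)) := by
    let _ : MeasurableSpace (Ω × Outcome X A m) := (past H t).prod inferInstance
    exact measurable_from_prod_countable_left hF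
  have hH : Measurable[past H (t + 1)] (H t) := measurable_past t.lt_succ_self
  have h2 : @Measurable _ _ (past H (t + 1)) (((past H t).prod inferInstance).prod inferInstance)
      (fun ω => ((ω, (H t ω).2), (H t ω).1)) :=
    @Measurable.prodMk _ (past H (t + 1)) _ _ ((past H t).prod inferInstance) _ _ _
      (@Measurable.prodMk _ (past H (t + 1)) _ _ (past H t) _ _ _ (measurable_id'' (past_mono t.le_succ))
        (measurable_snd.comp hH)) (measurable_fst.comp hH)
  exact h1.comp h2

/-- The tower property, obtained by splitting the sample space according to the finitely many
trajectories of the next episode. -/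
theorem IsRun.lintegral_step (hH : IsRun M T δ μ H) {t : ℕ} (ht : t < T)
    {F : Ω → Episode X A L m → ENNReal} (hF : StepMeasurable H t F) :
    ∫⁻ ω, F ω (H t ω) ∂μ = ∫⁻ ω, condExpect M (runPolicy M T δ H t ω) (F ω) ∂μ := by
  have := M.isProb
  have hm := hH.past_le ht.le
  have hmeasE : ∀ τ, MeasurableSet {ω | (H t ω).1 = τ} := fun τ =>
    (measurable_fst.comp (hH.measurable t ht)) (show MeasurableSet {τ} from trivial)
  have h1 : ∫⁻ ω, F ω (H t ω) ∂μ = ∑ τ, ∫⁻ ω in {ω | (H t ω).1 = τ}, F ω (τ, (H t ω).2) ∂μ := by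
    have hU : (Set.univ : Set Ω) = ⋃ τ ∈ (Finset.univ : Finset (Trajectory X A L)),
        {ω | (H t ω).1 = τ} := by
      ext ω
      simp
    rw [← setLIntegral_univ, hU, lintegral_biUnion_finset]
    · refine Finset.sum_congr rfl fun τ _ => setLIntegral_congr_fun (hmeasE τ) fun ω hω => ?_
      simp only [Set.mem_ofPred_eq] at hω
      simp only [← hω]
    · intro τ _ τ' _ hne
      refine Set.disjoint_left.2 fun ω h h' => hne ?_
      exact h.symm.trans h'
    · exact fun τ _ => hmeasE τ
  have h2 : ∀ τ, Measurable[past H t] fun ω =>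
      ENNReal.ofReal (trajProb M.lay M.P (runPolicy M T δ H t ω) τ) *
        ∫⁻ o, F ω (τ, o) ∂M.law := fun τ =>
    (measurable_run_trajProb M T δ H t τ).ennreal_ofReal.mul
      (@Measurable.lintegral_prod_right' Ω (Outcome X A m) (past H t) _ _ _ _ (hF τ))
  simp only [condExpect]
  rw [h1, lintegral_finsetSum _ fun τ _ => (h2 τ).mono hm le_rfl]
  exact Finset.sum_congr rfl fun τ _ => hH.setLIntegral_step ht τ (hF τ)

/-- Products of factors with conditional expectation at most one have expectation at most one. -/
theorem IsRun.lintegral_prod_le_one (hH : IsRun M T δ μ H)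
    {F : ℕ → Ω → Episode X A L m → ENNReal} {t : ℕ} (ht : t ≤ T)
    (hF : ∀ s < t, StepMeasurable H s (F s))
    (hle : ∀ s < t, ∀ᵐ ω ∂μ, condExpect M (runPolicy M T δ H s ω) (F s ω) ≤ 1) :
    Measurable[past H t] (fun ω => ∏ s ∈ Finset.range t, F s ω (H s ω)) ∧
      ∫⁻ ω, ∏ s ∈ Finset.range t, F s ω (H s ω) ∂μ ≤ 1 := by
  induction t with
  | zero => exact ⟨by simp, by simp⟩
  | succ t ih =>
    obtain ⟨ih1, ih2⟩ := ih (by omega) (fun s hs => hF s (by omega)) fun s hs => hle s (by omega)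
    have hFt := hF t (by omega)
    refine ⟨?_, ?_⟩
    · simp only [Finset.prod_range_succ]
      exact (ih1.mono (past_mono t.le_succ) le_rfl).mul hFt.comp_episode
    -- The earlier factors are known at time `t`, so they act as a constant under the conditional
    -- expectation of the last factor.
    · have hG : StepMeasurable H t
          (fun ω e => (∏ s ∈ Finset.range t, F s ω (H s ω)) * F t ω e) := fun τ =>
        Measurable.mul (ih1.comp (@measurable_fst _ _ (past H t) _)) (hFt τ)
      simp only [Finset.prod_range_succ]
      rw [hH.lintegral_step (by omega) hG]
      refine (lintegral_mono_ae ?_).trans ih2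
      filter_upwards [hle t (by omega)] with ω hω
      have hfac : condExpect M (runPolicy M T δ H t ω)
          (fun e => (∏ s ∈ Finset.range t, F s ω (H s ω)) * F t ω e) =
          (∏ s ∈ Finset.range t, F s ω (H s ω)) * condExpect M (runPolicy M T δ H t ω) (F t ω) := by
        simp only [condExpect, Finset.mul_sum]
        refine Finset.sum_congr rfl fun τ _ => ?_
        rw [lintegral_const_mul, mul_left_comm]
        have h := hFt τ
        exact h.comp (@measurable_prodMk_left _ _ (past H t) _ ω)
      rw [hfac]
      exact mul_le_of_le_one_right' hω

/-- The exponential Markov inequality for sums over episodes. -/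
theorem IsRun.measure_sum_gt_le (hH : IsRun M T δ μ H)
    {Y : ℕ → Ω → Episode X A L m → ℝ} {t : ℕ} (ht : t ≤ T)
    (hY : ∀ s < t, StepMeasurable H s (Y s))
    (hle : ∀ s < t, ∀ᵐ ω ∂μ, condExpect M (runPolicy M T δ H s ω)
      (fun e => ENNReal.ofReal (Real.exp (Y s ω e))) ≤ 1) (u : ℝ) :
    μ.real {ω | u < ∑ s ∈ Finset.range t, Y s ω (H s ω)} ≤ Real.exp (-u) := by
  obtain ⟨h1, h2⟩ := hH.lintegral_prod_le_one (F := fun s ω e =>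
    ENNReal.ofReal (Real.exp (Y s ω e))) ht
    (fun s hs τ => (Real.measurable_exp.comp (hY s hs τ)).ennreal_ofReal) hle
  have h3 : ∀ ω, ∏ s ∈ Finset.range t, ENNReal.ofReal (Real.exp (Y s ω (H s ω))) =
      ENNReal.ofReal (Real.exp (∑ s ∈ Finset.range t, Y s ω (H s ω))) := fun ω => by
    rw [Real.exp_sum, ENNReal.ofReal_prod_of_nonneg fun s _ => (Real.exp_pos _).le]
  simp only [h3] at h1 h2
  have h4 := mul_meas_ge_le_lintegral₀ (μ := μ)
    (h1.mono (hH.past_le ht) le_rfl).aemeasurable (ENNReal.ofReal (Real.exp u))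
  have h5 : μ {ω | u < ∑ s ∈ Finset.range t, Y s ω (H s ω)} ≤ μ {ω | ENNReal.ofReal (Real.exp u) ≤
      ENNReal.ofReal (Real.exp (∑ s ∈ Finset.range t, Y s ω (H s ω)))} := by
    refine measure_mono fun ω hω => ?_
    exact ENNReal.ofReal_le_ofReal (Real.exp_le_exp.2 (le_of_lt hω))
  have h6 := (mul_le_mul_right h5 (ENNReal.ofReal (Real.exp u))).trans (h4.trans h2)
  have h7 := ENNReal.toReal_mono ENNReal.one_ne_top h6
  rw [ENNReal.toReal_mul, ENNReal.toReal_ofReal (Real.exp_pos u).le, ENNReal.toReal_one] at h7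
  rw [Real.exp_neg, ← one_div, le_div_iff₀ (Real.exp_pos u), mul_comm]
  exact h7

theorem condExpect_traj {π : X → A → ℝ} (hP : IsPolicy π) {F : Trajectory X A L → ℝ}
    (hF : ∀ τ, 0 ≤ F τ) : condExpect M π (fun e => ENNReal.ofReal (F e.1)) =
      ENNReal.ofReal (texp M.lay M.P π F) := by
  have := M.isProb
  simp only [condExpect, lintegral_const, measure_univ, mul_one, texp]
  rw [ENNReal.ofReal_sum_of_nonneg fun τ _ =>
    mul_nonneg (trajProb_nonneg M.isTransition hP τ) (hF τ)]
  exact Finset.sum_congr rfl fun τ _ =>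
    (ENNReal.ofReal_mul (trajProb_nonneg M.isTransition hP τ)).symm

theorem sum_ofReal_trajProb {π : X → A → ℝ} (hP : IsPolicy π) :
    ∑ τ, ENNReal.ofReal (trajProb M.lay M.P π τ) = 1 := by
  rw [← ENNReal.ofReal_sum_of_nonneg fun τ _ => trajProb_nonneg M.isTransition hP τ,
    sum_trajProb M.isTransition hP, ENNReal.ofReal_one]

theorem condExpect_le_one {π : X → A → ℝ} (hP : IsPolicy π) {F : Episode X A L m → ENNReal}
    (hF : ∀ τ, ∫⁻ o, F (τ, o) ∂M.law ≤ 1) : condExpect M π F ≤ 1 := by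
  rw [← sum_ofReal_trajProb hP]
  exact Finset.sum_le_sum fun τ _ => mul_le_of_le_one_right' (hF τ)

/-- Measurability with respect to the past of a functional of the next trajectory. -/
theorem stepMeasurable_of_traj {t : ℕ} {F : Ω → Trajectory X A L → ℝ}
    (hF : ∀ τ, Measurable[past H t] fun ω => F ω τ) :
    StepMeasurable H t (fun ω (e : Episode X A L m) => F ω e.1) := fun τ =>
  (hF τ).comp (@measurable_fst _ _ (past H t) _)

/-- Freedman's inequality in its exponential form. -/
theorem IsRun.measure_sum_texp_lt_le (hH : IsRun M T δ μ H) {Y : ℕ → Ω → Trajectory X A L → ℝ}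
    (hY : ∀ s < T, ∀ τ, Measurable[past H s] fun ω => Y s ω τ) {c : ℝ} (hc : 0 < c)
    (hb : ∀ s < T, ∀ᵐ ω ∂μ, ∀ τ, Follows M.lay M.P τ → |c * Y s ω τ| ≤ 1) (u : ℝ) :
    μ.real {ω | ∑ s ∈ Finset.range T, texp M.lay M.P (runPolicy M T δ H s ω) (Y s ω) +
      c * ∑ s ∈ Finset.range T, texp M.lay M.P (runPolicy M T δ H s ω) (fun τ => Y s ω τ ^ 2) +
      u / c < ∑ s ∈ Finset.range T, Y s ω (H s ω).1} ≤ Real.exp (-u) := by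
  have hmt : ∀ s < T, ∀ F : Ω → Trajectory X A L → ℝ, (∀ τ, Measurable[past H s] fun ω => F ω τ) →
      Measurable[past H s] fun ω => texp M.lay M.P (runPolicy M T δ H s ω) (F ω) :=
    fun s _ F hF => Finset.measurable_sum _ fun τ _ =>
      (measurable_run_trajProb M T δ H s τ).mul (hF τ)
  have h := hH.measure_sum_gt_le (Y := fun s ω e => c * Y s ω e.1 -
    (c * texp M.lay M.P (runPolicy M T δ H s ω) (Y s ω) +
      c ^ 2 * texp M.lay M.P (runPolicy M T δ H s ω) (fun τ => Y s ω τ ^ 2))) le_rfl ?_ ?_ u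
  · refine le_trans (measureReal_mono fun ω hω => ?_) h
    simp only [Set.mem_ofPred_eq] at hω ⊢
    rw [Finset.sum_sub_distrib, Finset.sum_add_distrib, ← Finset.mul_sum, ← Finset.mul_sum,
      ← Finset.mul_sum]
    have := mul_lt_mul_of_pos_left hω hc
    rw [mul_add, mul_div_cancel₀ _ hc.ne'] at this
    nlinarith
  · intro s hs
    refine stepMeasurable_of_traj (F := fun ω τ => c * Y s ω τ -
      (c * texp M.lay M.P (runPolicy M T δ H s ω) (Y s ω) +
      c ^ 2 * texp M.lay M.P (runPolicy M T δ H s ω) (fun τ => Y s ω τ ^ 2))) fun τ => ?_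
    refine ((hY s hs τ).const_mul c).sub (((hmt s hs _ (hY s hs)).const_mul c).add
      ((hmt s hs (fun ω τ => Y s ω τ ^ 2) fun τ => (hY s hs τ).pow_const 2).const_mul (c ^ 2)))
  · intro s hs
    filter_upwards [hb s hs] with ω hω
    have hπ := isPolicy_runPolicy M T δ H s ω
    set e := texp M.lay M.P (runPolicy M T δ H s ω) (Y s ω) with he
    set e2 := texp M.lay M.P (runPolicy M T δ H s ω) (fun τ => Y s ω τ ^ 2) with he2
    rw [condExpect_traj (F := fun τ => Real.exp (c * Y s ω τ - (c * e + c ^ 2 * e2))) hπ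
      fun τ => (Real.exp_pos _).le, ENNReal.ofReal_le_one]
    -- `exp y ≤ 1 + y + y²` for `|y| ≤ 1`; after taking expectations, `1 + x ≤ exp x` shows that the
    -- compensated exponential has conditional mean at most one.
    have h1 : ∀ τ, Follows M.lay M.P τ → Real.exp (c * Y s ω τ - (c * e + c ^ 2 * e2)) ≤
        Real.exp (-(c * e + c ^ 2 * e2)) * (1 + (c * Y s ω τ + c ^ 2 * Y s ω τ ^ 2)) := by
      intro τ hτ
      rw [sub_eq_add_neg, add_comm, Real.exp_add]
      have := (abs_le.1 (Real.abs_exp_sub_one_sub_id_le (hω τ hτ))).2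
      exact mul_le_mul_of_nonneg_left (by nlinarith) (Real.exp_pos _).le
    refine (texp_mono M.isTransition hπ h1).trans ?_
    rw [texp_smul, texp_add, texp_add, texp_smul, texp_smul, texp_const M.isTransition hπ,
      Real.exp_neg, inv_mul_le_one₀ (Real.exp_pos _)]
    rw [add_comm]
    exact Real.add_one_le_exp _

/-- The exceptional set has conditional probability zero whatever the current policy is. This allows
the deterministic analysis to assume possible trajectories and bounded samples. -/
theorem IsRun.ae_mem (hH : IsRun M T δ μ H) {t : ℕ} (ht : t < T) {B : Set (Outcome X A m)}
    (hB : MeasurableSet B) (h : ∀ᵐ o ∂M.law, o ∈ B) :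
    ∀ᵐ ω ∂μ, Follows M.lay M.P (H t ω).1 ∧ (H t ω).2 ∈ B := by
  have hS : MeasurableSet {e : Episode X A L m | Follows M.lay M.P e.1 ∧ e.2 ∈ B} :=
    (measurable_fst (show MeasurableSet {τ : Trajectory X A L | Follows M.lay M.P τ}
      from trivial)).inter (measurable_snd hB)
  have hF : StepMeasurable H t (fun _ => Set.indicator
      {e : Episode X A L m | Follows M.lay M.P e.1 ∧ e.2 ∈ B}ᶜ (fun _ => (1 : ENNReal))) :=
    fun τ => (measurable_const.indicator hS.compl).comp
      (measurable_prodMk_left.comp (@measurable_snd _ _ (past H t) _))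
  have h1 := hH.lintegral_step ht hF
  have h2 : ∀ ω, condExpect M (runPolicy M T δ H t ω) (Set.indicator
      {e : Episode X A L m | Follows M.lay M.P e.1 ∧ e.2 ∈ B}ᶜ (fun _ => (1 : ENNReal))) = 0 := by
    intro ω
    refine Finset.sum_eq_zero fun τ _ => ?_
    by_cases hτ : trajProb M.lay M.P (runPolicy M T δ H t ω) τ = 0
    · simp [hτ]
    · have hf := follows_of_trajProb_ne_zero M.isTransition hτ
      refine mul_eq_zero_of_right _ ((lintegral_congr_ae (h.mono fun o ho => ?_)).trans
        lintegral_zero)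
      simp [hf, ho]
  simp only [h2, lintegral_zero] at h1
  have h3 : Measurable fun ω => Set.indicator
      {e : Episode X A L m | Follows M.lay M.P e.1 ∧ e.2 ∈ B}ᶜ (fun _ => (1 : ENNReal)) (H t ω) :=
    (measurable_const.indicator hS.compl).comp (hH.measurable t ht)
  rw [lintegral_eq_zero_iff h3] at h1
  filter_upwards [h1] with ω hω
  by_contra h'
  have : H t ω ∈ {e : Episode X A L m | Follows M.lay M.P e.1 ∧ e.2 ∈ B}ᶜ := h'
  simp [Set.indicator_of_mem this] at hω

end Run

/-! ### Concentration of the estimators -/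

section Estimation

variable {X A : Type*} [Fintype X] [Fintype A] {L m : ℕ}

/-- The logarithmic factor of the confidence sets. -/
abbrev logTerm (X A : Type*) [Fintype X] [Fintype A] (T : ℕ) (δ : ℝ) : ℝ :=
  Real.log (T * Fintype.card X * Fintype.card A / δ)

/-- The expected rewards. -/
def rew (M : Model X A L m) (x : X) (a : A) : ℝ := ∫ o, o.1 x a ∂M.law

theorem measureReal_exists_le {Ω I : Type*} [MeasurableSpace Ω] {μ : Measure Ω}
    [IsFiniteMeasure μ] [Fintype I] (p : I → Ω → Prop) {c : ℝ}
    (h : ∀ i, μ.real {ω | p i ω} ≤ c) : μ.real {ω | ∃ i, p i ω} ≤ Fintype.card I * c := by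
  have h1 : {ω | ∃ i, p i ω} = ⋃ i, {ω | p i ω} := by ext; simp
  rw [h1]
  refine (measureReal_iUnion_fintype_le _).trans ((Finset.sum_le_sum fun i _ => h i).trans_eq ?_)
  simp

theorem measureReal_or_le {Ω : Type*} [MeasurableSpace Ω] {μ : Measure Ω}
    [IsFiniteMeasure μ] {p q : Ω → Prop} {c d : ℝ}
    (hp : μ.real {ω | p ω} ≤ c) (hq : μ.real {ω | q ω} ≤ d) : μ.real {ω | p ω ∨ q ω} ≤ c + d :=
  (measureReal_union_le {ω | p ω} {ω | q ω}).trans (add_le_add hp hq)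

theorem one_le_den (h : ℕ → Episode X A L m) (t : ℕ) (x : X) (a : A) : 1 ≤ den h t x a :=
  le_max_left _ _

theorem den_pos (h : ℕ → Episode X A L m) (t : ℕ) (x : X) (a : A) : 0 < den h t x a :=
  zero_lt_one.trans_le (one_le_den h t x a)

theorem visits_le (h : ℕ → Episode X A L m) (t : ℕ) (x : X) (a : A) : visits h t x a ≤ t :=
  (Finset.card_filter_le _ _).trans_eq (Finset.card_range t)

theorem transits_le_visits (h : ℕ → Episode X A L m) (t : ℕ) (x : X) (a : A) (x' : X) :
    transits h t x a x' ≤ visits h t x a := by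
  refine Finset.card_le_card (Finset.monotone_filter_right _ fun s _ hs => ?_)
  exact HitsTo.hits (τ := (h s).1) hs

theorem den_eq_visits {h : ℕ → Episode X A L m} {t : ℕ} {x : X} {a : A}
    (hn : visits h t x a ≠ 0) : den h t x a = visits h t x a :=
  max_eq_right (by exact_mod_cast Nat.one_le_iff_ne_zero.2 hn)

theorem den_eq_one {h : ℕ → Episode X A L m} {t : ℕ} {x : X} {a : A}
    (hn : visits h t x a = 0) : den h t x a = 1 := by simp [den, hn]

theorem visits_eq_sum (h : ℕ → Episode X A L m) (t : ℕ) (x : X) (a : A) :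
    (visits h t x a : ℝ) = ∑ s ∈ Finset.range t, if Visited (h s) x a then (1 : ℝ) else 0 := by
  rw [Finset.sum_boole, visits]

theorem transits_eq_sum (h : ℕ → Episode X A L m) (t : ℕ) (x : X) (a : A) (x' : X) :
    (transits h t x a x' : ℝ) =
      ∑ s ∈ Finset.range t, if VisitedTo (h s) x a x' then (1 : ℝ) else 0 := by
  rw [Finset.sum_boole, transits]

/-- Given a visit, the move to `x'` is a Bernoulli trial, and `exp (l · trial)` has mean `1 + y`
with `y = (exp l - 1) P`. The compensator `y` suffices because `exp (-y) (1 + y) ≤ 1`. -/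
theorem texp_exp_hits_le {𝓛 : Layering X L} {P : X → A → X → ℝ} {π : X → A → ℝ}
    (hP : IsTransition 𝓛 P) (hπ : IsPolicy π) {x : X} (a : A) (x' : X) (hx : 𝓛.layer x < L)
    (l : ℝ) :
    texp 𝓛 P π (fun τ => Real.exp (l * (if HitsTo τ x a x' then 1 else 0) -
      (Real.exp l - 1) * P x a x' * (if Hits τ x a then 1 else 0))) ≤ 1 := by
  set y := (Real.exp l - 1) * P x a x' with hy
  have h1 : ∀ τ : Trajectory X A L, Real.exp (l * (if HitsTo τ x a x' then 1 else 0) -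
      y * (if Hits τ x a then 1 else 0)) =
      1 + ((Real.exp (-y) - 1) * (if Hits τ x a then 1 else 0) +
        Real.exp (-y) * (Real.exp l - 1) * (if HitsTo τ x a x' then 1 else 0)) := by
    intro τ
    by_cases h2 : HitsTo τ x a x'
    · rw [if_pos h2, if_pos h2.hits, sub_eq_add_neg, Real.exp_add]
      ring_nf
    · by_cases h3 : Hits τ x a
      · rw [if_neg h2, if_pos h3]
        ring_nf
      · rw [if_neg h2, if_neg h3]
        simp
  simp only [h1]
  rw [texp_add, texp_add, texp_smul, texp_smul, texp_const hP hπ, texp_hits hP hπ a hx,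
    texp_hitsTo hP hπ a x' hx]
  have h2 : Real.exp (-y) * (1 + y) ≤ 1 := by
    rw [Real.exp_neg, inv_mul_le_one₀ (Real.exp_pos _), add_comm]
    exact Real.add_one_le_exp y
  have h3 := mul_le_mul_of_nonneg_left h2 (occ_nonneg hP hπ x a)
  rw [hy] at h3 ⊢
  nlinarith

section Run

variable {Ω : Type*} [MeasurableSpace Ω] {M : Model X A L m} {T : ℕ} {δ : ℝ} {μ : Measure Ω}
  {H : ℕ → Ω → Episode X A L m} [IsProbabilityMeasure μ] [Nonempty A]

theorem IsRun.measure_transits_le (hH : IsRun M T δ μ H) {t : ℕ} (ht : t ≤ T) {x : X} (a : A)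
    (x' : X) (hx : M.lay.layer x < L) (l u : ℝ) :
    μ.real {ω | u < l * transits (fun s => H s ω) t x a x' -
      (Real.exp l - 1) * M.P x a x' * visits (fun s => H s ω) t x a} ≤ Real.exp (-u) := by
  have h := hH.measure_sum_gt_le (Y := fun _ _ e => l * (if VisitedTo e x a x' then 1 else 0) -
      (Real.exp l - 1) * M.P x a x' * (if Visited e x a then 1 else 0)) ht ?_ ?_ u
  · simp only [Finset.sum_sub_distrib, ← Finset.mul_sum] at h
    simp only [visits_eq_sum, transits_eq_sum]
    exact h
  · intro s _
    exact stepMeasurable_of_traj (F := fun _ τ => l * (if HitsTo τ x a x' then 1 else 0) -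
      (Real.exp l - 1) * M.P x a x' * (if Hits τ x a then 1 else 0)) fun τ => measurable_const
  · intro s _
    refine Filter.Eventually.of_forall fun ω => ?_
    have h1 := condExpect_traj (M := M) (F := fun τ => Real.exp
      (l * (if HitsTo τ x a x' then 1 else 0) -
      (Real.exp l - 1) * M.P x a x' * (if Hits τ x a then 1 else 0)))
      (isPolicy_runPolicy M T δ H s ω) fun τ => (Real.exp_pos _).le
    refine h1.trans_le (ENNReal.ofReal_le_one.2 ?_)
    exact texp_exp_hits_le M.isTransition (isPolicy_runPolicy M T δ H s ω) a x' hx l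

/-- From exponential moments to the empirical Bernstein bound. -/
theorem abs_sub_le_of_exponential {c z u : ℝ} (hc : 0 ≤ c) (hz : 0 ≤ z) (hu : 0 < u)
    (h1 : -(√(2 * u) / √c) * z - (Real.exp (-(√(2 * u) / √c)) - 1) * c ≤ u)
    (h2 : √u / (√u + √c) * z - (Real.exp (√u / (√u + √c)) - 1) * c ≤ u) :
    |c - z| ≤ 2 * (√u * √z) + 2 * u := by
  have hsu : 0 < √u := Real.sqrt_pos.2 hu
  have hsu2 : √u * √u = u := Real.mul_self_sqrt hu.le
  have hsz2 : √z * √z = z := Real.mul_self_sqrt hz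
  have hsz : 0 ≤ √z := Real.sqrt_nonneg z
  have hsc2 : √c * √c = c := Real.mul_self_sqrt hc
  have hsc : 0 ≤ √c := Real.sqrt_nonneg c
  rw [abs_le]
  constructor
  · rcases le_total z c with hzc | hzc
    · nlinarith [mul_nonneg hsu.le hsz]
    have hzc' : √c ≤ √z := Real.sqrt_le_sqrt hzc
    -- Close to the ideal exponent `√(u/c)`, but never above one, so that `exp l ≤ 1 + l + l²` is
    -- available.
    set l := √u / (√u + √c) with hl
    have hsum : 0 < √u + √c := by positivity
    have hl0 : 0 < l := by positivity
    have hl1 : l ≤ 1 := (div_le_one hsum).2 (by linarith)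
    have hle : l * (√u + √c) = √u := div_mul_cancel₀ _ hsum.ne'
    have he := (abs_le.1 (Real.abs_exp_sub_one_sub_id_le
      (show |l| ≤ 1 by rw [abs_of_pos hl0]; exact hl1))).2
    have h3 : l * (z - c) ≤ l ^ 2 * c + u := by nlinarith
    have h4 : l * √c ≤ √u := by nlinarith
    have h5 : l * (z - c) ≤ l * (2 * (√u * √c) + u) := by
      have : l ^ 2 * c = l * √c * (l * √c) := by linear_combination (-(l ^ 2)) * hsc2
      have h6 : l * √c * (l * √c) ≤ √u * (l * √c) :=
        mul_le_mul_of_nonneg_right h4 (by positivity)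
      have h7 : u = l * (√u + √c) * √u := by rw [hle, hsu2]
      nlinarith
    have h6 := le_of_mul_le_mul_left h5 hl0
    nlinarith [mul_le_mul_of_nonneg_left hzc' hsu.le]
  · rcases le_total c z with hzc | hzc
    · nlinarith [mul_nonneg hsu.le hsz]
    rcases hc.eq_or_lt with hc0 | hc0
    · rw [← hc0] at hzc ⊢
      nlinarith [mul_nonneg hsu.le hsz]
    have hscp : 0 < √c := Real.sqrt_pos.2 hc0
    set y := √(2 * u) with hy
    have hyp : 0 < y := Real.sqrt_pos.2 (by linarith)
    have hy2 : y * y = 2 * u := Real.mul_self_sqrt (by linarith)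
    set s := y / √c with hs
    have hs0 : 0 < s := by positivity
    have hsc' : s * √c = y := div_mul_cancel₀ _ hscp.ne'
    -- Here `s` may be large, so the quadratic bound must hold for all `s ≥ 0`. It does, since `(1 +
    -- s + s²/2)(1 - s + s²/2) = 1 + s⁴/4`.
    have he : Real.exp (-s) ≤ 1 - s + s ^ 2 / 2 := by
      have hq := Real.quadratic_le_exp_of_nonneg hs0.le
      rw [Real.exp_neg, inv_le_iff_one_le_mul₀ (Real.exp_pos s)]
      nlinarith [sq_nonneg s, sq_nonneg (s - 1), mul_nonneg hs0.le (sq_nonneg s),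
        mul_nonneg (mul_nonneg hs0.le hs0.le) (mul_nonneg hs0.le hs0.le)]
    have h3 : s * (c - z) ≤ s ^ 2 / 2 * c + u := by nlinarith
    have h4 : s ^ 2 / 2 * c = u := by
      have : s ^ 2 * c = s * √c * (s * √c) := by linear_combination (-(s ^ 2)) * hsc2
      rw [hsc', hy2] at this
      linarith
    have h5 : s * (c - z) ≤ s * (y * √c) := by
      have : s * (y * √c) = y * (s * √c) := by ring
      rw [this, hsc', hy2]
      linarith
    have h6 := le_of_mul_le_mul_left h5 hs0
    -- The deviation is so far bounded through the unknown mean `c`; this trades it for the observed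
    -- `z` at the price of an additive `2u`.
    have h7 : √c ≤ √z + y := by
      by_contra! h8
      nlinarith
    have h8 : c - z ≤ y * √z + 2 * u := by nlinarith
    have h9 : y ≤ 2 * √u := by
      rw [hy, show (2 : ℝ) * √u = √(4 * u) by
        rw [Real.sqrt_mul (by norm_num), show (4 : ℝ) = 2 ^ 2 by norm_num,
          Real.sqrt_sq (by norm_num)]]
      exact Real.sqrt_le_sqrt (by linarith)
    nlinarith

/-- The transition function lies in all the confidence sets. -/
def TransGood (M : Model X A L m) (T : ℕ) (δ : ℝ) (h : ℕ → Episode X A L m) : Prop :=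
  ∀ t < T, ∀ x a x', M.lay.layer x' = M.lay.layer x + 1 →
    |M.P x a x' - pHat h t x a x'| ≤ confWidth T δ h t x a x'

theorem exp_neg_three_mul_log {δ : ℝ} (hδ : 0 < δ) {N : ℝ} (hN : 0 < N) :
    Real.exp (-(3 * Real.log (N / δ))) = (δ / N) ^ 3 := by
  rw [← mul_neg, ← Real.log_inv, inv_div, mul_comm, Real.exp_mul,
    Real.exp_log (by positivity)]
  norm_num

/-- The good exponent depends on the number `n` of visits, which is random; hence a union bound over
`n` from `1` to `T` (indexed by `n - 1`), over the times and over the transitions. The factor three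
in `u` makes each event have probability at most `(δ / (T |X| |A|))³`, which beats the `|X|² |A| T²`
events. -/
theorem IsRun.measure_not_transGood (hH : IsRun M T δ μ H) (hδ : 0 < δ) (hδ1 : δ < 1)
    (hT : 0 < T) (hlog : 1 ≤ logTerm X A T δ) :
    μ.real {ω | ¬ TransGood M T δ (fun s => H s ω)} ≤ 2 * δ := by
  set u := 3 * logTerm X A T δ with hu
  have hupos : 0 < u := by linarith
  let l1 : X → A → X → ℕ → ℝ := fun x a x' n => -(√(2 * u) / √(n * M.P x a x'))
  let l2 : X → A → X → ℕ → ℝ := fun x a x' n => √u / (√u + √(n * M.P x a x'))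
  let bad : (X → A → X → ℕ → ℝ) → (X × A × X × Fin T × Fin T) → Ω → Prop := fun l i ω =>
    M.lay.layer i.1 < L ∧ u < l i.1 i.2.1 i.2.2.1 (i.2.2.2.1 + 1) *
      transits (fun s => H s ω) i.2.2.2.2 i.1 i.2.1 i.2.2.1 -
      (Real.exp (l i.1 i.2.1 i.2.2.1 (i.2.2.2.1 + 1)) - 1) * M.P i.1 i.2.1 i.2.2.1 *
        visits (fun s => H s ω) i.2.2.2.2 i.1 i.2.1
  have hbad : ∀ l, μ.real {ω | ∃ i, bad l i ω} ≤ δ := by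
    intro l
    have hX : (1 : ℝ) ≤ Fintype.card X := by
      have : Nonempty X := ⟨M.lay.start⟩
      exact_mod_cast Fintype.card_pos
    have hA : (1 : ℝ) ≤ Fintype.card A := by exact_mod_cast Fintype.card_pos
    have hT' : (1 : ℝ) ≤ T := by exact_mod_cast hT
    refine (measureReal_exists_le (bad l) (c := Real.exp (-u)) fun i => ?_).trans ?_
    · by_cases hx : M.lay.layer i.1 < L
      · refine le_trans (measureReal_mono fun ω hω => ?_) (hH.measure_transits_le
          (t := i.2.2.2.2) i.2.2.2.2.2.le i.2.1 i.2.2.1 hx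
          (l i.1 i.2.1 i.2.2.1 (i.2.2.2.1 + 1)) u)
        exact hω.2
      · have : {ω | bad l i ω} = ∅ := by
          ext ω
          simp [bad, hx]
        rw [this, measureReal_empty]
        exact (Real.exp_pos _).le
    · rw [hu, exp_neg_three_mul_log hδ (by positivity)]
      simp only [Fintype.card_prod, Fintype.card_fin, Nat.cast_mul]
      set S := (Fintype.card X : ℝ)
      set K := (Fintype.card A : ℝ)
      set t := (T : ℝ)
      rw [div_pow, ← mul_div_assoc, div_le_iff₀ (by positivity)]
      have h1 : δ ^ 3 ≤ δ := by nlinarith [mul_pos hδ hδ]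
      have h2 : S * (K * (S * (t * t))) ≤ (t * S * K) ^ 3 := by
        have h3 : (t * S * K) ^ 3 = S * (K * (S * (t * t))) * (t * S * K ^ 2) := by ring
        rw [h3]
        refine le_mul_of_one_le_right (by positivity) ?_
        exact one_le_mul_of_one_le_of_one_le (one_le_mul_of_one_le_of_one_le hT' hX)
          (one_le_pow₀ hA)
      rw [mul_comm δ]
      exact mul_le_mul h2 h1 (by positivity) (by positivity)
  refine le_trans (measureReal_mono (s₂ := {ω | (∃ i, bad l1 i ω) ∨ ∃ i, bad l2 i ω})
    fun ω hω => ?_) ((measureReal_or_le (hbad l1) (hbad l2)).trans_eq (by ring))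
  by_contra hcon
  simp only [Set.mem_ofPred_eq, not_or, not_exists] at hcon
  refine hω fun t ht x a x' hx => ?_
  set h : ℕ → Episode X A L m := fun s => H s ω with hh
  have hxL : M.lay.layer x < L := by have := M.lay.layer_le x'; omega
  have hP0 := M.isTransition.1 x a x'
  have hP1 := M.isTransition.le_one x a x'
  -- Without visits the width is at least `28/3`, and the claim holds trivially.
  by_cases hn : visits h t x a = 0
  · have h0 : transits h t x a x' = 0 := by have := transits_le_visits h t x a x'; omega
    simp only [pHat, confWidth, h0, den_eq_one hn, Nat.cast_zero, zero_div, zero_mul, sub_zero,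
      Real.sqrt_zero, mul_zero, zero_add]
    rw [abs_of_nonneg hP0]
    linarith
  set n := visits h t x a with hndef
  have hn1 : n - 1 < T := by have := visits_le h t x a; omega
  have hn2 : n - 1 + 1 = n := by omega
  have b1 := hcon.1 (x, a, x', ⟨n - 1, hn1⟩, ⟨t, ht⟩)
  have b2 := hcon.2 (x, a, x', ⟨n - 1, hn1⟩, ⟨t, ht⟩)
  simp only [bad, hxL, true_and, not_lt, hn2, l1, l2] at b1 b2
  have hnpos : (0 : ℝ) < n := by exact_mod_cast Nat.pos_of_ne_zero hn
  have key := abs_sub_le_of_exponential (c := n * M.P x a x') (z := transits h t x a x')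
    (by positivity) (by positivity) hupos (by rw [← hh] at b1; linarith)
    (by rw [← hh] at b2; linarith)
  rw [pHat, confWidth, pHat, den_eq_visits hn]
  set z := (transits h t x a x' : ℝ) with hz
  have hz0 : 0 ≤ z := by positivity
  have e1 : |M.P x a x' - z / n| = |n * M.P x a x' - z| / n := by
    rw [← abs_of_pos hnpos, ← abs_div, abs_of_pos hnpos, sub_div, mul_div_cancel_left₀ _ hnpos.ne']
  have e2 : √(z / n * logTerm X A T δ / n) = √(logTerm X A T δ) * √z / n := by
    rw [show z / n * logTerm X A T δ / n = logTerm X A T δ * z / n ^ 2 by field_simp,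
      Real.sqrt_div' _ (by positivity), Real.sqrt_sq hnpos.le, Real.sqrt_mul (by linarith)]
  have e3 : √u ≤ 2 * √(logTerm X A T δ) := by
    rw [show (2 : ℝ) * √(logTerm X A T δ) = √(4 * logTerm X A T δ) by
      rw [Real.sqrt_mul (by norm_num), show (4 : ℝ) = 2 ^ 2 by norm_num,
        Real.sqrt_sq (by norm_num)]]
    exact Real.sqrt_le_sqrt (by linarith)
  rw [e1, e2, div_le_iff₀ hnpos]
  have e4 : (4 * (√(logTerm X A T δ) * √z / n) + 28 * logTerm X A T δ / (3 * n)) * n =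
      4 * (√(logTerm X A T δ) * √z) + 28 / 3 * logTerm X A T δ := by
    field_simp
  rw [e4]
  nlinarith [mul_le_mul_of_nonneg_right e3 (Real.sqrt_nonneg z)]

theorem integrable_of_mem_Icc {O : Type*} [MeasurableSpace O] {ν : Measure O}
    [IsProbabilityMeasure ν] {f : O → ℝ} (hf : Measurable f)
    (h : ∀ᵐ o ∂ν, f o ∈ Set.Icc (0 : ℝ) 1) : Integrable f ν :=
  Integrable.of_bound hf.aestronglyMeasurable 1 (h.mono fun o ho => by
    rw [Real.norm_eq_abs, abs_le]; exact ⟨by linarith [ho.1], ho.2⟩)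

theorem integral_mem_Icc {O : Type*} [MeasurableSpace O] {ν : Measure O}
    [IsProbabilityMeasure ν] {f : O → ℝ} (hf : Measurable f)
    (h : ∀ᵐ o ∂ν, f o ∈ Set.Icc (0 : ℝ) 1) : (∫ o, f o ∂ν) ∈ Set.Icc (0 : ℝ) 1 := by
  refine ⟨integral_nonneg_of_ae (h.mono fun o ho => ho.1), ?_⟩
  have := integral_mono_ae (integrable_of_mem_Icc hf h) (integrable_const (1 : ℝ))
    (h.mono fun o ho => ho.2)
  simpa using this

/-- The sample is independent of the trajectory given the past, so for each fixed trajectory the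
factor is either one or controlled by Hoeffding's lemma for variables in `[0, 1]`; this is where `l²
/ 8` comes from. -/
theorem IsRun.measure_mean_le (hH : IsRun M T δ μ H) {t : ℕ} (ht : t ≤ T) (x : X) (a : A)
    {f : Outcome X A m → ℝ} (hf : Measurable f) (hf1 : ∀ᵐ o ∂M.law, f o ∈ Set.Icc (0 : ℝ) 1)
    (l u : ℝ) :
    μ.real {ω | u < l * (∑ s ∈ Finset.range t, (if Visited (H s ω) x a then f (H s ω).2 else 0) -
      (∫ o, f o ∂M.law) * visits (fun s => H s ω) t x a) -
      l ^ 2 / 8 * visits (fun s => H s ω) t x a} ≤ Real.exp (-u) := by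
  have := M.isProb
  have h := hH.measure_sum_gt_le (Y := fun _ _ e => if Visited e x a then
    l * (f e.2 - ∫ o, f o ∂M.law) - l ^ 2 / 8 else 0) ht ?_ ?_ u
  · refine le_trans (measureReal_mono fun ω hω => ?_) h
    simp only [Set.mem_ofPred_eq, visits_eq_sum] at hω ⊢
    refine hω.trans_eq ?_
    rw [Finset.mul_sum, Finset.mul_sum, ← Finset.sum_sub_distrib, Finset.mul_sum,
      ← Finset.sum_sub_distrib]
    refine Finset.sum_congr rfl fun s _ => ?_
    split_ifs <;> ring
  · intro s _ τ
    by_cases hτ : Hits τ x a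
    · have : ∀ p : Ω × Outcome X A m, Visited ((τ, p.2) : Episode X A L m) x a := fun _ => hτ
      simp only [this, if_true]
      have h1 : Measurable fun o => l * (f o - ∫ o, f o ∂M.law) - l ^ 2 / 8 := by fun_prop
      exact h1.comp (@measurable_snd _ _ (past H s) _)
    · have : ∀ p : Ω × Outcome X A m, ¬ Visited ((τ, p.2) : Episode X A L m) x a := fun _ => hτ
      simp only [this, if_false]
      exact measurable_const
  · intro s _
    refine Filter.Eventually.of_forall fun ω =>
      condExpect_le_one (isPolicy_runPolicy M T δ H s ω) fun τ => ?_
    by_cases hτ : Hits τ x a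
    · have hV : ∀ o : Outcome X A m, Visited ((τ, o) : Episode X A L m) x a := fun _ => hτ
      simp only [hV, if_true]
      have hsub := ProbabilityTheory.hasSubgaussianMGF_of_mem_Icc (μ := M.law) hf.aemeasurable hf1
      have h1 := hsub.mgf_le l
      rw [ProbabilityTheory.mgf] at h1
      have h_int := hsub.integrable_exp_mul l
      have h2 : ∀ o, Real.exp (l * (f o - ∫ o, f o ∂M.law) - l ^ 2 / 8) =
          Real.exp (l * (f o - ∫ o, f o ∂M.law)) * Real.exp (-(l ^ 2 / 8)) := fun o => by
        rw [← Real.exp_add]; ring_nf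
      simp only [h2]
      rw [← ofReal_integral_eq_lintegral_ofReal (h_int.mul_const _)
        (Filter.Eventually.of_forall fun o => by positivity), ENNReal.ofReal_le_one,
        integral_mul_const]
      calc _ ≤ Real.exp (((‖(1 : ℝ) - 0‖₊ / 2) ^ 2 : NNReal) * l ^ 2 / 2) *
            Real.exp (-(l ^ 2 / 8)) := mul_le_mul_of_nonneg_right h1 (Real.exp_pos _).le
        _ = 1 := by
          rw [← Real.exp_add, Real.exp_eq_one_iff]
          simp
          ring
    · have hV : ∀ o : Outcome X A m, ¬ Visited ((τ, o) : Episode X A L m) x a := fun _ => hτ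
      simp [hV]

/-- Hoeffding's bound, uniformly over the episodes, the pairs and a finite family. -/
theorem IsRun.measure_not_mean (hH : IsRun M T δ μ H) {I : Type*} [Fintype I] [Nonempty I]
    (hδ : 0 < δ) (hδ1 : δ < 1) (hT : 0 < T) (f : I → X → A → Outcome X A m → ℝ)
    (hf : ∀ i x a, Measurable (f i x a))
    (hf1 : ∀ i x a, ∀ᵐ o ∂M.law, f i x a o ∈ Set.Icc (0 : ℝ) 1) {v : ℝ}
    (hv : v = Real.log (T * Fintype.card X * Fintype.card A * Fintype.card I / δ))
    (hlog : 1 ≤ v) :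
    μ.real {ω | ¬ ∀ t < T, ∀ i x a, |(∑ s ∈ Finset.range t,
      if Visited (H s ω) x a then f i x a (H s ω).2 else 0) / den (fun s => H s ω) t x a -
      ∫ o, f i x a o ∂M.law| ≤ √(4 * v / den (fun s => H s ω) t x a)} ≤ 2 * δ := by
  have := M.isProb
  set u := 3 * v with hu
  have hupos : 0 < u := by linarith
  let bad : (ℕ → ℝ) → (I × X × A × Fin T × Fin T) → Ω → Prop := fun l i ω =>
    u < l (i.2.2.2.1 + 1) * (∑ s ∈ Finset.range i.2.2.2.2,
      (if Visited (H s ω) i.2.1 i.2.2.1 then f i.1 i.2.1 i.2.2.1 (H s ω).2 else 0) -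
      (∫ o, f i.1 i.2.1 i.2.2.1 o ∂M.law) *
        visits (fun s => H s ω) i.2.2.2.2 i.2.1 i.2.2.1) -
      l (i.2.2.2.1 + 1) ^ 2 / 8 * visits (fun s => H s ω) i.2.2.2.2 i.2.1 i.2.2.1
  have hbad : ∀ l, μ.real {ω | ∃ i, bad l i ω} ≤ δ := by
    intro l
    have hX : (1 : ℝ) ≤ Fintype.card X := by
      have : Nonempty X := ⟨M.lay.start⟩
      exact_mod_cast Fintype.card_pos
    have hA : (1 : ℝ) ≤ Fintype.card A := by exact_mod_cast Fintype.card_pos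
    have hI : (1 : ℝ) ≤ Fintype.card I := by exact_mod_cast Fintype.card_pos
    have hT' : (1 : ℝ) ≤ T := by exact_mod_cast hT
    refine (measureReal_exists_le (bad l) (c := Real.exp (-u)) fun i => ?_).trans ?_
    · exact hH.measure_mean_le i.2.2.2.2.2.le i.2.1 i.2.2.1 (hf i.1 i.2.1 i.2.2.1)
        (hf1 i.1 i.2.1 i.2.2.1) (l (i.2.2.2.1 + 1)) u
    · rw [hu, hv, exp_neg_three_mul_log hδ (by positivity)]
      simp only [Fintype.card_prod, Fintype.card_fin, Nat.cast_mul]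
      set S := (Fintype.card X : ℝ)
      set K := (Fintype.card A : ℝ)
      set J := (Fintype.card I : ℝ)
      set t := (T : ℝ)
      rw [div_pow, ← mul_div_assoc, div_le_iff₀ (by positivity)]
      have h1 : δ ^ 3 ≤ δ := by nlinarith [mul_pos hδ hδ]
      have h2 : J * (S * (K * (t * t))) ≤ (t * S * K * J) ^ 3 := by
        have h3 : (t * S * K * J) ^ 3 = J * (S * (K * (t * t))) * (t * S ^ 2 * K ^ 2 * J ^ 2) := by
          ring
        rw [h3]
        refine le_mul_of_one_le_right (by positivity) ?_
        exact one_le_mul_of_one_le_of_one_le (one_le_mul_of_one_le_of_one_le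
          (one_le_mul_of_one_le_of_one_le hT' (one_le_pow₀ hX)) (one_le_pow₀ hA))
          (one_le_pow₀ hI)
      rw [mul_comm δ]
      exact mul_le_mul h2 h1 (by positivity) (by positivity)
  -- With this exponent `l² n / 8 = u / 2`, so the deviation of the sum is at most `(3/4) √(u n)`.
  -- Since `u = 3 v`, this stays below `√(4 v n)`.
  let l1 : ℕ → ℝ := fun n => 2 * √u / √n
  refine le_trans (measureReal_mono (s₂ := {ω | (∃ i, bad l1 i ω) ∨ ∃ i, bad (fun n => -l1 n) i ω})
    fun ω hω => ?_) ((measureReal_or_le (hbad l1) (hbad fun n => -l1 n)).trans_eq (by ring))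
  by_contra hcon
  simp only [Set.mem_ofPred_eq, not_or, not_exists] at hcon
  refine hω fun t ht i x a => ?_
  set h : ℕ → Episode X A L m := fun s => H s ω with hh
  obtain ⟨hr0, hr1⟩ := integral_mem_Icc (hf i x a) (hf1 i x a)
  set r := ∫ o, f i x a o ∂M.law with hr
  by_cases hn : visits h t x a = 0
  · have h0 : ∑ s ∈ Finset.range t, (if Visited (H s ω) x a then f i x a (H s ω).2 else 0) = 0 := by
      refine Finset.sum_eq_zero fun s hs => if_neg fun h' => ?_
      have := Finset.card_eq_zero.1 hn
      exact (Finset.filter_eq_empty_iff.1 this) hs h'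
    rw [h0, zero_div, zero_sub, abs_neg, abs_of_nonneg hr0, den_eq_one hn, div_one]
    exact hr1.trans (Real.one_le_sqrt.2 (by linarith))
  set n := visits h t x a with hndef
  have hn1 : n - 1 < T := by have := visits_le h t x a; omega
  have hn2 : n - 1 + 1 = n := by omega
  have b1 := hcon.1 (i, x, a, ⟨n - 1, hn1⟩, ⟨t, ht⟩)
  have b2 := hcon.2 (i, x, a, ⟨n - 1, hn1⟩, ⟨t, ht⟩)
  simp only [bad, not_lt, hn2, l1] at b1 b2
  have hnpos : (0 : ℝ) < n := by exact_mod_cast Nat.pos_of_ne_zero hn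
  set Z := ∑ s ∈ Finset.range t, (if Visited (H s ω) x a then f i x a (H s ω).2 else 0) with hZ
  rw [den_eq_visits hn]
  have hsn : 0 < √(n : ℝ) := Real.sqrt_pos.2 hnpos
  have hsn2 : √(n : ℝ) * √(n : ℝ) = n := Real.mul_self_sqrt hnpos.le
  have hsu : 0 < √u := Real.sqrt_pos.2 hupos
  have hsu2 : √u * √u = u := Real.mul_self_sqrt hupos.le
  set l := 2 * √u / √(n : ℝ) with hl
  have hl0 : 0 < l := by positivity
  have hln : l * √(n : ℝ) = 2 * √u := div_mul_cancel₀ _ hsn.ne'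
  have e5 : l ^ 2 / 8 * n = u / 2 := by
    have : l ^ 2 * n = l * √(n : ℝ) * (l * √(n : ℝ)) := by linear_combination (-(l ^ 2)) * hsn2
    rw [hln] at this
    nlinarith
  have e6 : l * |Z - r * n| ≤ l * (3 / 4 * (√u * √(n : ℝ))) := by
    have e7 : l * (3 / 4 * (√u * √(n : ℝ))) = 3 / 2 * u := by
      rw [show l * (3 / 4 * (√u * √(n : ℝ))) = 3 / 4 * √u * (l * √(n : ℝ)) by ring, hln]
      linear_combination (3 / 2) * hsu2
    rw [e7, show l * |Z - r * n| = |l * (Z - r * n)| by rw [abs_mul, abs_of_pos hl0], abs_le]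
    rw [← hh, ← hr] at b1 b2
    constructor <;> linarith
  have e8 := le_of_mul_le_mul_left e6 hl0
  have e9 : |Z / n - r| = |Z - r * n| / n := by
    rw [← abs_of_pos hnpos, ← abs_div, abs_of_pos hnpos, sub_div, mul_div_cancel_right₀ _ hnpos.ne']
  rw [e9, div_le_iff₀ hnpos, Real.sqrt_div' _ hnpos.le]
  have e11 : √(4 * v) / √(n : ℝ) * n = √(4 * v) * √(n : ℝ) := by
    rw [div_mul_eq_mul_div, div_eq_iff hsn.ne', mul_assoc, hsn2]
  rw [e11]
  have e12 : √u ≤ √(4 * v) := Real.sqrt_le_sqrt (by linarith)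
  nlinarith [mul_le_mul_of_nonneg_right e12 hsn.le, mul_pos hsu hsn]

end Run

end Estimation

/-! ### Regular histories and the range of the losses -/

section Regular

variable {X A : Type*} [Fintype X] [Fintype A] {L m : ℕ}

/-- The trajectories are possible ones, and the rewards and costs lie in `[0, 1]`. -/
def Regular (M : Model X A L m) (T : ℕ) (h : ℕ → Episode X A L m) : Prop :=
  ∀ t < T, Follows M.lay M.P (h t).1 ∧ (∀ x a, (h t).2.1 x a ∈ Set.Icc (0 : ℝ) 1) ∧
    ∀ i x a, (h t).2.2 i x a ∈ Set.Icc (0 : ℝ) 1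

theorem IsRun.ae_regular {Ω : Type*} [MeasurableSpace Ω] {M : Model X A L m} {T : ℕ} {δ : ℝ}
    {μ : Measure Ω} {H : ℕ → Ω → Episode X A L m} [IsProbabilityMeasure μ] [Nonempty A]
    (hH : IsRun M T δ μ H) : ∀ᵐ ω ∂μ, Regular M T (fun s => H s ω) := by
  have hB : MeasurableSet {o : Outcome X A m | (∀ x a, o.1 x a ∈ Set.Icc (0 : ℝ) 1) ∧
      ∀ i x a, o.2 i x a ∈ Set.Icc (0 : ℝ) 1} := by
    simp only [Set.ofPred_and, Set.ofPred_forall]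
    refine MeasurableSet.inter ?_ ?_
    · refine MeasurableSet.iInter fun x => MeasurableSet.iInter fun a => ?_
      have : Measurable fun o : Outcome X A m => o.1 x a := by fun_prop
      exact this measurableSet_Icc
    · refine MeasurableSet.iInter fun i => MeasurableSet.iInter fun x =>
        MeasurableSet.iInter fun a => ?_
      have : Measurable fun o : Outcome X A m => o.2 i x a := by fun_prop
      exact this measurableSet_Icc
  have h : ∀ t : Fin T, ∀ᵐ ω ∂μ, Follows M.lay M.P (H t ω).1 ∧ (H t ω).2 ∈
      {o : Outcome X A m | (∀ x a, o.1 x a ∈ Set.Icc (0 : ℝ) 1) ∧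
      ∀ i x a, o.2 i x a ∈ Set.Icc (0 : ℝ) 1} := fun t =>
    hH.ae_mem t.2 hB (by filter_upwards [M.reward_mem, M.cost_mem] with o h1 h2 using ⟨h1, h2⟩)
  filter_upwards [ae_all_iff.2 h] with ω hω t ht
  exact hω ⟨t, ht⟩

theorem average_mem (h : ℕ → Episode X A L m) {t : ℕ} (x : X) (a : A) {z : ℕ → ℝ}
    (hz : ∀ s < t, z s ∈ Set.Icc (0 : ℝ) 1) :
    (∑ s ∈ Finset.range t, if Visited (h s) x a then z s else 0) / den h t x a ∈
      Set.Icc (0 : ℝ) 1 := by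
  refine ⟨div_nonneg (Finset.sum_nonneg fun s hs => ?_) (den_pos h t x a).le,
    (div_le_one (den_pos h t x a)).2 ?_⟩
  · split_ifs
    · exact (hz s (Finset.mem_range.1 hs)).1
    · exact le_rfl
  · refine (Finset.sum_le_sum fun s hs => ?_).trans ((visits_eq_sum h t x a).symm.le.trans
      (le_max_right _ _))
    split_ifs
    · exact (hz s (Finset.mem_range.1 hs)).2
    · exact le_rfl

variable {M : Model X A L m} {T : ℕ} {δ : ℝ} {h : ℕ → Episode X A L m} {t : ℕ}

theorem Regular.rHat_mem (hr : Regular M T h) (ht : t ≤ T) (x : X) (a : A) :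
    rHat h t x a ∈ Set.Icc (0 : ℝ) 1 :=
  average_mem h x a fun s hs => (hr s (hs.trans_le ht)).2.1 x a

theorem Regular.gHat_mem (hr : Regular M T h) (ht : t ≤ T) (i : Fin m) (x : X) (a : A) :
    gHat h t i x a ∈ Set.Icc (0 : ℝ) 1 :=
  average_mem h x a fun s hs => (hr s (hs.trans_le ht)).2.2 i x a

theorem phi_mem (T : ℕ) (δ : ℝ) (h : ℕ → Episode X A L m) (t : ℕ) (x : X) (a : A) :
    phi T δ h t x a ∈ Set.Icc (0 : ℝ) 1 :=
  ⟨le_min zero_le_one (Real.sqrt_nonneg _), min_le_left _ _⟩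

theorem xi_mem (T : ℕ) (δ : ℝ) (h : ℕ → Episode X A L m) (t : ℕ) (x : X) (a : A) :
    xi T δ h t x a ∈ Set.Icc (0 : ℝ) 1 :=
  ⟨le_min zero_le_one (Real.sqrt_nonneg _), min_le_left _ _⟩

theorem Regular.rUp_mem (hr : Regular M T h) (ht : t ≤ T) (x : X) (a : A) :
    rUp T δ h t x a ∈ Set.Icc (0 : ℝ) 2 := by
  have h1 := hr.rHat_mem ht x a
  have h2 := phi_mem T δ h t x a
  exact ⟨add_nonneg h1.1 h2.1, (add_le_add h1.2 h2.2).trans_eq (by norm_num)⟩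

theorem Regular.gLow_mem (hr : Regular M T h) (ht : t ≤ T) (i : Fin m) (x : X) (a : A) :
    gLow T δ h t i x a ∈ Set.Icc (-1 : ℝ) 1 := by
  have h1 := hr.gHat_mem ht i x a
  have h2 := xi_mem (m := m) T δ h t x a
  simp only [gLow]
  exact ⟨by linarith [h1.1, h2.2], by linarith [h1.2, h2.1]⟩

theorem dual_mem (hρ : 0 < rho M) (π : X → A → ℝ) (i : Fin m) :
    0 ≤ dual M T δ h t π i ∧ dual M T δ h t π i ≤ ((L : ℝ) + 1) / rho M := by
  have : 0 ≤ ((L : ℝ) + 1) / rho M := by positivity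
  simp only [dual]
  split_ifs
  · exact ⟨this, le_rfl⟩
  · exact ⟨le_rfl, this⟩

/-- Optimistic costs lie in `[-1, 1]` and `thr / L` in `[0, 1]`, so each dual summand lies between
`-2` and `1` times the largest multiplier. -/
theorem Regular.loss_mem (hr : Regular M T h) (hL : 0 < L) (hρ : 0 < rho M) (ht : t ≤ T)
    (π : X → A → ℝ) (x : X) (a : A) :
    -(((L : ℝ) + 1) * m / rho M + 2) ≤ loss M T δ h t π x a ∧
      loss M T δ h t π x a ≤ 2 * (((L : ℝ) + 1) * m / rho M) := by
  have h1 := hr.rUp_mem (δ := δ) ht x a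
  set Λ := ((L : ℝ) + 1) / rho M with hΛ
  have hΛ' : ((L : ℝ) + 1) * m / rho M = m * Λ := by rw [hΛ]; ring
  have hL' : (0 : ℝ) < L := by exact_mod_cast hL
  have h2 : ∀ i, -(2 * Λ) ≤ dual M T δ h t π i * (gLow T δ h t i x a - M.thr i / L) ∧
      dual M T δ h t π i * (gLow T δ h t i x a - M.thr i / L) ≤ Λ := by
    intro i
    have hd := dual_mem (T := T) (δ := δ) (h := h) (t := t) hρ π i
    have hg := hr.gLow_mem (δ := δ) ht i x a
    have ha0 : 0 ≤ M.thr i / L := div_nonneg (M.thr_mem i).1 hL'.le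
    have ha1 : M.thr i / L ≤ 1 := (div_le_one hL').2 (M.thr_mem i).2
    rw [← hΛ] at hd
    constructor <;> nlinarith [hg.1, hg.2, hd.1, hd.2]
  have h3 : -(2 * (m * Λ)) ≤ ∑ i, dual M T δ h t π i * (gLow T δ h t i x a - M.thr i / L) := by
    have := Finset.card_nsmul_le_sum Finset.univ _ _ fun i _ => (h2 i).1
    simp only [Finset.card_univ, Fintype.card_fin, nsmul_eq_mul] at this
    linarith
  have h4 : ∑ i, dual M T δ h t π i * (gLow T δ h t i x a - M.thr i / L) ≤ m * Λ := by
    have := Finset.sum_le_card_nsmul Finset.univ _ _ fun i _ => (h2 i).2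
    simpa only [Finset.card_univ, Fintype.card_fin, nsmul_eq_mul] using this
  simp only [loss, hΛ']
  exact ⟨by linarith [h1.2], by linarith [h1.1]⟩

theorem Regular.scaledLoss_mem (hr : Regular M T h) (hL : 0 < L) (hρ : 0 < rho M) (ht : t ≤ T)
    (π : X → A → ℝ) (x : X) (a : A) :
    0 ≤ scaledLoss M T δ h t π x a ∧ scaledLoss M T δ h t π x a ≤ 1 := by
  obtain ⟨h1, h2⟩ := hr.loss_mem (δ := δ) hL hρ ht π x a
  have h3 : 0 ≤ ((L : ℝ) + 1) * m / rho M := by positivity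
  exact ⟨div_nonneg (by linarith) (by linarith), (div_le_one (by linarith)).2 (by linarith)⟩

theorem rew_mem (M : Model X A L m) (x : X) (a : A) : rew M x a ∈ Set.Icc (0 : ℝ) 1 := by
  have := M.isProb
  exact integral_mem_Icc (by fun_prop) (M.reward_mem.mono fun o ho => ho x a)

theorem cost_mem (M : Model X A L m) (i : Fin m) (x : X) (a : A) :
    cost M i x a ∈ Set.Icc (0 : ℝ) 1 := by
  have := M.isProb
  exact integral_mem_Icc (by fun_prop) (M.cost_mem.mono fun o ho => ho i x a)

theorem thr_sub_value_le (M : Model X A L m) {π : X → A → ℝ} (hπ : IsPolicy π) (i : Fin m) :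
    M.thr i - value M.lay M.P π (cost M i) ≤ L := by
  have h1 := value_nonneg (𝓛 := M.lay) M.isTransition.1 hπ fun x a => (cost_mem M i x a).1
  linarith [(M.thr_mem i).2]

theorem bddAbove_rho (M : Model X A L m) (hm : 0 < m) : BddAbove
    ((fun π : X → A → ℝ => ⨅ i, (M.thr i - value M.lay M.P π (cost M i))) ''
      {π | IsPolicy π}) := by
  refine ⟨L, ?_⟩
  rintro _ ⟨π, hπ, rfl⟩
  exact (ciInf_le (Set.finite_range _).bddBelow (⟨0, hm⟩ : Fin m)).trans (thr_sub_value_le M hπ _)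

theorem rho_pos (hm : 0 < m) (hS : Slater M) : 0 < rho M := by
  obtain ⟨π, hπ, h⟩ := hS
  have : Nonempty (Fin m) := ⟨⟨0, hm⟩⟩
  obtain ⟨i, hi⟩ := exists_eq_ciInf_of_finite
    (f := fun i => M.thr i - value M.lay M.P π (cost M i))
  refine lt_of_lt_of_le ?_ (le_csSup (bddAbove_rho M hm) ⟨π, hπ, rfl⟩)
  change 0 < ⨅ i, (M.thr i - value M.lay M.P π (cost M i))
  rw [← hi]
  linarith [h i]

theorem rho_le (hm : 0 < m) (hS : Slater M) : rho M ≤ L := by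
  obtain ⟨π, hπ, h⟩ := hS
  refine csSup_le ⟨_, ⟨π, hπ, rfl⟩⟩ ?_
  rintro _ ⟨π, hπ, rfl⟩
  exact (ciInf_le (Set.finite_range _).bddBelow (⟨0, hm⟩ : Fin m)).trans (thr_sub_value_le M hπ _)

theorem occUp_nonneg {𝓛 : Layering X L} {π : X → A → ℝ} (hπ : IsPolicy π) (x : X) (a : A) :
    0 ≤ occUp 𝓛 (confSet 𝓛 T δ h t) π x a := by
  refine Real.sSup_nonneg ?_
  rintro _ ⟨P, hP, rfl⟩
  exact occ_nonneg hP.1 hπ x a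

/-- The estimated rewards and costs are accurate. -/
def MeanGood (M : Model X A L m) (T : ℕ) (δ : ℝ) (h : ℕ → Episode X A L m) : Prop :=
  ∀ t < T, (∀ x a, |rHat h t x a - rew M x a| ≤ phi T δ h t x a) ∧
    ∀ i x a, |gHat h t i x a - cost M i x a| ≤ xi T δ h t x a

theorem abs_sub_le_one {x y : ℝ} (hx : x ∈ Set.Icc (0 : ℝ) 1) (hy : y ∈ Set.Icc (0 : ℝ) 1) :
    |x - y| ≤ 1 :=
  abs_le.2 ⟨by linarith [hx.1, hy.2], by linarith [hx.2, hy.1]⟩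

/-- The widths are truncated at one. This is legitimate on regular histories, where averages and
means both lie in `[0, 1]`; hence the implication. -/
theorem IsRun.measure_not_meanGood {Ω : Type*} [MeasurableSpace Ω] {M : Model X A L m} {T : ℕ}
    {δ : ℝ} {μ : Measure Ω} {H : ℕ → Ω → Episode X A L m} [IsProbabilityMeasure μ] [Nonempty A]
    (hH : IsRun M T δ μ H) (hm : 0 < m) (hδ : 0 < δ) (hδ1 : δ < 1) (hT : 0 < T)
    (hlog : 1 ≤ logTerm X A T δ)
    (hlog' : 1 ≤ Real.log (T * Fintype.card X * Fintype.card A * m / δ)) :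
    μ.real {ω | ¬ (Regular M T (fun s => H s ω) → MeanGood M T δ (fun s => H s ω))} ≤
      4 * δ := by
  have : Nonempty (Fin m) := ⟨⟨0, hm⟩⟩
  have h1 := hH.measure_not_mean (I := Unit) hδ hδ1 hT (fun _ x a o => o.1 x a)
    (fun _ x a => by fun_prop) (fun _ x a => M.reward_mem.mono fun o ho => ho x a) rfl
    (by simpa using hlog)
  have h2 := hH.measure_not_mean (I := Fin m) hδ hδ1 hT (fun i x a o => o.2 i x a)
    (fun i x a => by fun_prop) (fun i x a => M.cost_mem.mono fun o ho => ho i x a) rfl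
    (by simpa using hlog')
  refine le_trans (measureReal_mono fun ω hω => ?_) ((measureReal_or_le h1 h2).trans_eq (by ring))
  by_contra hcon
  simp only [Set.mem_ofPred_eq, not_or, not_not, Fintype.card_unit, Nat.cast_one, mul_one,
    Fintype.card_fin] at hcon
  refine hω fun hr t ht => ⟨fun x a => ?_, fun i x a => ?_⟩
  · exact le_min (abs_sub_le_one (hr.rHat_mem ht.le x a) (rew_mem M x a)) (hcon.1 t ht () x a)
  · exact le_min (abs_sub_le_one (hr.gHat_mem ht.le i x a) (cost_mem M i x a))
      (hcon.2 t ht i x a)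

end Regular

/-! ### Concentration along the run -/

section Concentration

variable {X A : Type*} [Fintype X] [Fintype A] {L m : ℕ}

/-- A harmonic sum over the visits: the first contributes one, and the visit after `n ≥ 1` earlier
ones contributes `1/n ≤ 2 (log (n+1) - log n)`. -/
theorem sum_visited_div_den_le (h : ℕ → Episode X A L m) (t : ℕ) (x : X) (a : A) :
    ∑ s ∈ Finset.range t, (if Visited (h s) x a then 1 / den h s x a else 0) ≤
      if visits h t x a = 0 then 0 else 1 + 2 * Real.log (visits h t x a) := by
  induction t with
  | zero => simp [visits]
  | succ t ih =>
    rw [Finset.sum_range_succ]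
    by_cases hv : Visited (h t) x a
    · have h1 : visits h (t + 1) x a = visits h t x a + 1 := by
        simp only [visits, Finset.range_add_one, Finset.filter_insert, hv, if_true]
        rw [Finset.card_insert_of_notMem (by simp)]
      rw [if_pos hv, h1, if_neg (Nat.succ_ne_zero _)]
      by_cases hn : visits h t x a = 0
      · rw [if_pos hn] at ih
        simp only [den_eq_one hn, hn, zero_add, Nat.cast_one, Real.log_one]
        linarith
      · rw [if_neg hn] at ih
        rw [den_eq_visits hn]
        have hn1 : (1 : ℝ) ≤ visits h t x a := by exact_mod_cast Nat.one_le_iff_ne_zero.2 hn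
        set n : ℝ := (visits h t x a : ℝ) with hndef
        have h2 := Real.one_sub_inv_le_log_of_pos (x := (n + 1) / n) (by positivity)
        rw [Real.log_div (by positivity) (by positivity), inv_div] at h2
        have h3 : 1 / n ≤ 2 * (1 - n / (n + 1)) := by
          rw [one_sub_div (by positivity), add_sub_cancel_left, ← mul_div_assoc, div_le_div_iff₀
            (by positivity) (by positivity)]
          linarith
        push_cast
        linarith
    · have h1 : visits h (t + 1) x a = visits h t x a := by
        simp only [visits, Finset.range_add_one, Finset.filter_insert, hv, if_false]
      rw [if_neg hv, h1, add_zero]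
      exact ih

theorem log_le_logTerm {T : ℕ} {δ : ℝ} [Nonempty X] [Nonempty A] (hδ : 0 < δ) (hδ1 : δ < 1)
    (hT : 0 < T) : Real.log T ≤ logTerm X A T δ := by
  have hX : (1 : ℝ) ≤ Fintype.card X := by exact_mod_cast Fintype.card_pos
  have hA : (1 : ℝ) ≤ Fintype.card A := by exact_mod_cast Fintype.card_pos
  have hT' : (0 : ℝ) < T := by exact_mod_cast hT
  refine Real.log_le_log hT' ?_
  rw [le_div_iff₀ hδ, mul_assoc]
  exact mul_le_mul_of_nonneg_left (hδ1.le.trans (one_le_mul_of_one_le_of_one_le hX hA)) hT'.le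

theorem exp_neg_logTerm {T : ℕ} {δ : ℝ} [Nonempty X] [Nonempty A] (hδ : 0 < δ) (hT : 0 < T) :
    Real.exp (-logTerm X A T δ) = δ / (T * Fintype.card X * Fintype.card A) := by
  have hX : (0 : ℝ) < Fintype.card X := by exact_mod_cast Fintype.card_pos
  have hA : (0 : ℝ) < Fintype.card A := by exact_mod_cast Fintype.card_pos
  have hT' : (0 : ℝ) < T := by exact_mod_cast hT
  rw [← Real.log_inv, Real.exp_log (by positivity), inv_div]

/-- The expected number of visits, discounted by the past visits, is logarithmic. -/
def VisitGood (M : Model X A L m) (T : ℕ) (δ : ℝ) (h : ℕ → Episode X A L m) : Prop :=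
  ∀ x a, M.lay.layer x < L → ∑ t ∈ Finset.range T,
    occ M.lay M.P (policy M T δ h t) x a / den h t x a ≤ 10 * logTerm X A T δ

section Quantities

variable (M : Model X A L m) (T : ℕ) (δ : ℝ) (h : ℕ → Episode X A L m) (t : ℕ)

/-- The loss vector fed to the policy optimization. -/
def fedLoss : X → A → ℝ := scaledLoss M T δ h t (policy M T δ h t)

/-- The upper occupancy bound of the current policy. -/
def runUp (x : X) (a : A) : ℝ :=
  occUp M.lay (confSet M.lay T δ h t) (policy M T δ h t) x a

/-- The lower occupancy bound of the current policy. -/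
def runLow (x : X) (a : A) : ℝ :=
  occLow M.lay (confSet M.lay T δ h t) (policy M T δ h t) x a

/-- The occupancy of the current policy. -/
def runOcc (x : X) (a : A) : ℝ := occ M.lay M.P (policy M T δ h t) x a

/-- The action value of the current policy and loss. -/
def runQ (x : X) (a : A) : ℝ :=
  qgo M.P (policy M T δ h t) (fedLoss M T δ h t) (L - (M.lay.layer x + 1)) x a

/-- The estimated action value. -/
def runQHat (x : X) (a : A) : ℝ :=
  qEst M.lay (gam X A L T) (confSet M.lay T δ h t) (policy M T δ h t) (h t).1
    (fedLoss M T δ h t) x a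

end Quantities

theorem eta_pos {T : ℕ} [Nonempty X] [Nonempty A] (hL : 0 < L) (hT : 0 < T) :
    0 < eta X A L T := by
  have hX : (0 : ℝ) < Fintype.card X := by exact_mod_cast Fintype.card_pos
  have hA : (0 : ℝ) < Fintype.card A := by exact_mod_cast Fintype.card_pos
  have hT' : (0 : ℝ) < T := by exact_mod_cast hT
  have hL' : (0 : ℝ) < L := by exact_mod_cast hL
  exact lt_min (by positivity) (by positivity)

theorem gam_pos {T : ℕ} [Nonempty X] [Nonempty A] (hL : 0 < L) (hT : 0 < T) :
    0 < gam X A L T := by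
  have hL' : (0 : ℝ) < L := by exact_mod_cast hL
  have := eta_pos (X := X) (A := A) hL hT
  simp only [gam]
  positivity

/-- The estimated action values concentrate, with respect to the current policies and to a
comparator. -/
structure QHatGood (M : Model X A L m) (T : ℕ) (δ : ℝ) (σ : X → A → ℝ)
    (h : ℕ → Episode X A L m) (x : X) : Prop where
  own : ∑ t ∈ Finset.range T, ∑ a, policy M T δ h t x a *
      (runOcc M T δ h t x a * runQ M T δ h t x a / (runUp M T δ h t x a + gam X A L T)) ≤
    ∑ t ∈ Finset.range T, ∑ a, policy M T δ h t x a * runQHat M T δ h t x a +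
      gam X A L T / L * ∑ t ∈ Finset.range T, ∑ a, policy M T δ h t x a *
        (L * L * runOcc M T δ h t x a / (runUp M T δ h t x a + gam X A L T) ^ 2) +
      logTerm X A T δ / (gam X A L T / L)
  comparator : ∑ t ∈ Finset.range T, ∑ a, σ x a * runQHat M T δ h t x a ≤
    ∑ t ∈ Finset.range T, ∑ a, σ x a *
      (runOcc M T δ h t x a * runQ M T δ h t x a / (runUp M T δ h t x a + gam X A L T)) +
      gam X A L T / L * ∑ t ∈ Finset.range T, ∑ a, σ x a *
        (L * (runOcc M T δ h t x a * runQ M T δ h t x a) /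
          (runUp M T δ h t x a + gam X A L T) ^ 2) +
      logTerm X A T δ / (gam X A L T / L)
  square : ∑ t ∈ Finset.range T, ∑ a, policy M T δ h t x a * runQHat M T δ h t x a ^ 2 ≤
    2 * ∑ t ∈ Finset.range T, ∑ a, policy M T δ h t x a *
        (L * L * runOcc M T δ h t x a / (runUp M T δ h t x a + gam X A L T) ^ 2) +
      logTerm X A T δ / (gam X A L T / L) ^ 2

/-! ### Moments of the estimated action values -/

section Moments

variable {𝓛 : Layering X L} {P : X → A → X → ℝ} {π : X → A → ℝ} {ℓ : X → A → ℝ} {x : X}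
  {w d : A → ℝ}

theorem texp_weighted (hP : IsTransition 𝓛 P) (hπ : IsPolicy π) (hx : 𝓛.layer x < L) :
    texp 𝓛 P π (fun τ => ∑ a, w a * (lossFrom ℓ x a τ / d a)) =
      ∑ a, w a * (occ 𝓛 P π x a * qgo P π ℓ (L - (𝓛.layer x + 1)) x a / d a) := by
  rw [texp_sum]
  refine Finset.sum_congr rfl fun a _ => ?_
  have h1 : ∀ τ : Trajectory X A L, w a * (lossFrom ℓ x a τ / d a) =
      w a / d a * lossFrom ℓ x a τ := fun τ => by ring
  simp only [h1, texp_smul, texp_lossFrom hP hπ ℓ a hx]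
  ring

theorem weighted_sq_le (hw0 : ∀ a, 0 ≤ w a) (hw1 : ∑ a, w a = 1) {z : A → ℝ}
    (hz : ∀ a, 0 ≤ z a) : (∑ a, w a * z a) ^ 2 ≤ ∑ a, w a * z a ^ 2 :=
  Real.pow_arith_mean_le_arith_mean_pow _ _ _ (fun a _ => hw0 a) hw1 (fun a _ => hz a) 2

/-- Two bounds for one second moment. The comparator needs the one proportional to occupancy times
action value, which fits into the slack of implicit exploration; the policy's own terms use the
cruder one with `L²`, charged to the local bonus. -/
theorem texp_weighted_sq_le (hP : IsTransition 𝓛 P) (hπ : IsPolicy π) (hx : 𝓛.layer x < L)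
    (h0 : ∀ x a, 0 ≤ ℓ x a) (h1 : ∀ x a, ℓ x a ≤ 1) (hw0 : ∀ a, 0 ≤ w a) :
    texp 𝓛 P π (fun τ => ∑ a, w a * (lossFrom ℓ x a τ / d a) ^ 2) ≤
      ∑ a, w a * (L * (occ 𝓛 P π x a * qgo P π ℓ (L - (𝓛.layer x + 1)) x a) / d a ^ 2) ∧
    texp 𝓛 P π (fun τ => ∑ a, w a * (lossFrom ℓ x a τ / d a) ^ 2) ≤
      ∑ a, w a * (L * L * occ 𝓛 P π x a / d a ^ 2) := by
  simp only [texp_sum]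
  constructor
  · refine Finset.sum_le_sum fun a _ => ?_
    calc _ ≤ texp 𝓛 P π (fun τ => w a * L / d a ^ 2 * lossFrom ℓ x a τ) := by
          refine texp_mono hP hπ fun τ hτ => ?_
          obtain ⟨h2, h3⟩ := hτ.lossFrom_mem hP h0 h1 a hx
          have h4 : lossFrom ℓ x a τ ≤ L := h3.trans (by split_ifs <;> simp)
          rw [div_pow, show w a * L / d a ^ 2 * lossFrom ℓ x a τ =
            w a * (L * lossFrom ℓ x a τ / d a ^ 2) by ring]
          refine mul_le_mul_of_nonneg_left (div_le_div_of_nonneg_right ?_ (sq_nonneg _)) (hw0 a)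
          nlinarith
      _ = _ := by rw [texp_smul, texp_lossFrom hP hπ ℓ a hx]; ring
  · refine Finset.sum_le_sum fun a _ => ?_
    calc _ ≤ texp 𝓛 P π (fun τ => w a * (L * L) / d a ^ 2 * (if Hits τ x a then 1 else 0)) := by
          refine texp_mono hP hπ fun τ hτ => ?_
          obtain ⟨h2, h3⟩ := hτ.lossFrom_mem hP h0 h1 a hx
          rw [div_pow, show w a * (L * L) / d a ^ 2 * (if Hits τ x a then (1 : ℝ) else 0) =
            w a * (L * L * (if Hits τ x a then (1 : ℝ) else 0) / d a ^ 2) by ring]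
          refine mul_le_mul_of_nonneg_left (div_le_div_of_nonneg_right ?_ (sq_nonneg _)) (hw0 a)
          split_ifs at h3 ⊢ <;> nlinarith
      _ = _ := by rw [texp_smul, texp_hits hP hπ a hx]; ring

theorem Follows.quotient_mem (hP : IsTransition 𝓛 P) (hx : 𝓛.layer x < L)
    (h0 : ∀ x a, 0 ≤ ℓ x a) (h1 : ∀ x a, ℓ x a ≤ 1) {γ : ℝ} (hγ : 0 < γ) (hd : ∀ a, γ ≤ d a)
    {τ : Trajectory X A L} (hτ : Follows 𝓛 P τ) (a : A) :
    0 ≤ lossFrom ℓ x a τ / d a ∧ lossFrom ℓ x a τ / d a ≤ L / γ := by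
  obtain ⟨h2, h3⟩ := hτ.lossFrom_mem hP h0 h1 a hx
  have h4 : lossFrom ℓ x a τ ≤ L := h3.trans (by split_ifs <;> simp)
  exact ⟨div_nonneg h2 (hγ.le.trans (hd a)), div_le_div₀ (Nat.cast_nonneg L) h4 hγ (hd a)⟩

theorem weighted_le (hw0 : ∀ a, 0 ≤ w a) (hw1 : ∑ a, w a = 1) {z : A → ℝ} {c : ℝ}
    (hz : ∀ a, z a ≤ c) : ∑ a, w a * z a ≤ c :=
  (Finset.sum_le_sum fun a _ => mul_le_mul_of_nonneg_left (hz a) (hw0 a)).trans_eq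
    (by rw [← Finset.sum_mul, hw1, one_mul])

end Moments

/-! ### Probability of the good events for visits and action values -/

section Run

variable {Ω : Type*} [MeasurableSpace Ω] {M : Model X A L m} {T : ℕ} {δ : ℝ} {μ : Measure Ω}
  {H : ℕ → Ω → Episode X A L m} [IsProbabilityMeasure μ] [Nonempty A]

/-- Freedman's inequality for the negated discounted visits with `c = 1/2`: the variance uses up at
most half of the mean, and the other half is bounded by the realized harmonic sum, at most `3 u`,
plus `2 u`. Hence the constant `10`. -/
theorem IsRun.measure_not_visitGood (hH : IsRun M T δ μ H) (hδ : 0 < δ) (hδ1 : δ < 1)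
    (hT : 0 < T) (hlog : 1 ≤ logTerm X A T δ) :
    μ.real {ω | ¬ VisitGood M T δ (fun s => H s ω)} ≤ δ := by
  have : Nonempty X := ⟨M.lay.start⟩
  set u := logTerm X A T δ with hu
  let Y : X × A → ℕ → Ω → Trajectory X A L → ℝ := fun p s ω τ =>
    -(1 / den (fun s => H s ω) s p.1 p.2) * (if Hits τ p.1 p.2 then 1 else 0)
  have hden : ∀ (p : X × A) s, Measurable[past H s] fun ω => den (fun s => H s ω) s p.1 p.2 :=
    fun p s => @measurable_den X A _ _ L m Ω (past H s) (fun ω s => H s ω) s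
      (fun _ hs => measurable_past hs) p.1 p.2
  have hbad : ∀ p : X × A, μ.real {ω | ∑ s ∈ Finset.range T,
      texp M.lay M.P (runPolicy M T δ H s ω) (Y p s ω) + 1 / 2 * ∑ s ∈ Finset.range T,
        texp M.lay M.P (runPolicy M T δ H s ω) (fun τ => Y p s ω τ ^ 2) + u / (1 / 2) <
        ∑ s ∈ Finset.range T, Y p s ω (H s ω).1} ≤ Real.exp (-u) := by
    intro p
    refine hH.measure_sum_texp_lt_le (fun s hs τ => ?_) (by norm_num) (fun s hs => ?_) u
    · exact (((hden p s).const_div 1).neg).mul_const _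
    · refine Filter.Eventually.of_forall fun ω τ _ => ?_
      have h1 := one_le_den (fun s => H s ω) s p.1 p.2
      have h2 : 1 / den (fun s => H s ω) s p.1 p.2 ≤ 1 := by
        rw [div_le_one (by linarith)]; exact h1
      have h3 : 0 ≤ 1 / den (fun s => H s ω) s p.1 p.2 := by positivity
      simp only [Y]
      rw [abs_le]
      split_ifs <;> constructor <;> linarith
  refine le_trans (measureReal_mono fun ω hω => ?_)
    ((measureReal_exists_le _ hbad).trans ?_)
  · by_contra hcon
    simp only [Set.mem_ofPred_eq, not_exists, not_lt] at hcon
    refine hω fun x a hx => ?_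
    have h1 := hcon (x, a)
    have hπ := isPolicy_runPolicy M T δ H
    have e1 : ∀ s, texp M.lay M.P (runPolicy M T δ H s ω) (Y (x, a) s ω) =
        -(occ M.lay M.P (policy M T δ (fun s => H s ω) s) x a / den (fun s => H s ω) s x a) := by
      intro s
      simp only [Y, texp_smul, texp_hits M.isTransition (hπ s ω) a hx]
      ring
    have e2 : ∀ s, texp M.lay M.P (runPolicy M T δ H s ω) (fun τ => Y (x, a) s ω τ ^ 2) ≤
        occ M.lay M.P (policy M T δ (fun s => H s ω) s) x a / den (fun s => H s ω) s x a := by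
      intro s
      have h3 : ∀ τ : Trajectory X A L, Y (x, a) s ω τ ^ 2 =
          (1 / den (fun s => H s ω) s x a) ^ 2 * (if Hits τ x a then 1 else 0) := by
        intro τ
        simp only [Y]
        split_ifs <;> ring
      simp only [h3, texp_smul, texp_hits M.isTransition (hπ s ω) a hx]
      have h4 := one_le_den (fun s => H s ω) s x a
      have h5 : 1 / den (fun s => H s ω) s x a ≤ 1 := by rw [div_le_one (by linarith)]; exact h4
      have h6 : 0 ≤ 1 / den (fun s => H s ω) s x a := by positivity
      have h7 := occ_nonneg M.isTransition (hπ s ω) x a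
      have h8 : (1 / den (fun s => H s ω) s x a) ^ 2 ≤ 1 / den (fun s => H s ω) s x a := by
        nlinarith
      exact (mul_le_mul_of_nonneg_right h8 h7).trans_eq (by ring)
    have e3 : ∑ s ∈ Finset.range T, Y (x, a) s ω (H s ω).1 =
        -∑ s ∈ Finset.range T, (if Visited (H s ω) x a then
          1 / den (fun s => H s ω) s x a else 0) := by
      rw [← Finset.sum_neg_distrib]
      refine Finset.sum_congr rfl fun s _ => ?_
      simp only [Y]
      have : Hits (H s ω).1 x a ↔ Visited (H s ω) x a := Iff.rfl
      simp only [this]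
      split_ifs <;> ring
    have e4 := Finset.sum_le_sum fun s (_ : s ∈ Finset.range T) => e2 s
    have e5 := sum_visited_div_den_le (fun s => H s ω) T x a
    have e6 : (if visits (fun s => H s ω) T x a = 0 then (0 : ℝ) else
        1 + 2 * Real.log (visits (fun s => H s ω) T x a)) ≤ 3 * u := by
      split_ifs with hn
      · linarith
      · have hn1 : (0 : ℝ) < visits (fun s => H s ω) T x a := by
          exact_mod_cast Nat.pos_of_ne_zero hn
        have := (Real.log_le_log hn1 (show (visits (fun s => H s ω) T x a : ℝ) ≤ T by
          exact_mod_cast visits_le (fun s => H s ω) T x a)).trans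
          (log_le_logTerm (X := X) (A := A) hδ hδ1 hT)
        linarith
    rw [e3, Finset.sum_congr rfl fun s _ => e1 s, Finset.sum_neg_distrib] at h1
    linarith
  · rw [hu, exp_neg_logTerm hδ hT, Fintype.card_prod]
    have hX : (1 : ℝ) ≤ Fintype.card X := by exact_mod_cast Fintype.card_pos
    have hA : (1 : ℝ) ≤ Fintype.card A := by exact_mod_cast Fintype.card_pos
    have hT' : (1 : ℝ) ≤ T := by exact_mod_cast hT
    push_cast
    rw [← mul_div_assoc, div_le_iff₀ (by positivity)]
    nlinarith [mul_pos (mul_pos (show (0 : ℝ) < Fintype.card X by linarith)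
      (show (0 : ℝ) < Fintype.card A by linarith)) hδ]

/-- One application of Freedman's inequality per field. Estimates are at most `L/γ`, which dictates
the parameter `γ/L`, and `(γ/L)²` for the squares. The comparator is fixed beforehand, so its
weights are deterministic. -/
theorem IsRun.measure_not_qHatGood (hH : IsRun M T δ μ H) (hL : 0 < L) (hρ : 0 < rho M)
    (hδ : 0 < δ) (hT : 0 < T) {σ : X → A → ℝ} (hσ : IsPolicy σ) :
    μ.real {ω | ¬ (Regular M T (fun s => H s ω) → ∀ x, M.lay.layer x < L →
      QHatGood M T δ σ (fun s => H s ω) x)} ≤ 3 * δ := by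
  have : Nonempty X := ⟨M.lay.start⟩
  set u := logTerm X A T δ with hu
  set γ := gam X A L T with hγdef
  have hγ : 0 < γ := gam_pos hL hT
  have hL' : (0 : ℝ) < L := by exact_mod_cast hL
  have hπ := isPolicy_runPolicy M T δ H
  let d : ℕ → Ω → X → A → ℝ := fun s ω x a => runUp M T δ (fun s => H s ω) s x a + γ
  have hd : ∀ s ω x a, γ ≤ d s ω x a := fun s ω x a => by
    have := occUp_nonneg (𝓛 := M.lay) (T := T) (δ := δ) (h := fun s => H s ω) (t := s)
      (hπ s ω) x a
    simp only [d, runUp]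
    linarith
  let z : X → ℕ → Ω → Trajectory X A L → A → ℝ := fun x s ω τ a =>
    lossFrom (fedLoss M T δ (fun s => H s ω) s) x a τ / d s ω x a
  have hpm : ∀ s x a, Measurable[past H s] fun ω => policy M T δ (fun s => H s ω) s x a :=
    measurable_runPolicy M T δ H
  have hzm : ∀ x s τ a, Measurable[past H s] fun ω => z x s ω τ a := by
    intro x s τ a
    let _ : MeasurableSpace Ω := past H s
    have hh : ∀ r < s, Measurable fun ω => H r ω := fun _ hr => measurable_past hr
    exact (measurable_lossFrom (measurable_scaledLoss (h := fun ω s => H s ω) M T δ hh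
      (hpm s)) x a τ).div ((measurable_occUp (h := fun ω s => H s ω) M T δ hh
      (hpm s) x a).add_const γ)
  have hℓ : ∀ᵐ ω ∂μ, ∀ s < T, ∀ x a, 0 ≤ fedLoss M T δ (fun s => H s ω) s x a ∧
      fedLoss M T δ (fun s => H s ω) s x a ≤ 1 := by
    filter_upwards [hH.ae_regular] with ω hω s hs x a
    exact hω.scaledLoss_mem hL hρ hs.le _ x a
  have hcz : γ / L * (L / γ) = 1 := by field_simp
  have hz : ∀ x, M.lay.layer x < L → ∀ᵐ ω ∂μ, ∀ s < T, ∀ τ, Follows M.lay M.P τ → ∀ a,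
      0 ≤ z x s ω τ a ∧ z x s ω τ a ≤ L / γ := by
    intro x hx
    filter_upwards [hℓ] with ω hω s hs τ hτ a
    exact hτ.quotient_mem M.isTransition hx (fun x a => (hω s hs x a).1)
      (fun x a => (hω s hs x a).2) hγ (hd s ω x) a
  have hwz : ∀ x, M.lay.layer x < L → ∀ w : ℕ → Ω → A → ℝ,
      (∀ s ω, (∀ a, 0 ≤ w s ω a) ∧ ∑ a, w s ω a = 1) →
      ∀ s < T, ∀ᵐ ω ∂μ, ∀ τ, Follows M.lay M.P τ →
        |γ / L * ∑ a, w s ω a * z x s ω τ a| ≤ 1 := by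
    intro x hx w hw s hs
    filter_upwards [hz x hx] with ω hω τ hτ
    have h1 := weighted_le (hw s ω).1 (hw s ω).2 fun a => (hω s hs τ hτ a).2
    have h2 : 0 ≤ ∑ a, w s ω a * z x s ω τ a :=
      Finset.sum_nonneg fun a _ => mul_nonneg ((hw s ω).1 a) (hω s hs τ hτ a).1
    rw [abs_of_nonneg (by positivity)]
    calc _ ≤ γ / L * (L / γ) := mul_le_mul_of_nonneg_left h1 (by positivity)
      _ = 1 := hcz
  let Y1 : X → ℕ → Ω → Trajectory X A L → ℝ := fun x s ω τ =>
    -∑ a, policy M T δ (fun s => H s ω) s x a * z x s ω τ a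
  let Y2 : X → ℕ → Ω → Trajectory X A L → ℝ := fun x s ω τ => ∑ a, σ x a * z x s ω τ a
  let Y3 : X → ℕ → Ω → Trajectory X A L → ℝ := fun x s ω τ =>
    ∑ a, policy M T δ (fun s => H s ω) s x a * z x s ω τ a ^ 2
  let bad : (X → ℕ → Ω → Trajectory X A L → ℝ) → ℝ → X → Ω → Prop := fun Y c x ω =>
    M.lay.layer x < L ∧ ∑ s ∈ Finset.range T,
      texp M.lay M.P (runPolicy M T δ H s ω) (Y x s ω) + c * ∑ s ∈ Finset.range T,
        texp M.lay M.P (runPolicy M T δ H s ω) (fun τ => Y x s ω τ ^ 2) + u / c <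
        ∑ s ∈ Finset.range T, Y x s ω (H s ω).1
  have hbad : ∀ (Y : X → ℕ → Ω → Trajectory X A L → ℝ) (c : ℝ), 0 < c →
      (∀ x, M.lay.layer x < L → ∀ s < T, ∀ τ, Measurable[past H s] fun ω => Y x s ω τ) →
      (∀ x, M.lay.layer x < L → ∀ s < T, ∀ᵐ ω ∂μ, ∀ τ, Follows M.lay M.P τ →
        |c * Y x s ω τ| ≤ 1) → μ.real {ω | ∃ x, bad Y c x ω} ≤ δ := by
    intro Y c hc hm hb
    refine (measureReal_exists_le _ (c := Real.exp (-u)) fun x => ?_).trans ?_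
    · by_cases hx : M.lay.layer x < L
      · refine le_trans (measureReal_mono fun ω hω => hω.2)
          (hH.measure_sum_texp_lt_le (hm x hx) hc (hb x hx) u)
      · have : {ω | bad Y c x ω} = ∅ := by
          ext ω
          simp [bad, hx]
        rw [this, measureReal_empty]
        exact (Real.exp_pos _).le
    · rw [hu, exp_neg_logTerm hδ hT]
      have hX : (1 : ℝ) ≤ Fintype.card X := by exact_mod_cast Fintype.card_pos
      have hA : (1 : ℝ) ≤ Fintype.card A := by exact_mod_cast Fintype.card_pos
      have hT' : (1 : ℝ) ≤ T := by exact_mod_cast hT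
      rw [← mul_div_assoc, div_le_iff₀ (by positivity)]
      have h1 : (Fintype.card X : ℝ) ≤ T * Fintype.card X * Fintype.card A := by
        calc (Fintype.card X : ℝ) ≤ T * Fintype.card X := le_mul_of_one_le_left (by linarith) hT'
          _ ≤ _ := le_mul_of_one_le_right (by positivity) hA
      rw [mul_comm δ]
      exact mul_le_mul_of_nonneg_right h1 hδ.le
  have b1 := hbad Y1 (γ / L) (by positivity)
    (fun x _ s _ τ => (Finset.measurable_sum _ fun a _ => (hpm s x a).mul (hzm x s τ a)).neg)
    (fun x hx s hs => by
      filter_upwards [hwz x hx (fun s ω a => policy M T δ (fun s => H s ω) s x a)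
        (fun s ω => hπ s ω x) s hs] with ω hω τ hτ
      simp only [Y1, mul_neg, abs_neg]
      exact hω τ hτ)
  have b2 := hbad Y2 (γ / L) (by positivity)
    (fun x _ s _ τ => Finset.measurable_sum _ fun a _ => (hzm x s τ a).const_mul (σ x a))
    (fun x hx s hs => hwz x hx (fun _ _ a => σ x a) (fun _ _ => hσ x) s hs)
  have hY3 : ∀ x, M.lay.layer x < L → ∀ᵐ ω ∂μ, ∀ s < T, ∀ τ, Follows M.lay M.P τ →
      0 ≤ Y3 x s ω τ ∧ Y3 x s ω τ ≤ (L / γ) ^ 2 := by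
    intro x hx
    filter_upwards [hz x hx] with ω hω s hs τ hτ
    refine ⟨Finset.sum_nonneg fun a _ => mul_nonneg ((hπ s ω x).1 a) (sq_nonneg _),
      weighted_le (hπ s ω x).1 (hπ s ω x).2 fun a => ?_⟩
    exact pow_le_pow_left₀ (hω s hs τ hτ a).1 (hω s hs τ hτ a).2 2
  have hcz2 : (γ / L) ^ 2 * (L / γ) ^ 2 = 1 := by rw [← mul_pow, hcz, one_pow]
  have b3 := hbad Y3 ((γ / L) ^ 2) (by positivity)
    (fun x _ s _ τ => Finset.measurable_sum _ fun a _ =>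
      (hpm s x a).mul ((hzm x s τ a).pow_const 2))
    (fun x hx s hs => by
      filter_upwards [hY3 x hx] with ω hω τ hτ
      obtain ⟨h1, h2⟩ := hω s hs τ hτ
      rw [abs_of_nonneg (by positivity)]
      calc _ ≤ (γ / L) ^ 2 * (L / γ) ^ 2 := mul_le_mul_of_nonneg_left h2 (by positivity)
        _ = 1 := hcz2)
  refine le_trans (measureReal_mono (s₂ := {ω | (∃ x, bad Y1 (γ / L) x ω) ∨
    ((∃ x, bad Y2 (γ / L) x ω) ∨ ∃ x, bad Y3 ((γ / L) ^ 2) x ω)}) fun ω hω => ?_)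
    ((measureReal_or_le b1 (measureReal_or_le b2 b3)).trans_eq (by ring))
  by_contra hcon
  simp only [Set.mem_ofPred_eq, not_or, not_exists] at hcon
  refine hω fun hr x hx => ?_
  obtain ⟨c1, c2, c3⟩ := hcon
  replace c1 := c1 x
  replace c2 := c2 x
  replace c3 := c3 x
  simp only [bad, hx, true_and, not_lt] at c1 c2 c3
  have hℓω : ∀ s < T, ∀ x a, 0 ≤ fedLoss M T δ (fun s => H s ω) s x a ∧
      fedLoss M T δ (fun s => H s ω) s x a ≤ 1 := fun s hs x a =>
    hr.scaledLoss_mem hL hρ hs.le _ x a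
  have hzω : ∀ s < T, ∀ τ, Follows M.lay M.P τ → ∀ a,
      0 ≤ z x s ω τ a ∧ z x s ω τ a ≤ L / γ := fun s hs τ hτ a =>
    hτ.quotient_mem M.isTransition hx (fun x a => (hℓω s hs x a).1)
      (fun x a => (hℓω s hs x a).2) hγ (hd s ω x) a
  have hq : ∀ s a, z x s ω (H s ω).1 a = runQHat M T δ (fun s => H s ω) s x a := fun s a =>
    (qEst_eq (𝓛 := M.lay) γ (confSet M.lay T δ (fun s => H s ω) s) (H s ω).1
      (fedLoss M T δ (fun s => H s ω) s) x a).symm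
  have hsq : ∀ s < T, ∀ w : A → ℝ, (∀ a, 0 ≤ w a) → ∑ a, w a = 1 →
      texp M.lay M.P (runPolicy M T δ H s ω) (fun τ => (∑ a, w a * z x s ω τ a) ^ 2) ≤
      texp M.lay M.P (runPolicy M T δ H s ω) (fun τ => ∑ a, w a * z x s ω τ a ^ 2) :=
    fun s hs w hw0 hw1 => texp_mono M.isTransition (hπ s ω) fun τ hτ =>
      weighted_sq_le hw0 hw1 fun a => (hzω s hs τ hτ a).1
  have hmom := fun s (hs : s < T) (w : A → ℝ) (hw0 : ∀ a, 0 ≤ w a) =>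
    texp_weighted_sq_le (w := w) (d := d s ω x) M.isTransition (hπ s ω) hx
      (fun x a => (hℓω s hs x a).1) (fun x a => (hℓω s hs x a).2) hw0
  have hmean := fun s (w : A → ℝ) => texp_weighted (w := w) (d := d s ω x)
    (ℓ := fedLoss M T δ (fun s => H s ω) s) M.isTransition (hπ s ω) hx
  have hcpos : 0 < γ / L := by positivity
  refine ⟨?_, ?_, ?_⟩
  · have e1 : ∀ s, texp M.lay M.P (runPolicy M T δ H s ω) (Y1 x s ω) =
        -∑ a, policy M T δ (fun s => H s ω) s x a * (runOcc M T δ (fun s => H s ω) s x a *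
          runQ M T δ (fun s => H s ω) s x a / (runUp M T δ (fun s => H s ω) s x a + γ)) := by
      intro s
      have h1 := texp_smul (𝓛 := M.lay) (P := M.P) (π := runPolicy M T δ H s ω) (-1)
        (fun τ => ∑ a, policy M T δ (fun s => H s ω) s x a * z x s ω τ a)
      simp only [neg_one_mul] at h1
      exact h1.trans (congrArg _ (hmean s _))
    have e2 : ∀ s ∈ Finset.range T,
        texp M.lay M.P (runPolicy M T δ H s ω) (fun τ => Y1 x s ω τ ^ 2) ≤
        ∑ a, policy M T δ (fun s => H s ω) s x a * (L * L * runOcc M T δ (fun s => H s ω) s x a /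
          (runUp M T δ (fun s => H s ω) s x a + γ) ^ 2) := by
      intro s hs
      have hs := Finset.mem_range.1 hs
      simp only [Y1, neg_sq]
      exact (hsq s hs _ (hπ s ω x).1 (hπ s ω x).2).trans (hmom s hs _ (hπ s ω x).1).2
    have e3 : ∑ s ∈ Finset.range T, Y1 x s ω (H s ω).1 = -∑ s ∈ Finset.range T,
        ∑ a, policy M T δ (fun s => H s ω) s x a * runQHat M T δ (fun s => H s ω) s x a := by
      simp only [Y1, hq, Finset.sum_neg_distrib]
    rw [e3, Finset.sum_congr rfl fun s _ => e1 s, Finset.sum_neg_distrib] at c1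
    have e4 := mul_le_mul_of_nonneg_left (Finset.sum_le_sum e2) hcpos.le
    linarith
  · have e1 : ∀ s, texp M.lay M.P (runPolicy M T δ H s ω) (Y2 x s ω) =
        ∑ a, σ x a * (runOcc M T δ (fun s => H s ω) s x a *
          runQ M T δ (fun s => H s ω) s x a / (runUp M T δ (fun s => H s ω) s x a + γ)) :=
      fun s => hmean s _
    have e2 : ∀ s ∈ Finset.range T,
        texp M.lay M.P (runPolicy M T δ H s ω) (fun τ => Y2 x s ω τ ^ 2) ≤
        ∑ a, σ x a * (L * (runOcc M T δ (fun s => H s ω) s x a *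
          runQ M T δ (fun s => H s ω) s x a) /
          (runUp M T δ (fun s => H s ω) s x a + γ) ^ 2) := by
      intro s hs
      have hs := Finset.mem_range.1 hs
      exact (hsq s hs _ (hσ x).1 (hσ x).2).trans (hmom s hs _ (hσ x).1).1
    have e3 : ∑ s ∈ Finset.range T, Y2 x s ω (H s ω).1 = ∑ s ∈ Finset.range T,
        ∑ a, σ x a * runQHat M T δ (fun s => H s ω) s x a := by
      simp only [Y2, hq]
    rw [e3, Finset.sum_congr rfl fun s _ => e1 s] at c2
    have e4 := mul_le_mul_of_nonneg_left (Finset.sum_le_sum e2) hcpos.le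
    linarith
  · have e1 : ∀ s ∈ Finset.range T, texp M.lay M.P (runPolicy M T δ H s ω) (Y3 x s ω) ≤
        ∑ a, policy M T δ (fun s => H s ω) s x a * (L * L * runOcc M T δ (fun s => H s ω) s x a /
          (runUp M T δ (fun s => H s ω) s x a + γ) ^ 2) := by
      intro s hs
      exact (hmom s (Finset.mem_range.1 hs) _ (hπ s ω x).1).2
    -- Since `Y3 ≤ (L/γ)²`, the variance term is at most the mean; this produces the factor two in
    -- `square`.
    have e2 : ∀ s ∈ Finset.range T,
        (γ / L) ^ 2 * texp M.lay M.P (runPolicy M T δ H s ω) (fun τ => Y3 x s ω τ ^ 2) ≤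
        texp M.lay M.P (runPolicy M T δ H s ω) (Y3 x s ω) := by
      intro s hs
      have hs := Finset.mem_range.1 hs
      rw [← texp_smul]
      refine texp_mono M.isTransition (hπ s ω) fun τ hτ => ?_
      have h1 : 0 ≤ Y3 x s ω τ :=
        Finset.sum_nonneg fun a _ => mul_nonneg ((hπ s ω x).1 a) (sq_nonneg _)
      have h2 : Y3 x s ω τ ≤ (L / γ) ^ 2 := weighted_le (hπ s ω x).1 (hπ s ω x).2 fun a =>
        pow_le_pow_left₀ (hzω s hs τ hτ a).1 (hzω s hs τ hτ a).2 2
      calc (γ / L) ^ 2 * Y3 x s ω τ ^ 2 = (γ / L) ^ 2 * Y3 x s ω τ * Y3 x s ω τ := by ring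
        _ ≤ (γ / L) ^ 2 * (L / γ) ^ 2 * Y3 x s ω τ := by gcongr
        _ = Y3 x s ω τ := by rw [hcz2, one_mul]
    have e3 : ∑ s ∈ Finset.range T, Y3 x s ω (H s ω).1 = ∑ s ∈ Finset.range T,
        ∑ a, policy M T δ (fun s => H s ω) s x a *
          runQHat M T δ (fun s => H s ω) s x a ^ 2 := by
      simp only [Y3, hq]
    rw [e3, Finset.mul_sum] at c3
    have e4 := Finset.sum_le_sum e2
    have e5 := Finset.sum_le_sum e1
    linarith

end Run

end Concentration

/-! ### The regret of policy optimization with dilated bonuses -/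

section Hedge

variable {A : Type*} [Fintype A] [Nonempty A]

/-- The regret of exponential weights. -/
theorem hedge_regret {η : ℝ} (hη : 0 < η) (c : ℕ → A → ℝ) (p : ℕ → A → ℝ) (T : ℕ)
    (hp : ∀ t a, p t a = Real.exp (-η * ∑ s ∈ Finset.range t, c s a) /
      ∑ b, Real.exp (-η * ∑ s ∈ Finset.range t, c s b))
    (hc : ∀ t < T, ∀ a, |η * c t a| ≤ 1) {σ : A → ℝ} (hσ0 : ∀ a, 0 ≤ σ a)
    (hσ1 : ∑ a, σ a = 1) :
    ∑ t ∈ Finset.range T, ∑ a, (p t a - σ a) * c t a ≤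
      Real.log (Fintype.card A) / η + η * ∑ t ∈ Finset.range T, ∑ a, p t a * c t a ^ 2 := by
  set W : ℕ → ℝ := fun t => ∑ b, Real.exp (-η * ∑ s ∈ Finset.range t, c s b) with hW
  have hWpos : ∀ t, 0 < W t := fun t =>
    Finset.sum_pos (fun b _ => Real.exp_pos _) Finset.univ_nonempty
  have hpW : ∀ t a, p t a * W t = Real.exp (-η * ∑ s ∈ Finset.range t, c s a) := fun t a => by
    rw [hp, div_mul_cancel₀ _ (hWpos t).ne']
  have hp0 : ∀ t a, 0 ≤ p t a := fun t a => by
    rw [hp]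
    exact div_nonneg (Real.exp_pos _).le (hWpos t).le
  have hp1 : ∀ t, ∑ a, p t a = 1 := fun t => by
    simp only [hp]
    rw [← Finset.sum_div, div_self (hWpos t).ne']
  -- The potential is the logarithm of the normalizer, with `exp (-y) ≤ 1 - y + y²` for `|y| ≤ 1`. A
  -- two-sided condition is required because the bonuses can make `c` negative.
  have hstep : ∀ t ≤ T, Real.log (W t) ≤ Real.log (Fintype.card A) -
      η * ∑ s ∈ Finset.range t, ∑ a, p s a * c s a +
      η ^ 2 * ∑ s ∈ Finset.range t, ∑ a, p s a * c s a ^ 2 := by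
    intro t
    induction t with
    | zero => simp [hW]
    | succ t ih =>
      intro ht
      have ih := ih (by omega)
      have h1 : W (t + 1) ≤ W t * Real.exp (-η * ∑ a, p t a * c t a +
          η ^ 2 * ∑ a, p t a * c t a ^ 2) := by
        calc W (t + 1) = ∑ a, p t a * W t * Real.exp (-η * c t a) := by
              refine Finset.sum_congr rfl fun a _ => ?_
              rw [hpW, ← Real.exp_add, Finset.sum_range_succ, mul_add]
          _ ≤ ∑ a, p t a * W t * (1 - η * c t a + η ^ 2 * c t a ^ 2) := by
              refine Finset.sum_le_sum fun a _ => mul_le_mul_of_nonneg_left ?_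
                (mul_nonneg (hp0 t a) (hWpos t).le)
              have h2 : |-η * c t a| ≤ 1 := by
                rw [neg_mul, abs_neg]
                exact hc t (by omega) a
              have h3 := (abs_le.1 (Real.abs_exp_sub_one_sub_id_le h2)).2
              nlinarith
          _ = W t * (1 + (-η * ∑ a, p t a * c t a + η ^ 2 * ∑ a, p t a * c t a ^ 2)) := by
              have : ∀ a, p t a * W t * (1 - η * c t a + η ^ 2 * c t a ^ 2) =
                  W t * (p t a + (-η * (p t a * c t a) + η ^ 2 * (p t a * c t a ^ 2))) :=
                fun a => by ring
              simp only [this, ← Finset.mul_sum, Finset.sum_add_distrib, hp1]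
          _ ≤ _ := mul_le_mul_of_nonneg_left ((add_comm _ _).trans_le (Real.add_one_le_exp _))
              (hWpos t).le
      have h2 := Real.log_le_log (hWpos (t + 1)) h1
      rw [Real.log_mul (hWpos t).ne' (Real.exp_pos _).ne', Real.log_exp] at h2
      rw [Finset.sum_range_succ, Finset.sum_range_succ]
      linarith
  -- The normalizer dominates each of its summands; averaging the logarithms with weights `σ` admits
  -- a randomized comparator.
  have hlow : -η * ∑ a, σ a * ∑ s ∈ Finset.range T, c s a ≤ Real.log (W T) := by
    calc -η * ∑ a, σ a * ∑ s ∈ Finset.range T, c s a =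
          ∑ a, σ a * (-η * ∑ s ∈ Finset.range T, c s a) := by
          rw [Finset.mul_sum]
          exact Finset.sum_congr rfl fun a _ => by ring
      _ ≤ ∑ a, σ a * Real.log (W T) := by
          refine Finset.sum_le_sum fun a _ => mul_le_mul_of_nonneg_left ?_ (hσ0 a)
          rw [← Real.log_exp (-η * _)]
          refine Real.log_le_log (Real.exp_pos _) ?_
          exact Finset.single_le_sum (f := fun b => Real.exp (-η * ∑ s ∈ Finset.range T, c s b))
            (fun b _ => (Real.exp_pos _).le) (Finset.mem_univ a)
      _ = Real.log (W T) := by rw [← Finset.sum_mul, hσ1, one_mul]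
  have hfin := hlow.trans (hstep T le_rfl)
  have e1 : ∑ t ∈ Finset.range T, ∑ a, (p t a - σ a) * c t a =
      ∑ t ∈ Finset.range T, ∑ a, p t a * c t a - ∑ a, σ a * ∑ s ∈ Finset.range T, c s a := by
    simp only [sub_mul, Finset.sum_sub_distrib, Finset.mul_sum]
    rw [Finset.sum_comm (f := fun t a => σ a * c t a)]
  rw [e1]
  refine le_of_mul_le_mul_left ?_ hη
  rw [mul_add, mul_div_cancel₀ _ hη.ne']
  nlinarith

end Hedge

/-! ### Local and dilated bonuses -/

section Bonus

variable {X A : Type*} [Fintype X] [Fintype A] {L m : ℕ} {𝓛 : Layering X L} {γ : ℝ}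
  {S : Set (X → A → X → ℝ)} {π σ : X → A → ℝ} {P : X → A → X → ℝ}

theorem bddAbove_occ (hS : ∀ P ∈ S, IsTransition 𝓛 P) (hπ : IsPolicy π) (x : X) (a : A) :
    BddAbove ((fun P => occ 𝓛 P π x a) '' S) := by
  refine ⟨1, ?_⟩
  rintro _ ⟨P, hP, rfl⟩
  exact occ_le_one (hS P hP) hπ x a

theorem occ_le_occUp (hS : ∀ P ∈ S, IsTransition 𝓛 P) (hπ : IsPolicy π) (hP : P ∈ S) (x : X)
    (a : A) : occ 𝓛 P π x a ≤ occUp 𝓛 S π x a :=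
  le_csSup (bddAbove_occ hS hπ x a) ⟨P, hP, rfl⟩

theorem occLow_le_occ (hS : ∀ P ∈ S, IsTransition 𝓛 P) (hπ : IsPolicy π) (hP : P ∈ S) (x : X)
    (a : A) : occLow 𝓛 S π x a ≤ occ 𝓛 P π x a := by
  refine csInf_le ⟨0, ?_⟩ ⟨P, hP, rfl⟩
  rintro _ ⟨P, hP, rfl⟩
  exact occ_nonneg (hS P hP) hπ x a

theorem occLow_nonneg (hS : ∀ P ∈ S, IsTransition 𝓛 P) (hπ : IsPolicy π) (x : X) (a : A) :
    0 ≤ occLow 𝓛 S π x a := by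
  refine Real.sInf_nonneg ?_
  rintro _ ⟨P, hP, rfl⟩
  exact occ_nonneg (hS P hP) hπ x a

theorem localBonus_mem (hγ : 0 < γ) (hS : ∀ P ∈ S, IsTransition 𝓛 P) (hπ : IsPolicy π)
    (hP : P ∈ S) (x : X) :
    0 ≤ localBonus 𝓛 γ S π x ∧ localBonus 𝓛 γ S π x ≤ 4 * L := by
  have h1 := occ_le_occUp hS hπ hP x
  have h2 := occLow_le_occ hS hπ hP x
  have h3 := occLow_nonneg hS hπ x
  have hL : (0 : ℝ) ≤ L := Nat.cast_nonneg L
  refine ⟨Finset.sum_nonneg fun a _ => mul_nonneg ((hπ x).1 a) (div_nonneg ?_ ?_),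
    weighted_le (hπ x).1 (hπ x).2 fun a => ?_⟩
  · have : 0 ≤ L * (occUp 𝓛 S π x a - occLow 𝓛 S π x a) :=
      mul_nonneg hL (by linarith [h1 a, h2 a])
    positivity
  · linarith [h1 a, h2 a, h3 a]
  · have h4 : 0 ≤ occUp 𝓛 S π x a := by linarith [h1 a, h2 a, h3 a]
    rw [div_le_iff₀ (by linarith)]
    nlinarith [h3 a, mul_nonneg hL h4, mul_nonneg hL hγ.le, mul_nonneg hL (h3 a)]

/-- The value of the bonus, averaged over the actions. -/
def avgBonus (𝓛 : Layering X L) (γ : ℝ) (S : Set (X → A → X → ℝ)) (π : X → A → ℝ) (n : ℕ)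
    (x : X) : ℝ := ∑ a, π x a * bonusAux 𝓛 γ S π n x a

theorem bonusAux_succ (n : ℕ) (x : X) (a : A) : bonusAux 𝓛 γ S π (n + 1) x a =
    localBonus 𝓛 γ S π x + (1 + 1 / (L : ℝ)) *
      sSup ((fun P : X → A → X → ℝ => ∑ x', P x a x' * avgBonus 𝓛 γ S π n x') '' S) := rfl

/-- Each remaining step adds a local bonus of at most `4 L`, which is dilated at most once per step.
-/
theorem bonusAux_mem (hγ : 0 < γ) (hS : ∀ P ∈ S, IsTransition 𝓛 P) (hπ : IsPolicy π)
    (hP : P ∈ S) (n : ℕ) (x : X) (a : A) :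
    0 ≤ bonusAux 𝓛 γ S π n x a ∧
      bonusAux 𝓛 γ S π n x a ≤ 4 * L * n * (1 + 1 / (L : ℝ)) ^ n := by
  induction n generalizing x a with
  | zero => simp [bonusAux]
  | succ n ih =>
    have hb := localBonus_mem hγ hS hπ hP x
    set d := 1 + 1 / (L : ℝ) with hd
    have hd1 : 1 ≤ d := le_add_of_nonneg_right (by positivity)
    have havg : ∀ y, 0 ≤ avgBonus 𝓛 γ S π n y ∧ avgBonus 𝓛 γ S π n y ≤ 4 * L * n * d ^ n :=
      fun y => ⟨Finset.sum_nonneg fun a _ => mul_nonneg ((hπ y).1 a) (ih y a).1,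
        weighted_le (hπ y).1 (hπ y).2 fun a => (ih y a).2⟩
    have hs0 : 0 ≤ sSup ((fun P : X → A → X → ℝ =>
        ∑ x', P x a x' * avgBonus 𝓛 γ S π n x') '' S) := by
      refine Real.sSup_nonneg ?_
      rintro _ ⟨P, hP, rfl⟩
      exact Finset.sum_nonneg fun y _ => mul_nonneg ((hS P hP).1 _ _ _) (havg y).1
    have hs1 : sSup ((fun P : X → A → X → ℝ => ∑ x', P x a x' * avgBonus 𝓛 γ S π n x') '' S) ≤
        4 * L * n * d ^ n := by
      refine Real.sSup_le ?_ (by positivity)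
      rintro _ ⟨P, hP, rfl⟩
      calc _ ≤ ∑ x', P x a x' * (4 * L * n * d ^ n) :=
            Finset.sum_le_sum fun y _ => mul_le_mul_of_nonneg_left (havg y).2 ((hS P hP).1 _ _ _)
        _ = (∑ x', P x a x') * (4 * L * n * d ^ n) := by rw [Finset.sum_mul]
        _ ≤ 1 * (4 * L * n * d ^ n) :=
            mul_le_mul_of_nonneg_right ((hS P hP).sum_le_one x a) (by positivity)
        _ = _ := one_mul _
    rw [bonusAux_succ, ← hd]
    refine ⟨add_nonneg hb.1 (mul_nonneg (by linarith) hs0), ?_⟩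
    have h1 := mul_le_mul_of_nonneg_left hs1 (show 0 ≤ d by linarith)
    have h2 : (4 : ℝ) * L ≤ 4 * L * d ^ (n + 1) :=
      le_mul_of_one_le_right (by positivity) (one_le_pow₀ hd1)
    push_cast
    have h3 : 4 * L * (n + 1) * d ^ (n + 1) = 4 * L * d ^ (n + 1) + d * (4 * L * n * d ^ n) := by
      ring
    rw [h3]
    linarith [hb.2]

/-- The dilation `1 + 1/L` compounds over a whole episode to at most `e < 3`, so it costs only a
constant. -/
theorem dilation_pow_le {n : ℕ} (hL : 0 < L) (hn : n ≤ L) : (1 + 1 / (L : ℝ)) ^ n ≤ 3 := by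
  have hL' : (0 : ℝ) < L := by exact_mod_cast hL
  have h1 : (1 + 1 / (L : ℝ)) ^ n ≤ (1 + 1 / (L : ℝ)) ^ L :=
    pow_le_pow_right₀ (le_add_of_nonneg_right (by positivity)) hn
  have h2 : (1 + 1 / (L : ℝ)) ^ L ≤ Real.exp (1 / L) ^ L :=
    pow_le_pow_left₀ (by positivity) ((add_comm _ _).trans_le (Real.add_one_le_exp _)) L
  rw [← Real.exp_nat_mul, mul_one_div_cancel hL'.ne'] at h2
  linarith [Real.exp_one_lt_d9]

theorem bonus_le (hL : 0 < L) (hγ : 0 < γ) (hS : ∀ P ∈ S, IsTransition 𝓛 P) (hπ : IsPolicy π)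
    (hP : P ∈ S) (x : X) (a : A) : bonus 𝓛 γ S π x a ≤ 12 * (L : ℝ) ^ 2 := by
  have h1 := (bonusAux_mem hγ hS hπ hP (L - 𝓛.layer x) x a).2
  have h2 := dilation_pow_le hL (Nat.sub_le L (𝓛.layer x))
  have h3 : ((L - 𝓛.layer x : ℕ) : ℝ) ≤ L := by exact_mod_cast Nat.sub_le L (𝓛.layer x)
  calc _ ≤ 4 * L * ((L - 𝓛.layer x : ℕ) : ℝ) * (1 + 1 / (L : ℝ)) ^ (L - 𝓛.layer x) := h1
    _ ≤ 4 * L * L * 3 := by gcongr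
    _ = _ := by ring

theorem bonus_nonneg (hγ : 0 < γ) (hS : ∀ P ∈ S, IsTransition 𝓛 P) (hπ : IsPolicy π)
    (hP : P ∈ S) (x : X) (a : A) : 0 ≤ bonus 𝓛 γ S π x a :=
  (bonusAux_mem hγ hS hπ hP _ x a).1

/-- The bonus dominates its Bellman equation under every transition function of the set. -/
theorem le_bonusAux_succ (hγ : 0 < γ) (hS : ∀ P ∈ S, IsTransition 𝓛 P) (hπ : IsPolicy π)
    (hP : P ∈ S) (n : ℕ) (x : X) (a : A) :
    localBonus 𝓛 γ S π x + (1 + 1 / (L : ℝ)) * ∑ x', P x a x' * avgBonus 𝓛 γ S π n x' ≤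
      bonusAux 𝓛 γ S π (n + 1) x a := by
  rw [bonusAux_succ]
  have : BddAbove ((fun P : X → A → X → ℝ => ∑ x', P x a x' * avgBonus 𝓛 γ S π n x') '' S) := by
    refine ⟨∑ x', avgBonus 𝓛 γ S π n x', ?_⟩
    rintro _ ⟨P', hP', rfl⟩
    refine Finset.sum_le_sum fun y _ => mul_le_of_le_one_left ?_ ((hS P' hP').le_one _ _ _)
    exact Finset.sum_nonneg fun a _ => mul_nonneg ((hπ y).1 a) (bonusAux_mem hγ hS hπ hP n y a).1
  have h1 := le_csSup this ⟨P, hP, rfl⟩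
  exact add_le_add_right (mul_le_mul_of_nonneg_left h1 (by positivity)) _

/-- The dilated bonus lemma: the bonus compensates the local bonuses of a comparator. -/
theorem dilated_bonus (hγ : 0 < γ) (hS : ∀ P ∈ S, IsTransition 𝓛 P) (hπ : IsPolicy π)
    (hσ : IsPolicy σ) (hP : P ∈ S) :
    ∑ x ∈ 𝓛.inner, stateProb 𝓛 P σ (𝓛.layer x) x *
        ∑ a, (π x a - σ x a) * bonus 𝓛 γ S π x a ≤
      (1 + 1 / (L : ℝ)) * avgBonus 𝓛 γ S π L 𝓛.start -
      ∑ x ∈ 𝓛.inner, stateProb 𝓛 P σ (𝓛.layer x) x * (localBonus 𝓛 γ S π x +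
        1 / (L : ℝ) * ∑ a, π x a * bonus 𝓛 γ S π x a) := by
  have hT := hS P hP
  have htel := sum_stateProb_telescope 𝓛 P σ (fun k => avgBonus 𝓛 γ S π (L - k))
    (by simp [avgBonus, bonusAux])
  rw [sum_range_sum_stateProb hT (fun k x => avgBonus 𝓛 γ S π (L - k) x -
    ∑ a, σ x a * ∑ x', P x a x' * avgBonus 𝓛 γ S π (L - (k + 1)) x')] at htel
  simp only [Nat.sub_zero] at htel
  rw [htel, Finset.mul_sum, ← Finset.sum_sub_distrib]
  refine Finset.sum_le_sum fun x hx => ?_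
  have hxL := Layering.mem_inner.1 hx
  have hn : L - 𝓛.layer x = L - (𝓛.layer x + 1) + 1 := by omega
  have hsp := stateProb_nonneg (𝓛 := 𝓛) hT.1 hσ (𝓛.layer x) x
  have h1 : ∑ a, σ x a * bonus 𝓛 γ S π x a ≥ localBonus 𝓛 γ S π x + (1 + 1 / (L : ℝ)) *
      ∑ a, σ x a * ∑ x', P x a x' * avgBonus 𝓛 γ S π (L - (𝓛.layer x + 1)) x' := by
    calc _ ≥ ∑ a, σ x a * (localBonus 𝓛 γ S π x + (1 + 1 / (L : ℝ)) *
          ∑ x', P x a x' * avgBonus 𝓛 γ S π (L - (𝓛.layer x + 1)) x') := by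
          refine Finset.sum_le_sum fun a _ => mul_le_mul_of_nonneg_left ?_ ((hσ x).1 a)
          rw [bonus, hn]
          exact le_bonusAux_succ hγ hS hπ hP _ x a
      _ = _ := by
          simp only [mul_add, Finset.sum_add_distrib, ← Finset.sum_mul, (hσ x).2, one_mul,
            Finset.mul_sum, mul_left_comm _ (1 + 1 / (L : ℝ))]
  have h2 : avgBonus 𝓛 γ S π (L - 𝓛.layer x) x = ∑ a, π x a * bonus 𝓛 γ S π x a := rfl
  rw [h2]
  have h3 : ∑ a, (π x a - σ x a) * bonus 𝓛 γ S π x a =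
      ∑ a, π x a * bonus 𝓛 γ S π x a - ∑ a, σ x a * bonus 𝓛 γ S π x a := by
    rw [← Finset.sum_sub_distrib]
    exact Finset.sum_congr rfl fun a _ => by ring
  rw [h3]
  -- With `b` the local bonus, `F - (b + (1 + 1/L) G) = (1 + 1/L)(F - G) - b - F/L`, and `F - G` is
  -- the telescoping increment. The dilation is what leaves the term `-F/L`, later spent on the
  -- squared bonuses.
  set F := ∑ a, π x a * bonus 𝓛 γ S π x a
  set G := ∑ a, σ x a * ∑ x', P x a x' * avgBonus 𝓛 γ S π (L - (𝓛.layer x + 1)) x'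
  have h4 := mul_le_mul_of_nonneg_left h1 hsp
  linarith

/-- Optimistic rows can be combined into one transition function of the confidence set. -/
theorem avgBonus_start_le (hL : 0 < L) (hγ : 0 < γ) (hS : ∀ P ∈ S, IsTransition 𝓛 P)
    (hc : IsCompact S) (hrow : ∀ R : X → A → X → A → X → ℝ, (∀ x a, R x a ∈ S) →
      (fun x a => R x a x a) ∈ S) (hπ : IsPolicy π) (hP : P ∈ S) :
    avgBonus 𝓛 γ S π L 𝓛.start ≤ 3 * ∑ x ∈ 𝓛.inner, ∑ a,
      (3 * γ * L + L * (occUp 𝓛 S π x a - occLow 𝓛 S π x a)) := by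
  have hex : ∀ x a, ∃ R ∈ S, sSup ((fun P : X → A → X → ℝ => ∑ x', P x a x' *
      avgBonus 𝓛 γ S π (L - (𝓛.layer x + 1)) x') '' S) =
      ∑ x', R x a x' * avgBonus 𝓛 γ S π (L - (𝓛.layer x + 1)) x' := fun x a =>
    hc.exists_sSup_image_eq ⟨P, hP⟩ (Continuous.continuousOn (by fun_prop))
  choose R hRS hR using hex
  set P' : X → A → X → ℝ := fun x a => R x a x a with hP'
  have hP'S : P' ∈ S := hrow R hRS
  have hP'T := hS P' hP'S
  set d := 1 + 1 / (L : ℝ) with hd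
  have hd1 : 1 ≤ d := le_add_of_nonneg_right (by positivity)
  have hb0 := fun x => (localBonus_mem hγ hS hπ hP x).1
  -- Along the optimistic rows the bonus is a value under `P'` with the local bonus as payoff.
  -- Pulling the dilation factors to the front costs at most `d ^ n`.
  have key : ∀ n x, 𝓛.layer x + n = L →
      avgBonus 𝓛 γ S π n x ≤ d ^ n * vgo P' π (fun x _ => localBonus 𝓛 γ S π x) n x := by
    intro n
    induction n with
    | zero => intro x _; simp [avgBonus, bonusAux, vgo]
    | succ n ih =>
      intro x hx
      have hn : L - (𝓛.layer x + 1) = n := by omega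
      rw [avgBonus, vgo, Finset.mul_sum]
      refine Finset.sum_le_sum fun a _ => ?_
      rw [mul_left_comm]
      refine mul_le_mul_of_nonneg_left ?_ ((hπ x).1 a)
      have h1 := hR x a
      rw [hn] at h1
      rw [bonusAux_succ, h1, mul_add, ← hd]
      refine add_le_add (le_mul_of_one_le_left (hb0 x) (one_le_pow₀ hd1)) ?_
      rw [pow_succ, mul_comm (d ^ n), mul_assoc]
      refine mul_le_mul_of_nonneg_left ?_ (by linarith)
      rw [Finset.mul_sum]
      refine Finset.sum_le_sum fun y _ => ?_
      rw [mul_left_comm]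
      by_cases hy : 𝓛.layer y = 𝓛.layer x + 1
      · exact mul_le_mul_of_nonneg_left (ih y (by omega)) (hP'T.1 x a y)
      · have h0 : P' x a y = 0 := hP'T.eq_zero hy
        have h0' : R x a x a y = 0 := h0
        rw [h0, h0', zero_mul, zero_mul]
  have h1 := key L 𝓛.start (by rw [(𝓛.layer_eq_zero _).2 rfl, zero_add])
  have hv := value_nonneg (𝓛 := 𝓛) hP'T.1 hπ (v := fun x _ => localBonus 𝓛 γ S π x)
    fun x _ => hb0 x
  rw [← value_eq_vgo] at h1
  refine h1.trans (mul_le_mul (dilation_pow_le hL le_rfl) ?_ hv (by norm_num))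
  rw [value_eq_sum_occ hP'T]
  refine Finset.sum_le_sum fun x _ => ?_
  rw [← Finset.sum_mul]
  have h2 : ∑ a, occ 𝓛 P' π x a = stateProb 𝓛 P' π (𝓛.layer x) x := by
    simp only [occ, ← Finset.mul_sum, (hπ x).2, mul_one]
  rw [h2, localBonus, Finset.mul_sum]
  refine Finset.sum_le_sum fun a _ => ?_
  have h3 := occ_le_occUp hS hπ hP'S x a
  have h4 := occLow_le_occ hS hπ hP'S x a
  have h5 := occ_nonneg hP'T hπ x a
  rw [← mul_assoc]
  change occ 𝓛 P' π x a * _ ≤ _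
  have h6 : 0 ≤ 3 * γ * L + L * (occUp 𝓛 S π x a - occLow 𝓛 S π x a) := by
    have : 0 ≤ L * (occUp 𝓛 S π x a - occLow 𝓛 S π x a) :=
      mul_nonneg (Nat.cast_nonneg L) (by linarith)
    positivity
  -- The policy visits the pair under `P'` with probability at most `occUp`, which cancels the
  -- denominator of the local bonus.
  rw [mul_div_assoc', div_le_iff₀ (by linarith), mul_comm]
  exact mul_le_mul_of_nonneg_left (by linarith) h6

end Bonus

/-! ### Regret in a state and regret of an episode -/

section Regret

variable {X A : Type*} [Fintype X] [Fintype A] {L m : ℕ} {M : Model X A L m} {T : ℕ} {δ : ℝ}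
  {h : ℕ → Episode X A L m}

/-- The transition axioms and the confidence intervals constrain each pair separately, so rows of
different members may be combined. -/
theorem confSet_rows (𝓛 : Layering X L) (T : ℕ) (δ : ℝ) (h : ℕ → Episode X A L m) (t : ℕ)
    (R : X → A → X → A → X → ℝ) (hR : ∀ x a, R x a ∈ confSet 𝓛 T δ h t) :
    (fun x a => R x a x a) ∈ confSet 𝓛 T δ h t :=
  ⟨⟨fun x a x' => (hR x a).1.1 x a x', fun x a x' => (hR x a).1.2.1 x a x',
    fun x a => (hR x a).1.2.2 x a⟩, fun x a x' => (hR x a).2 x a x'⟩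

theorem TransGood.mem_confSet (hg : TransGood M T δ h) {t : ℕ} (ht : t < T) :
    M.P ∈ confSet M.lay T δ h t :=
  ⟨M.isTransition, hg _ ((epochStart_le h t).trans_lt ht)⟩

/-- The bonus of the current policy. -/
def runBonus (M : Model X A L m) (T : ℕ) (δ : ℝ) (h : ℕ → Episode X A L m) (t : ℕ) (x : X)
    (a : A) : ℝ :=
  bonus M.lay (gam X A L T) (confSet M.lay T δ h t) (policy M T δ h t) x a

/-- The local bonus of the current policy. -/
def runLocalBonus (M : Model X A L m) (T : ℕ) (δ : ℝ) (h : ℕ → Episode X A L m) (t : ℕ) (x : X) :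
    ℝ := localBonus M.lay (gam X A L T) (confSet M.lay T δ h t) (policy M T δ h t) x

theorem cumLoss_eq_sum (t : ℕ) (x : X) (a : A) : cumLoss M T δ h t x a =
    ∑ s ∈ Finset.range t, (runQHat M T δ h s x a - runBonus M T δ h s x a) := by
  induction t with
  | zero => rfl
  | succ t ih =>
    rw [Finset.sum_range_succ, ← ih]
    rfl

theorem Regular.runQHat_mem [Nonempty A] (hr : Regular M T h) (hL : 0 < L) (hρ : 0 < rho M)
    (hT : 0 < T) {t : ℕ} (ht : t < T) {x : X} (hx : M.lay.layer x < L) (a : A) :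
    0 ≤ runQHat M T δ h t x a ∧ runQHat M T δ h t x a ≤ L / gam X A L T := by
  have : Nonempty X := ⟨M.lay.start⟩
  rw [runQHat, qEst_eq]
  refine (hr t ht).1.quotient_mem (d := fun a =>
    occUp M.lay (confSet M.lay T δ h t) (policy M T δ h t) x a + gam X A L T) M.isTransition hx
    (fun x a => (hr.scaledLoss_mem hL hρ ht.le _ x a).1)
    (fun x a => (hr.scaledLoss_mem hL hρ ht.le _ x a).2) (gam_pos hL hT) (fun a => ?_) a
  exact le_add_of_nonneg_left (occUp_nonneg (isPolicy_expWeights _ _) x a)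

theorem log_card_le_logTerm [Nonempty X] [Nonempty A] (hδ : 0 < δ) (hδ1 : δ < 1) (hT : 0 < T) :
    Real.log (Fintype.card A) ≤ logTerm X A T δ := by
  have hX : (1 : ℝ) ≤ Fintype.card X := by exact_mod_cast Fintype.card_pos
  have hA : (0 : ℝ) < Fintype.card A := by exact_mod_cast Fintype.card_pos
  have hT' : (1 : ℝ) ≤ T := by exact_mod_cast hT
  refine Real.log_le_log hA ?_
  rw [le_div_iff₀ hδ, mul_comm]
  exact mul_le_mul_of_nonneg_right (hδ1.le.trans (one_le_mul_of_one_le_of_one_le hT' hX)) hA.le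

/-- The regret in a single state, up to the local and the dilated bonuses. -/
theorem state_regret [Nonempty A] (hr : Regular M T h) (hg : TransGood M T δ h) (hL : 0 < L)
    (hρ : 0 < rho M) (hδ : 0 < δ) (hδ1 : δ < 1) (hT : 0 < T) (hlog : 1 ≤ logTerm X A T δ)
    {σ : X → A → ℝ} (hσ : IsPolicy σ) {x : X} (hx : M.lay.layer x < L)
    (hQ : QHatGood M T δ σ h x) :
    ∑ t ∈ Finset.range T, ∑ a, (policy M T δ h t x a - σ x a) *
        (runQ M T δ h t x a - runBonus M T δ h t x a) ≤
      3 * logTerm X A T δ / eta X A L T + ∑ t ∈ Finset.range T, (runLocalBonus M T δ h t x +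
        1 / (L : ℝ) * ∑ a, policy M T δ h t x a * runBonus M T δ h t x a) := by
  have : Nonempty X := ⟨M.lay.start⟩
  have hη : 0 < eta X A L T := eta_pos hL hT
  have hγ : 0 < gam X A L T := gam_pos hL hT
  have hL' : (0 : ℝ) < L := by exact_mod_cast hL
  have hL1 : (1 : ℝ) ≤ L := by exact_mod_cast hL
  have hγη : gam X A L T = 2 * eta X A L T * L := rfl
  have hη24 : eta X A L T ≤ 1 / (24 * (L : ℝ) ^ 3) := min_le_left _ _
  have hπ : ∀ t, IsPolicy (policy M T δ h t) := fun t => isPolicy_expWeights _ _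
  have hS : ∀ t, ∀ P ∈ confSet M.lay T δ h t, IsTransition M.lay P := fun t P hP => hP.1
  have hB0 : ∀ t < T, ∀ a, 0 ≤ runBonus M T δ h t x a := fun t ht a =>
    bonus_nonneg hγ (hS t) (hπ t) (hg.mem_confSet ht) x a
  have hB1 : ∀ t < T, ∀ a, runBonus M T δ h t x a ≤ 12 * (L : ℝ) ^ 2 := fun t ht a =>
    bonus_le hL hγ (hS t) (hπ t) (hg.mem_confSet ht) x a
  -- The cap `1 / (24 L³)` on the learning rate is chosen for this estimate, the bonuses being at
  -- most `12 L²`.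
  have hηB : ∀ t < T, ∀ a, eta X A L T * runBonus M T δ h t x a ≤ 1 / (2 * L) := by
    intro t ht a
    calc _ ≤ 1 / (24 * (L : ℝ) ^ 3) * (12 * (L : ℝ) ^ 2) :=
          mul_le_mul hη24 (hB1 t ht a) (hB0 t ht a) (by positivity)
      _ = 1 / (2 * L) := by field_simp; norm_num
  have hηQ : ∀ t < T, ∀ a, eta X A L T * runQHat M T δ h t x a ≤ 1 / 2 := by
    intro t ht a
    calc _ ≤ eta X A L T * (L / gam X A L T) :=
          mul_le_mul_of_nonneg_left (hr.runQHat_mem hL hρ hT ht hx a).2 hη.le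
      _ = 1 / 2 := by rw [hγη]; field_simp
  have hQ0 : ∀ t < T, ∀ a, 0 ≤ runQHat M T δ h t x a := fun t ht a =>
    (hr.runQHat_mem hL hρ hT ht hx a).1
  have hsmall : (1 : ℝ) / (2 * L) ≤ 1 / 2 := by
    rw [div_le_div_iff₀ (by positivity) (by norm_num)]
    linarith
  have hhedge := hedge_regret hη (fun t a => runQHat M T δ h t x a - runBonus M T δ h t x a)
    (fun t a => policy M T δ h t x a) T
    (fun t a => by simp only [policy, expWeights, cumLoss_eq_sum])
    (fun t ht a => by
      have h1 := hηB t ht a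
      have h2 := hηQ t ht a
      have h3 := mul_nonneg hη.le (hB0 t ht a)
      have h4 := mul_nonneg hη.le (hQ0 t ht a)
      rw [mul_sub, abs_le]
      constructor <;> linarith) (hσ x).1 (hσ x).2
  -- The policy's own part. The bias is at most `L (up - lo + γ) / (up + γ)`. The variance, with
  -- coefficient `γ/L + 2η = 2γ/L`, is at most `2γL / (up + γ)`. Together they give exactly the
  -- summand of the local bonus.
  have hpoint : ∀ t ∈ Finset.range T, ∀ a, policy M T δ h t x a *
      (runQ M T δ h t x a - runOcc M T δ h t x a * runQ M T δ h t x a /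
        (runUp M T δ h t x a + gam X A L T)) +
      (gam X A L T / L + 2 * eta X A L T) * (policy M T δ h t x a *
        (L * L * runOcc M T δ h t x a / (runUp M T δ h t x a + gam X A L T) ^ 2)) ≤
      policy M T δ h t x a * ((3 * gam X A L T * L + L * (runUp M T δ h t x a -
        runLow M T δ h t x a)) / (runUp M T δ h t x a + gam X A L T)) := by
    intro t ht a
    have ht := Finset.mem_range.1 ht
    have q1 : runOcc M T δ h t x a ≤ runUp M T δ h t x a :=
      occ_le_occUp (hS t) (hπ t) (hg.mem_confSet ht) x a
    have q2 : runLow M T δ h t x a ≤ runOcc M T δ h t x a :=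
      occLow_le_occ (hS t) (hπ t) (hg.mem_confSet ht) x a
    have q3 : 0 ≤ runOcc M T δ h t x a := occ_nonneg M.isTransition (hπ t) x a
    have v0 : 0 ≤ runQ M T δ h t x a := qgo_nonneg M.isTransition.1 (hπ t)
      (fun x a => (hr.scaledLoss_mem hL hρ ht.le _ x a).1) _ x a
    have v1 : runQ M T δ h t x a ≤ L := by
      refine (qgo_le M.isTransition (hπ t) (fun x a => (hr.scaledLoss_mem hL hρ ht.le _ x a).1)
        (fun x a => (hr.scaledLoss_mem hL hρ ht.le _ x a).2) _ x a).trans ?_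
      have : L - (M.lay.layer x + 1) + 1 ≤ L := by omega
      exact_mod_cast this
    set Q := runQ M T δ h t x a
    set q := runOcc M T δ h t x a
    set up := runUp M T δ h t x a
    set lo := runLow M T δ h t x a
    set γ := gam X A L T
    have hd : 0 < up + γ := by linarith
    have e1 : γ / L + 2 * eta X A L T = 2 * (γ / L) := by rw [hγη]; field_simp; ring
    rw [e1, mul_left_comm, ← mul_add]
    refine mul_le_mul_of_nonneg_left ?_ ((hπ t x).1 a)
    have e2 : Q - q * Q / (up + γ) ≤ L * (up - lo + γ) / (up + γ) := by
      rw [sub_le_iff_le_add, ← add_div, le_div_iff₀ hd]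
      nlinarith
    have e3 : 2 * (γ / L) * (L * L * q / (up + γ) ^ 2) ≤ 2 * γ * L / (up + γ) := by
      have : 2 * (γ / L) * (L * L * q / (up + γ) ^ 2) = 2 * γ * L * q / (up + γ) ^ 2 := by
        field_simp
      rw [this, div_le_div_iff₀ (by positivity) hd]
      have : 0 ≤ 2 * γ * L * (up + γ) := by positivity
      nlinarith
    have e4 : L * (up - lo + γ) / (up + γ) + 2 * γ * L / (up + γ) =
        (3 * γ * L + L * (up - lo)) / (up + γ) := by rw [← add_div]; ring_nf
    linarith
  -- Implicit exploration: `q (up + 2γ) ≤ (up + γ)²` because `q ≤ up`, so the comparator's mean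
  -- estimate together with its variance term never exceeds the true action value.
  have hpoint2 : ∀ t ∈ Finset.range T, ∀ a, σ x a * (runOcc M T δ h t x a *
      runQ M T δ h t x a / (runUp M T δ h t x a + gam X A L T)) + gam X A L T / L * (σ x a *
        (L * (runOcc M T δ h t x a * runQ M T δ h t x a) /
          (runUp M T δ h t x a + gam X A L T) ^ 2)) ≤ σ x a * runQ M T δ h t x a := by
    intro t ht a
    have ht := Finset.mem_range.1 ht
    have q1 : runOcc M T δ h t x a ≤ runUp M T δ h t x a :=
      occ_le_occUp (hS t) (hπ t) (hg.mem_confSet ht) x a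
    have q3 : 0 ≤ runOcc M T δ h t x a := occ_nonneg M.isTransition (hπ t) x a
    have v0 : 0 ≤ runQ M T δ h t x a := qgo_nonneg M.isTransition.1 (hπ t)
      (fun x a => (hr.scaledLoss_mem hL hρ ht.le _ x a).1) _ x a
    set Q := runQ M T δ h t x a
    set q := runOcc M T δ h t x a
    set up := runUp M T δ h t x a
    set γ := gam X A L T
    have hd : 0 < up + γ := by linarith
    rw [mul_left_comm, ← mul_add]
    refine mul_le_mul_of_nonneg_left ?_ ((hσ x).1 a)
    have e1 : q * Q / (up + γ) + γ / L * (L * (q * Q) / (up + γ) ^ 2) =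
        Q * (q * (up + γ + γ)) / (up + γ) ^ 2 := by
      field_simp
    rw [e1, div_le_iff₀ (by positivity)]
    refine mul_le_mul_of_nonneg_left ?_ v0
    nlinarith
  -- The cross term is dropped since both quantities are nonnegative. Then `η B ≤ 1/L` reduces the
  -- square of the bonus to a `1/L` fraction of the bonus, which the dilation pays for.
  have hsq : ∀ t ∈ Finset.range T, ∀ a, eta X A L T * (policy M T δ h t x a *
      (runQHat M T δ h t x a - runBonus M T δ h t x a) ^ 2) ≤
      eta X A L T * (policy M T δ h t x a * runQHat M T δ h t x a ^ 2) +
      1 / (L : ℝ) * (policy M T δ h t x a * runBonus M T δ h t x a) := by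
    intro t ht a
    have ht := Finset.mem_range.1 ht
    have h0 := (hπ t x).1 a
    have h1 := hηB t ht a
    have h2 := hB0 t ht a
    have h3 := hQ0 t ht a
    set Q := runQHat M T δ h t x a
    set B := runBonus M T δ h t x a
    set p := policy M T δ h t x a
    have h4 : eta X A L T * B ^ 2 ≤ 1 / (L : ℝ) * B := by
      calc eta X A L T * B ^ 2 = eta X A L T * B * B := by ring
        _ ≤ 1 / (L : ℝ) * B := mul_le_mul_of_nonneg_right (h1.trans (by
            rw [div_le_div_iff₀ (by positivity) hL']; linarith)) h2
    have h5 : (Q - B) ^ 2 ≤ Q ^ 2 + B ^ 2 := by nlinarith [mul_nonneg h3 h2]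
    have h6 := mul_le_mul_of_nonneg_left h5 (mul_nonneg hη.le h0)
    have h7 := mul_le_mul_of_nonneg_left h4 h0
    nlinarith
  set D : (ℕ → A → ℝ) → ℝ := fun f => ∑ t ∈ Finset.range T, ∑ a, f t a with hD
  have Dadd : ∀ f g, D (fun t a => f t a + g t a) = D f + D g := fun f g => by
    simp only [hD, Finset.sum_add_distrib]
  have Dsub : ∀ f g, D (fun t a => f t a - g t a) = D f - D g := fun f g => by
    simp only [hD, Finset.sum_sub_distrib]
  have Dmul : ∀ c f, D (fun t a => c * f t a) = c * D f := fun c f => by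
    simp only [hD, Finset.mul_sum]
  have Dle : ∀ f g, (∀ t ∈ Finset.range T, ∀ a, f t a ≤ g t a) → D f ≤ D g := fun f g hfg =>
    Finset.sum_le_sum fun t ht => Finset.sum_le_sum fun a _ => hfg t ht a
  have s1 := Dle _ _ hpoint
  have s2 := Dle _ _ hpoint2
  have s3 := Dle _ _ hsq
  rw [Dadd, Dmul] at s1 s2
  rw [Dmul, Dadd, Dmul, Dmul] at s3
  simp only [mul_sub (policy M T δ h _ x _)] at s1
  rw [Dsub] at s1
  obtain ⟨o1, o2, o3⟩ := hQ
  have o3' := mul_le_mul_of_nonneg_left o3 hη.le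
  rw [mul_add] at o3'
  have hlogs : Real.log (Fintype.card A) / eta X A L T + (logTerm X A T δ / (gam X A L T / L) +
      logTerm X A T δ / (gam X A L T / L) + eta X A L T * (logTerm X A T δ /
        (gam X A L T / L) ^ 2)) ≤ 3 * logTerm X A T δ / eta X A L T := by
    have h1 := log_card_le_logTerm (X := X) (A := A) hδ hδ1 hT
    have h2 : gam X A L T / L = 2 * eta X A L T := by rw [hγη]; field_simp
    rw [h2]
    have h3 : Real.log (Fintype.card A) / eta X A L T + (logTerm X A T δ / (2 * eta X A L T) +
      logTerm X A T δ / (2 * eta X A L T) + eta X A L T * (logTerm X A T δ /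
        (2 * eta X A L T) ^ 2)) =
      (Real.log (Fintype.card A) + 5 / 4 * logTerm X A T δ) / eta X A L T := by
      field_simp
      ring
    rw [h3]
    exact div_le_div_of_nonneg_right (by linarith) hη.le
  have hloc : ∑ t ∈ Finset.range T, runLocalBonus M T δ h t x = D fun t a =>
      policy M T δ h t x a * ((3 * gam X A L T * L + L * (runUp M T δ h t x a -
        runLow M T δ h t x a)) / (runUp M T δ h t x a + gam X A L T)) := rfl
  have hlhs : ∑ t ∈ Finset.range T, ∑ a, (policy M T δ h t x a - σ x a) *
        (runQ M T δ h t x a - runBonus M T δ h t x a) =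
      (D fun t a => policy M T δ h t x a * runQ M T δ h t x a) -
      (D fun t a => σ x a * runQ M T δ h t x a) -
      (D fun t a => policy M T δ h t x a * runQHat M T δ h t x a) +
      (D fun t a => σ x a * runQHat M T δ h t x a) +
      D fun t a => (policy M T δ h t x a - σ x a) *
        (runQHat M T δ h t x a - runBonus M T δ h t x a) := by
    rw [← Dsub, ← Dsub, ← Dadd, ← Dadd]
    exact Finset.sum_congr rfl fun t _ => Finset.sum_congr rfl fun a _ => by ring
  have hrhs : ∑ t ∈ Finset.range T, (runLocalBonus M T δ h t x +
        1 / (L : ℝ) * ∑ a, policy M T δ h t x a * runBonus M T δ h t x a) =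
      ∑ t ∈ Finset.range T, runLocalBonus M T δ h t x +
      1 / (L : ℝ) * D fun t a => policy M T δ h t x a * runBonus M T δ h t x a := by
    rw [Finset.sum_add_distrib, Finset.mul_sum]
  change (D fun t a => (policy M T δ h t x a - σ x a) *
      (runQHat M T δ h t x a - runBonus M T δ h t x a)) ≤ _ + eta X A L T * (D fun t a =>
      policy M T δ h t x a * (runQHat M T δ h t x a - runBonus M T δ h t x a) ^ 2) at hhedge
  change (D fun t a => policy M T δ h t x a * (runOcc M T δ h t x a * runQ M T δ h t x a /
      (runUp M T δ h t x a + gam X A L T))) ≤ (D fun t a => policy M T δ h t x a *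
      runQHat M T δ h t x a) + gam X A L T / L * (D fun t a => policy M T δ h t x a *
        (L * L * runOcc M T δ h t x a / (runUp M T δ h t x a + gam X A L T) ^ 2)) + _ at o1
  change (D fun t a => σ x a * runQHat M T δ h t x a) ≤ (D fun t a => σ x a *
      (runOcc M T δ h t x a * runQ M T δ h t x a / (runUp M T δ h t x a + gam X A L T))) +
      gam X A L T / L * (D fun t a => σ x a * (L * (runOcc M T δ h t x a * runQ M T δ h t x a) /
          (runUp M T δ h t x a + gam X A L T) ^ 2)) + _ at o2
  change eta X A L T * (D fun t a => policy M T δ h t x a * runQHat M T δ h t x a ^ 2) ≤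
    eta X A L T * (2 * (D fun t a => policy M T δ h t x a *
        (L * L * runOcc M T δ h t x a / (runUp M T δ h t x a + gam X A L T) ^ 2))) + _ at o3'
  rw [hlhs, hrhs, hloc]
  rw [add_mul] at s1
  linarith

/-- The regret bound of `PO-DB` on the good event. -/
theorem podb_regret [Nonempty A] (hr : Regular M T h) (hg : TransGood M T δ h) (hL : 0 < L)
    (hρ : 0 < rho M) (hδ : 0 < δ) (hδ1 : δ < 1) (hT : 0 < T) (hlog : 1 ≤ logTerm X A T δ)
    {σ : X → A → ℝ} (hσ : IsPolicy σ)
    (hQ : ∀ x, M.lay.layer x < L → QHatGood M T δ σ h x) :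
    ∑ t ∈ Finset.range T, (value M.lay M.P (policy M T δ h t) (fedLoss M T δ h t) -
        value M.lay M.P σ (fedLoss M T δ h t)) ≤
      L * (3 * logTerm X A T δ / eta X A L T) + 6 * ∑ t ∈ Finset.range T,
        ∑ x ∈ M.lay.inner, ∑ a, (3 * gam X A L T * L +
          L * (runUp M T δ h t x a - runLow M T δ h t x a)) := by
  have : Nonempty X := ⟨M.lay.start⟩
  have hγ : 0 < gam X A L T := gam_pos hL hT
  have hL1 : (1 : ℝ) ≤ L := by exact_mod_cast hL
  have hπ : ∀ t, IsPolicy (policy M T δ h t) := fun t => isPolicy_expWeights _ _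
  have hS : ∀ t, ∀ P ∈ confSet M.lay T δ h t, IsTransition M.lay P := fun t P hP => hP.1
  set sp : X → ℝ := fun x => stateProb M.lay M.P σ (M.lay.layer x) x with hsp
  have hsp0 : ∀ x, 0 ≤ sp x := fun x => stateProb_nonneg M.isTransition.1 hσ _ x
  -- The comparator passes through one state of each layer before the last, so the per-state
  -- logarithmic cost is paid `L` times and not `|X|` times.
  have hspsum : ∑ x ∈ M.lay.inner, sp x = L := by
    have h1 := sum_range_sum_stateProb (π := σ) M.isTransition (fun _ _ => (1 : ℝ))
    simp only [mul_one] at h1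
    rw [hsp, ← h1, Finset.sum_congr rfl fun k hk =>
      sum_stateProb M.isTransition hσ (Finset.mem_range.1 hk).le]
    simp
  have hdiff : ∀ t, value M.lay M.P (policy M T δ h t) (fedLoss M T δ h t) -
        value M.lay M.P σ (fedLoss M T δ h t) =
      ∑ x ∈ M.lay.inner, sp x * ∑ a, (policy M T δ h t x a - σ x a) * runQ M T δ h t x a := by
    intro t
    rw [value_eq_vgo M.lay M.P (policy M T δ h t), vgo_sub_value]
    exact sum_range_sum_stateProb M.isTransition (fun k x => ∑ a,
      (policy M T δ h t x a - σ x a) * qgo M.P (policy M T δ h t) (fedLoss M T δ h t)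
        (L - (k + 1)) x a)
  have hstate : ∑ x ∈ M.lay.inner, sp x * ∑ t ∈ Finset.range T, ∑ a,
        (policy M T δ h t x a - σ x a) * (runQ M T δ h t x a - runBonus M T δ h t x a) ≤
      ∑ x ∈ M.lay.inner, sp x * (3 * logTerm X A T δ / eta X A L T +
        ∑ t ∈ Finset.range T, (runLocalBonus M T δ h t x +
        1 / (L : ℝ) * ∑ a, policy M T δ h t x a * runBonus M T δ h t x a)) :=
    Finset.sum_le_sum fun x hx => mul_le_mul_of_nonneg_left
      (state_regret hr hg hL hρ hδ hδ1 hT hlog hσ (Layering.mem_inner.1 hx)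
        (hQ x (Layering.mem_inner.1 hx))) (hsp0 x)
  -- The constant six is three from the compounded dilation times `1 + 1/L ≤ 2`. The subtracted sum
  -- is precisely what the per-state regret bounds leave over.
  have hbonus : ∀ t ∈ Finset.range T, ∑ x ∈ M.lay.inner, sp x *
        ∑ a, (policy M T δ h t x a - σ x a) * runBonus M T δ h t x a ≤
      6 * (∑ x ∈ M.lay.inner, ∑ a, (3 * gam X A L T * L +
          L * (runUp M T δ h t x a - runLow M T δ h t x a))) -
      ∑ x ∈ M.lay.inner, sp x * (runLocalBonus M T δ h t x +
        1 / (L : ℝ) * ∑ a, policy M T δ h t x a * runBonus M T δ h t x a) := by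
    intro t ht
    have hP := hg.mem_confSet (Finset.mem_range.1 ht)
    refine (dilated_bonus hγ (hS t) (hπ t) hσ hP).trans (sub_le_sub_right ?_ _)
    have h1 := avgBonus_start_le hL hγ (hS t) (isCompact_confSet M.lay T δ h t)
      (confSet_rows M.lay T δ h t) (hπ t) hP
    have h0 : 0 ≤ avgBonus M.lay (gam X A L T) (confSet M.lay T δ h t) (policy M T δ h t) L
        M.lay.start := Finset.sum_nonneg fun a _ =>
      mul_nonneg ((hπ t _).1 a) (bonusAux_mem hγ (hS t) (hπ t) hP L _ a).1
    have h2 : 1 + 1 / (L : ℝ) ≤ 2 := by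
      have : 1 / (L : ℝ) ≤ 1 := div_le_one_of_le₀ hL1 (by positivity)
      linarith
    refine (mul_le_mul h2 h1 h0 (by norm_num)).trans_eq ?_
    rw [← mul_assoc]
    norm_num
    rfl
  have hb := Finset.sum_le_sum hbonus
  rw [Finset.sum_sub_distrib, ← Finset.mul_sum] at hb
  have e1 : ∑ x ∈ M.lay.inner, sp x * ∑ t ∈ Finset.range T, ∑ a,
        (policy M T δ h t x a - σ x a) * (runQ M T δ h t x a - runBonus M T δ h t x a) =
      ∑ t ∈ Finset.range T, ∑ x ∈ M.lay.inner, sp x * (∑ a,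
        (policy M T δ h t x a - σ x a) * runQ M T δ h t x a) -
      ∑ t ∈ Finset.range T, ∑ x ∈ M.lay.inner, sp x * (∑ a,
        (policy M T δ h t x a - σ x a) * runBonus M T δ h t x a) := by
    simp only [mul_sub, Finset.sum_sub_distrib, Finset.mul_sum (s := Finset.range T)]
    rw [Finset.sum_comm, Finset.sum_comm (s := M.lay.inner)]
  have e2 : ∑ x ∈ M.lay.inner, sp x * (3 * logTerm X A T δ / eta X A L T +
        ∑ t ∈ Finset.range T, (runLocalBonus M T δ h t x +
        1 / (L : ℝ) * ∑ a, policy M T δ h t x a * runBonus M T δ h t x a)) =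
      L * (3 * logTerm X A T δ / eta X A L T) + ∑ t ∈ Finset.range T, ∑ x ∈ M.lay.inner,
        sp x * (runLocalBonus M T δ h t x +
        1 / (L : ℝ) * ∑ a, policy M T δ h t x a * runBonus M T δ h t x a) := by
    simp only [mul_add (sp _) (3 * logTerm X A T δ / eta X A L T),
      Finset.sum_add_distrib (s := M.lay.inner)
        (f := fun x => sp x * (3 * logTerm X A T δ / eta X A L T)), ← Finset.sum_mul, hspsum]
    congr 1
    rw [Finset.sum_comm]
    exact Finset.sum_congr rfl fun x _ => Finset.mul_sum _ _ _
  rw [Finset.sum_congr rfl fun t _ => hdiff t]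
  rw [e1, e2] at hstate
  linarith

end Regret

/-! ### The effect of an error in the transition function -/

section Perturbation

variable {X A : Type*} [Fintype X] [Fintype A] {L : ℕ} {𝓛 : Layering X L}
  {P P' ε : X → A → X → ℝ} {π v : X → A → ℝ} {N : X → A → ℝ}

/-- The sum over the steps of an episode of a function of the transitions that may depend on the
step. -/
def stepSum (𝓛 : Layering X L) (P : X → A → X → ℝ) (π : X → A → ℝ) (f : ℕ → X → A → ℝ) : ℝ :=
  ∑ k ∈ Finset.range L, ∑ x, ∑ a, stateProb 𝓛 P π k x * π x a * f k x a

theorem stepSum_mono (hP : ∀ x a x', 0 ≤ P x a x') (hπ : IsPolicy π) {f g : ℕ → X → A → ℝ}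
    (h : ∀ k < L, ∀ x a, f k x a ≤ g k x a) : stepSum 𝓛 P π f ≤ stepSum 𝓛 P π g :=
  Finset.sum_le_sum fun k hk => Finset.sum_le_sum fun x _ => Finset.sum_le_sum fun a _ =>
    mul_le_mul_of_nonneg_left (h k (Finset.mem_range.1 hk) x a)
      (mul_nonneg (stateProb_nonneg hP hπ k x) ((hπ x).1 a))

theorem abs_stepSum_le (hP : ∀ x a x', 0 ≤ P x a x') (hπ : IsPolicy π) (f : ℕ → X → A → ℝ) :
    |stepSum 𝓛 P π f| ≤ stepSum 𝓛 P π (fun k x a => |f k x a|) := by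
  refine (Finset.abs_sum_le_sum_abs _ _).trans (Finset.sum_le_sum fun k _ => ?_)
  refine (Finset.abs_sum_le_sum_abs _ _).trans (Finset.sum_le_sum fun x _ => ?_)
  refine (Finset.abs_sum_le_sum_abs _ _).trans (Finset.sum_le_sum fun a _ => ?_)
  rw [abs_mul, abs_of_nonneg (mul_nonneg (stateProb_nonneg hP hπ k x) ((hπ x).1 a))]

theorem stepSum_add (f g : ℕ → X → A → ℝ) :
    stepSum 𝓛 P π (fun k x a => f k x a + g k x a) = stepSum 𝓛 P π f + stepSum 𝓛 P π g := by
  simp only [stepSum, mul_add, Finset.sum_add_distrib]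

theorem stepSum_smul (c : ℝ) (f : ℕ → X → A → ℝ) :
    stepSum 𝓛 P π (fun k x a => c * f k x a) = c * stepSum 𝓛 P π f := by
  simp only [stepSum, Finset.mul_sum, mul_left_comm c]

theorem stepSum_sum {ι : Type*} (s : Finset ι) (f : ι → ℕ → X → A → ℝ) :
    stepSum 𝓛 P π (fun k x a => ∑ i ∈ s, f i k x a) = ∑ i ∈ s, stepSum 𝓛 P π (f i) := by
  induction s using Finset.induction_on with
  | empty => simp [stepSum]
  | insert i s hi ih => simp only [Finset.sum_insert hi, stepSum_add, ih]

theorem stepSum_eq_value (v : X → A → ℝ) : stepSum 𝓛 P π (fun _ => v) = value 𝓛 P π v := rfl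

theorem abs_sum_sub_mul_le (hε : ∀ x a x', |P' x a x' - P x a x'| ≤ ε x a x') {f : X → ℝ} {c : ℝ}
    (hf : ∀ x, |f x| ≤ c) (x : X) (a : A) :
    |∑ x', (P' x a x' - P x a x') * f x'| ≤ c * ∑ x', ε x a x' := by
  rw [Finset.mul_sum]
  refine (Finset.abs_sum_le_sum_abs _ _).trans (Finset.sum_le_sum fun y _ => ?_)
  rw [abs_mul, mul_comm]
  exact mul_le_mul (hf y) (hε x a y) (abs_nonneg _) ((abs_nonneg _).trans (hf y))

/-- The simulation lemma with values-to-go bounded by `L`. `P'` may be substochastic because the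
bound is meant for the empirical transition function. -/
theorem abs_value_sub_value_le (hP : ∀ x a x', 0 ≤ P x a x') (hP' : ∀ x a x', 0 ≤ P' x a x')
    (hP's : ∀ x a, ∑ x', P' x a x' ≤ 1) (hπ : IsPolicy π) (hv : ∀ x a, |v x a| ≤ 1)
    (hε : ∀ x a x', |P' x a x' - P x a x'| ≤ ε x a x') :
    |value 𝓛 P' π v - value 𝓛 P π v| ≤
      L * value 𝓛 P π (fun x a => ∑ x', ε x a x') := by
  rw [value_sub_value]
  change |stepSum 𝓛 P π (fun k x a => ∑ x', (P' x a x' - P x a x') *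
    vgo P' π v (L - (k + 1)) x')| ≤ _
  refine (abs_stepSum_le hP hπ _).trans ?_
  rw [← value_smul, ← stepSum_eq_value]
  refine stepSum_mono hP hπ fun k _ x a => abs_sum_sub_mul_le hε (fun y => ?_) x a
  refine (abs_vgo_le hP' hP's hπ hv _ y).trans ?_
  exact_mod_cast Nat.sub_le _ _

theorem abs_vgo_sub_vgo_le (hP : ∀ x a x', 0 ≤ P x a x') (hP' : ∀ x a x', 0 ≤ P' x a x')
    (hP's : ∀ x a, ∑ x', P' x a x' ≤ 1) (hπ : IsPolicy π) (hv : ∀ x a, |v x a| ≤ 1)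
    (hε : ∀ x a x', |P' x a x' - P x a x'| ≤ ε x a x') {n : ℕ} (hn : n ≤ L) (x : X) :
    |vgo P' π v n x - vgo P π v n x| ≤ L * vgo P π (fun x a => ∑ x', ε x a x') n x := by
  induction n generalizing x with
  | zero => simp [vgo]
  | succ n ih =>
    have ih := ih (by omega)
    simp only [vgo]
    rw [← Finset.sum_sub_distrib, Finset.mul_sum]
    refine (Finset.abs_sum_le_sum_abs _ _).trans (Finset.sum_le_sum fun a _ => ?_)
    rw [← mul_sub, abs_mul, abs_of_nonneg ((hπ x).1 a), mul_left_comm]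
    refine mul_le_mul_of_nonneg_left ?_ ((hπ x).1 a)
    have e1 : v x a + ∑ x', P' x a x' * vgo P' π v n x' -
        (v x a + ∑ x', P x a x' * vgo P π v n x') =
        ∑ x', (P' x a x' - P x a x') * vgo P' π v n x' +
        ∑ x', P x a x' * (vgo P' π v n x' - vgo P π v n x') := by
      rw [add_sub_add_left_eq_sub, ← Finset.sum_sub_distrib, ← Finset.sum_add_distrib]
      exact Finset.sum_congr rfl fun y _ => by ring
    rw [e1, mul_add]
    refine (abs_add_le _ _).trans (add_le_add (abs_sum_sub_mul_le hε (fun y => ?_) x a) ?_)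
    · refine (abs_vgo_le hP' hP's hπ hv _ y).trans ?_
      exact_mod_cast by omega
    · rw [Finset.mul_sum]
      refine (Finset.abs_sum_le_sum_abs _ _).trans (Finset.sum_le_sum fun y _ => ?_)
      rw [abs_mul, abs_of_nonneg (hP x a y), mul_left_comm]
      exact mul_le_mul_of_nonneg_left (ih y) (hP x a y)

/-- The indicator of a pair. -/
def pairInd (x : X) (a : A) (y : X) (b : A) : ℝ := if y = x ∧ b = a then 1 else 0

theorem abs_pairInd_le (x : X) (a : A) (y : X) (b : A) : |pairInd x a y b| ≤ 1 := by
  unfold pairInd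
  split_ifs <;> simp

theorem pairInd_nonneg (x : X) (a : A) (y : X) (b : A) : 0 ≤ pairInd x a y b := by
  unfold pairInd
  split_ifs <;> simp

theorem sum_pairInd_le (s : Finset X) (y : X) (b : A) : ∑ x ∈ s, ∑ a, pairInd x a y b ≤ 1 := by
  calc ∑ x ∈ s, ∑ a, pairInd x a y b ≤ ∑ x, ∑ a, pairInd x a y b :=
        Finset.sum_le_univ_sum_of_nonneg fun x =>
          Finset.sum_nonneg fun a _ => pairInd_nonneg x a y b
    _ = 1 := by simp [pairInd, ite_and]

theorem value_pairInd (hP : IsTransition 𝓛 P) {x : X} (hx : 𝓛.layer x < L) (a : A) :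
    value 𝓛 P π (pairInd x a) = occ 𝓛 P π x a := by
  rw [value_eq_sum_occ hP]
  simp only [pairInd, ite_and, mul_ite, mul_one, mul_zero]
  rw [Finset.sum_eq_single x]
  · simp
  · intro y _ hy
    simp [hy]
  · intro h
    exact absurd (Layering.mem_inner.2 hx) h

/-- A bound on the deviation of an occupancy when the transition function varies by `ε`. -/
def occDev (𝓛 : Layering X L) (P ε : X → A → X → ℝ) (π : X → A → ℝ) (x : X) (a : A) : ℝ :=
  stepSum 𝓛 P π fun k y b => ∑ y', ε y b y' * (vgo P π (pairInd x a) (L - (k + 1)) y' +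
    L * vgo P π (fun x a => ∑ x', ε x a x') (L - (k + 1)) y')

/-- An occupancy is the value of an indicator. The simulation lemma leaves a value-to-go under `P'`,
which is replaced by the one under `P` plus `L` times the accumulated error. The bound no longer
involves `P'`, so it holds for a whole confidence set at once. -/
theorem abs_occ_sub_occ_le (hP : IsTransition 𝓛 P) (hP' : IsTransition 𝓛 P') (hπ : IsPolicy π)
    (hε : ∀ x a x', |P' x a x' - P x a x'| ≤ ε x a x') {x : X} (hx : 𝓛.layer x < L) (a : A) :
    |occ 𝓛 P' π x a - occ 𝓛 P π x a| ≤ occDev 𝓛 P ε π x a := by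
  rw [← value_pairInd hP hx, ← value_pairInd hP' hx, value_sub_value]
  refine (abs_stepSum_le (𝓛 := 𝓛) hP.1 hπ (fun k y b => ∑ y', (P' y b y' - P y b y') *
    vgo P' π (pairInd x a) (L - (k + 1)) y')).trans ?_
  refine stepSum_mono hP.1 hπ fun k _ y b => ?_
  refine (Finset.abs_sum_le_sum_abs _ _).trans (Finset.sum_le_sum fun y' _ => ?_)
  have h1 := abs_vgo_sub_vgo_le hP.1 hP'.1 hP'.sum_le_one hπ (abs_pairInd_le x a) hε
    (Nat.sub_le L (k + 1)) y'
  have h2 := vgo_nonneg hP'.1 hπ (pairInd_nonneg x a) (L - (k + 1)) y'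
  rw [abs_mul, abs_of_nonneg h2]
  exact mul_le_mul (hε y b y') (by linarith [(abs_le.1 h1).2]) h2
    ((abs_nonneg _).trans (hε y b y'))

/-- At each step only the indicator of the current pair is nonzero, so the first-order parts of all
pairs together cost a factor `L`. Only the second-order part pays for the number of pairs. -/
theorem sum_occDev_le (hP : IsTransition 𝓛 P) (hπ : IsPolicy π) (hε : ∀ x a x', 0 ≤ ε x a x') :
    ∑ x ∈ 𝓛.inner, ∑ a, occDev 𝓛 P ε π x a ≤
      L * value 𝓛 P π (fun x a => ∑ x', ε x a x') +
      Fintype.card X * Fintype.card A * L * stepSum 𝓛 P π (fun k y b => ∑ y', ε y b y' *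
        vgo P π (fun x a => ∑ x', ε x a x') (L - (k + 1)) y') := by
  simp only [occDev, ← stepSum_sum]
  rw [← stepSum_eq_value, ← stepSum_smul, ← stepSum_smul, ← stepSum_add]
  refine stepSum_mono hP.1 hπ fun k _ y b => ?_
  rw [Finset.sum_congr rfl fun x _ => Finset.sum_comm, Finset.sum_comm, Finset.mul_sum,
    Finset.mul_sum, ← Finset.sum_add_distrib]
  refine Finset.sum_le_sum fun y' _ => ?_
  simp only [← Finset.mul_sum, Finset.sum_add_distrib]
  have hE : ∀ x a, 0 ≤ ∑ x', ε x a x' := fun x a => Finset.sum_nonneg fun x' _ => hε x a x'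
  have h1 : ∑ x ∈ 𝓛.inner, ∑ a, vgo P π (pairInd x a) (L - (k + 1)) y' ≤ L := by
    simp only [← vgo_sum]
    refine (le_abs_self _).trans ((abs_vgo_le hP.1 hP.sum_le_one hπ (fun z c => ?_) _ y').trans ?_)
    · rw [abs_of_nonneg (Finset.sum_nonneg fun x _ => Finset.sum_nonneg fun a _ =>
        pairInd_nonneg x a z c)]
      exact sum_pairInd_le _ z c
    · exact_mod_cast Nat.sub_le _ _
  set V := vgo P π (fun x a => ∑ x', ε x a x') (L - (k + 1)) y' with hV
  have hV0 : 0 ≤ V := vgo_nonneg hP.1 hπ hE _ y'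
  have h2 : ∑ x ∈ 𝓛.inner, ∑ _a : A, (L : ℝ) * V ≤ Fintype.card X * Fintype.card A * L * V := by
    simp only [Finset.sum_const, nsmul_eq_mul, Finset.card_univ]
    have : (𝓛.inner.card : ℝ) ≤ Fintype.card X := by exact_mod_cast Finset.card_le_univ _
    calc _ ≤ (Fintype.card X : ℝ) * (Fintype.card A * (L * V)) := by gcongr
      _ = _ := by ring
  have h3 := mul_le_mul_of_nonneg_left (add_le_add h1 h2) (hε y b y')
  simp only [← Finset.mul_sum] at h3
  linarith

/-- For a nonnegative payoff the expected value-to-go can only decrease along the episode. -/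
theorem sum_stateProb_mul_vgo_le (hP : ∀ x a x', 0 ≤ P x a x') (hπ : IsPolicy π)
    (hv : ∀ x a, 0 ≤ v x a) {k : ℕ} (hk : k ≤ L) :
    ∑ x, stateProb 𝓛 P π k x * vgo P π v (L - k) x ≤ value 𝓛 P π v := by
  induction k with
  | zero => rw [sum_stateProb_zero_mul, value_eq_vgo, Nat.sub_zero]
  | succ k ih =>
    refine le_trans ?_ (ih (by omega))
    rw [stateProb_succ, sum_push_mul]
    refine Finset.sum_le_sum fun x _ => mul_le_mul_of_nonneg_left ?_ (stateProb_nonneg hP hπ k x)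
    rw [vgo_sub_succ P π v (by omega)]
    exact Finset.sum_le_sum fun a _ => mul_le_mul_of_nonneg_left
      (le_add_of_nonneg_left (hv x a)) ((hπ x).1 a)

/-- The shape of the confidence intervals of the transition probabilities. -/
def tolerance (𝓛 : Layering X L) (P : X → A → X → ℝ) (N : X → A → ℝ) (x : X) (a : A) (x' : X) :
    ℝ := if 𝓛.layer x' = 𝓛.layer x + 1 then √(P x a x' / N x a) + 1 / N x a else 0

theorem tolerance_nonneg (hN : ∀ x a, 1 ≤ N x a) (x : X) (a : A) (x' : X) :
    0 ≤ tolerance 𝓛 P N x a x' := by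
  unfold tolerance
  have := zero_lt_one.trans_le (hN x a)
  split_ifs
  · positivity
  · exact le_rfl

theorem sum_tolerance_le (hP : IsTransition 𝓛 P) (hN : ∀ x a, 1 ≤ N x a) (x : X) (a : A) :
    ∑ x', tolerance 𝓛 P N x a x' ≤ 2 * Fintype.card X * √(1 / N x a) := by
  have h0 := zero_lt_one.trans_le (hN x a)
  have h1 : ∀ x', tolerance 𝓛 P N x a x' ≤ 2 * √(1 / N x a) := by
    intro x'
    have h2 : 1 / N x a ≤ √(1 / N x a) := by
      refine Real.le_sqrt_of_sq_le ?_
      rw [sq]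
      exact mul_le_of_le_one_left (by positivity) (div_le_one_of_le₀ (hN x a) h0.le)
    unfold tolerance
    split_ifs
    · have : √(P x a x' / N x a) ≤ √(1 / N x a) :=
        Real.sqrt_le_sqrt (div_le_div_of_nonneg_right (hP.le_one _ _ _) h0.le)
      linarith
    · positivity
  refine (Finset.sum_le_sum fun x' _ => h1 x').trans_eq ?_
  simp only [Finset.sum_const, nsmul_eq_mul, Finset.card_univ]
  ring

theorem two_mul_sqrt_mul_le {u w : ℝ} (hu : 0 ≤ u) (hw : 0 ≤ w) : 2 * (√u * √w) ≤ u + w := by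
  have := two_mul_le_add_sq √u √w
  rw [Real.sq_sqrt hu, Real.sq_sqrt hw] at this
  linarith

/-- The contribution of two errors along an episode is of second order. -/
theorem stepSum_tolerance_le (hP : IsTransition 𝓛 P) (hπ : IsPolicy π) (hN : ∀ x a, 1 ≤ N x a) :
    stepSum 𝓛 P π (fun k y b => ∑ y', tolerance 𝓛 P N y b y' *
        vgo P π (fun x a => ∑ x', tolerance 𝓛 P N x a x') (L - (k + 1)) y') ≤
      6 * (Fintype.card X : ℝ) ^ 2 * L * value 𝓛 P π (fun x a => 1 / N x a) := by
  have : Nonempty X := ⟨𝓛.start⟩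
  have hS1 : (1 : ℝ) ≤ Fintype.card X := by exact_mod_cast Fintype.card_pos
  have hN0 : ∀ x a, 0 < N x a := fun x a => zero_lt_one.trans_le (hN x a)
  set S := (Fintype.card X : ℝ) with hS
  set e : X → A → ℝ := fun x a => √(1 / N x a) with he
  have hinv : ∀ x a, 0 ≤ 1 / N x a := fun x a => by have := hN0 x a; positivity
  have h1 : ∀ n y, vgo P π (fun x a => ∑ x', tolerance 𝓛 P N x a x') n y ≤
      2 * S * vgo P π e n y := by
    intro n y
    rw [← vgo_smul]
    exact vgo_mono hP.1 hπ (sum_tolerance_le hP hN) n y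
  have he0 : ∀ n y, 0 ≤ vgo P π e n y := vgo_nonneg hP.1 hπ fun x a => Real.sqrt_nonneg _
  have heL : ∀ n ≤ L, ∀ y, vgo P π e n y ≤ L := by
    intro n hn y
    refine (le_abs_self _).trans ((abs_vgo_le hP.1 hP.sum_le_one hπ (fun x a => ?_) n y).trans ?_)
    · rw [abs_of_nonneg (Real.sqrt_nonneg _)]
      exact Real.sqrt_le_one.2 (div_le_one_of_le₀ (hN x a) (hN0 x a).le)
    · exact_mod_cast hn
  -- The product of two errors is regrouped as `√(1/N) · √(P/N') ≤ 1/N + P/N'`, with `N'` the later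
  -- counter. Keeping `P` next to the later counter makes the sum over successors an expectation
  -- under `P`.
  have hmix : ∀ n ≤ L, ∀ y b y', √(P y b y' / N y b) * vgo P π e n y' ≤
      L * (1 / N y b) + P y b y' * vgo P π (fun x a => 1 / N x a) n y' := by
    intro n hn y b y'
    have h2 : vgo P π (fun x a => √(P y b y' / N y b) * e x a) n y' ≤
        vgo P π (fun x a => 1 / N y b * 1 + P y b y' * (1 / N x a)) n y' := by
      refine vgo_mono hP.1 hπ (fun x a => ?_) n y'
      have h3 := two_mul_sqrt_mul_le (hinv y b) (mul_nonneg (hP.1 y b y') (hinv x a))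
      have h4 : √(P y b y' / N y b) * e x a =
          √(1 / N y b) * √(P y b y' * (1 / N x a)) := by
        rw [he, ← Real.sqrt_mul (div_nonneg (hP.1 _ _ _) (hN0 y b).le),
          ← Real.sqrt_mul (hinv y b)]
        congr 1
        ring
      have h5 := mul_nonneg (Real.sqrt_nonneg (1 / N y b))
        (Real.sqrt_nonneg (P y b y' * (1 / N x a)))
      linarith
    rw [vgo_add, vgo_smul, vgo_smul, vgo_smul] at h2
    refine h2.trans (add_le_add_left ?_ _)
    rw [mul_comm (L : ℝ)]
    refine mul_le_mul_of_nonneg_left ?_ (hinv y b)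
    refine (le_abs_self _).trans ((abs_vgo_le hP.1 hP.sum_le_one hπ (fun x a => ?_) n y').trans ?_)
    · simp
    · exact_mod_cast hn
  have hrow : ∀ k < L, ∀ y b, ∑ y', tolerance 𝓛 P N y b y' *
        vgo P π (fun x a => ∑ x', tolerance 𝓛 P N x a x') (L - (k + 1)) y' ≤
      2 * S * (2 * S * L * (1 / N y b) + ∑ y', P y b y' *
        vgo P π (fun x a => 1 / N x a) (L - (k + 1)) y') := by
    intro k hk y b
    have h2 : ∀ y', tolerance 𝓛 P N y b y' *
        vgo P π (fun x a => ∑ x', tolerance 𝓛 P N x a x') (L - (k + 1)) y' ≤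
        2 * S * (2 * L * (1 / N y b) + P y b y' *
          vgo P π (fun x a => 1 / N x a) (L - (k + 1)) y') := by
      intro y'
      have h3 : tolerance 𝓛 P N y b y' ≤ √(P y b y' / N y b) + 1 / N y b := by
        unfold tolerance
        split_ifs
        · exact le_rfl
        · have := hinv y b
          positivity
      have h4 := hmix (L - (k + 1)) (Nat.sub_le _ _) y b y'
      have h5 := mul_le_mul_of_nonneg_left (heL (L - (k + 1)) (Nat.sub_le _ _) y') (hinv y b)
      calc _ ≤ (√(P y b y' / N y b) + 1 / N y b) * (2 * S * vgo P π e (L - (k + 1)) y') :=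
            mul_le_mul h3 (h1 _ y') (vgo_nonneg hP.1 hπ (fun x a => Finset.sum_nonneg fun x' _ =>
              tolerance_nonneg hN x a x') _ y')
              (add_nonneg (Real.sqrt_nonneg _) (hinv y b))
        _ = 2 * S * (√(P y b y' / N y b) * vgo P π e (L - (k + 1)) y' +
              1 / N y b * vgo P π e (L - (k + 1)) y') := by ring
        _ ≤ _ := mul_le_mul_of_nonneg_left (by linarith) (by positivity)
    refine (Finset.sum_le_sum fun y' _ => h2 y').trans_eq ?_
    rw [← Finset.mul_sum, Finset.sum_add_distrib]
    simp only [Finset.sum_const, nsmul_eq_mul, Finset.card_univ]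
    rw [← hS]
    ring
  refine (stepSum_mono hP.1 hπ hrow).trans ?_
  rw [stepSum_smul, stepSum_add, stepSum_smul, stepSum_eq_value]
  have hV0 : 0 ≤ value 𝓛 P π (fun x a => 1 / N x a) := value_nonneg hP.1 hπ hinv
  -- Each of the `L` steps contributes the expected tail of a nonnegative value, hence at most the
  -- whole value.
  have hlast : stepSum 𝓛 P π (fun k y b => ∑ y', P y b y' *
        vgo P π (fun x a => 1 / N x a) (L - (k + 1)) y') ≤
      L * value 𝓛 P π (fun x a => 1 / N x a) := by
    calc _ ≤ ∑ _k ∈ Finset.range L, value 𝓛 P π (fun x a => 1 / N x a) := by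
          refine Finset.sum_le_sum fun k hk => ?_
          have hk := Finset.mem_range.1 hk
          have := sum_stateProb_mul_vgo_le (𝓛 := 𝓛) hP.1 hπ hinv (show k + 1 ≤ L by omega)
          rw [stateProb_succ, sum_push_mul] at this
          refine le_trans (le_of_eq ?_) this
          simp only [mul_assoc, Finset.mul_sum]
      _ = _ := by simp
  set V := value 𝓛 P π (fun x a => 1 / N x a)
  have hLV : 0 ≤ L * V := by positivity
  calc _ ≤ 2 * S * (2 * S * L * V + L * V) := by gcongr
    _ ≤ 2 * S * (2 * S * L * V + S * (L * V)) := mul_le_mul_of_nonneg_left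
        (add_le_add_right (le_mul_of_one_le_left hLV hS1) _) (by positivity)
    _ = _ := by ring

/-- The first-order bound on the accumulated errors of an episode. -/
theorem value_tolerance_le (hP : IsTransition 𝓛 P) (hπ : IsPolicy π) (hN : ∀ x a, 1 ≤ N x a)
    {β : ℝ} (hβ : 0 < β) :
    value 𝓛 P π (fun x a => ∑ x', tolerance 𝓛 P N x a x') ≤
      β * Fintype.card X + (1 / β + Fintype.card X) * value 𝓛 P π (fun x a => 1 / N x a) := by
  have hN0 : ∀ x a, 0 < N x a := fun x a => zero_lt_one.trans_le (hN x a)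
  have hinv : ∀ x a, 0 ≤ 1 / N x a := fun x a => by have := hN0 x a; positivity
  set S := (Fintype.card X : ℝ) with hS
  set f : ℕ → ℝ := fun k => ∑ x' : X, if 𝓛.layer x' = k + 1 then (1 : ℝ) else 0 with hf
  -- `√(P/N) ≤ β + P/(β N)`. Keeping `P` makes the second term sum to at most `1/(β N)`. The first
  -- counts only the states of the next layer, so over an episode it amounts to `β |X|` instead of
  -- `β |X| L`.
  have hrow : ∀ x a, ∑ x', tolerance 𝓛 P N x a x' ≤
      β * f (𝓛.layer x) + (1 / β + S) * (1 / N x a) := by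
    intro x a
    have h1 : ∀ x', tolerance 𝓛 P N x a x' ≤
        β * (if 𝓛.layer x' = 𝓛.layer x + 1 then (1 : ℝ) else 0) +
        (P x a x' * (1 / β * (1 / N x a)) + 1 / N x a) := by
      intro x'
      have h3 : 0 ≤ P x a x' * (1 / β * (1 / N x a)) :=
        mul_nonneg (hP.1 _ _ _) (mul_nonneg (by positivity) (hinv x a))
      unfold tolerance
      split_ifs
      · have h2 := two_mul_sqrt_mul_le hβ.le h3
        rw [← Real.sqrt_mul hβ.le] at h2
        have h4 : β * (P x a x' * (1 / β * (1 / N x a))) = P x a x' / N x a := by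
          field_simp
        rw [h4] at h2
        have := Real.sqrt_nonneg (P x a x' / N x a)
        linarith
      · have := hinv x a
        linarith
    refine (Finset.sum_le_sum fun x' _ => h1 x').trans ?_
    rw [Finset.sum_add_distrib, Finset.sum_add_distrib, ← Finset.mul_sum, ← Finset.sum_mul]
    simp only [Finset.sum_const, nsmul_eq_mul, Finset.card_univ]
    have h5 := mul_le_mul_of_nonneg_right (hP.sum_le_one x a)
      (mul_nonneg (one_div_pos.2 hβ).le (hinv x a))
    rw [← hS]
    linarith
  refine (value_mono hP.1 hπ hrow).trans ?_
  rw [value_add, value_smul, value_smul]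
  refine add_le_add_left (mul_le_mul_of_nonneg_left ?_ hβ.le) _
  have h6 : value 𝓛 P π (fun x _ => f (𝓛.layer x)) = ∑ k ∈ Finset.range L, f k := by
    refine Finset.sum_congr rfl fun k hk => ?_
    have h7 : ∀ x a, stateProb 𝓛 P π k x * π x a * f (𝓛.layer x) =
        stateProb 𝓛 P π k x * π x a * f k := by
      intro x a
      by_cases h : 𝓛.layer x = k
      · rw [h]
      · rw [stateProb_eq_zero hP h]
        simp
    simp only [h7, ← Finset.sum_mul, ← Finset.mul_sum, (hπ _).2, mul_one,
      sum_stateProb hP hπ (Finset.mem_range.1 hk).le, one_mul]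
  rw [h6, hf, Finset.sum_comm]
  calc _ ≤ ∑ _x : X, (1 : ℝ) := by
        refine Finset.sum_le_sum fun x _ => ?_
        rw [Finset.sum_boole]
        have : ((Finset.range L).filter fun k => 𝓛.layer x = k + 1).card ≤ 1 := by
          rw [Finset.card_le_one]
          intro i hi j hj
          simp only [Finset.mem_filter] at hi hj
          omega
        exact_mod_cast this
    _ = S := by simp [hS]

end Perturbation

/-! ### Accumulated widths along a run -/

section Widths

variable {X A : Type*} [Fintype X] [Fintype A] {L m : ℕ} {M : Model X A L m} {T : ℕ} {δ : ℝ}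
  {h : ℕ → Episode X A L m}

/-- Nonempty layers are not part of the definition; they follow because the state distribution has
total mass one at every time up to `L`. -/
theorem card_gt_layers {𝓛 : Layering X L} {P : X → A → X → ℝ} {π : X → A → ℝ}
    (hP : IsTransition 𝓛 P) (hπ : IsPolicy π) : L + 1 ≤ Fintype.card X := by
  have h1 : ∀ k : Fin (L + 1), ∃ x, 𝓛.layer x = k := by
    intro k
    by_contra! hk
    have h2 := sum_stateProb hP hπ (Nat.lt_succ_iff.1 k.2)
    rw [Finset.sum_eq_zero fun x _ => stateProb_eq_zero hP (hk x)] at h2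
    exact zero_ne_one h2
  choose f hf using h1
  have := Fintype.card_le_of_injective f fun i j hij => Fin.ext (by rw [← hf, ← hf, hij])
  simpa using this

/-- Within an epoch the counters at most double. -/
theorem visits_le_epochStart (h : ℕ → Episode X A L m) (t : ℕ) (x : X) (a : A) :
    visits h t x a ≤ 2 * max 1 (visits h (epochStart h t) x a) := by
  induction t with
  | zero => simp [visits]
  | succ t ih =>
    rw [epochStart]
    split_ifs with hc
    · omega
    · push Not at hc
      by_cases hv : Visited (h t) x a
      · have := hc x a hv
        omega
      · have : visits h (t + 1) x a = visits h t x a := by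
          unfold visits
          rw [Finset.range_add_one, Finset.filter_insert, if_neg hv]
        omega

theorem den_le_epochStart (h : ℕ → Episode X A L m) (t : ℕ) (x : X) (a : A) :
    den h t x a ≤ 2 * den h (epochStart h t) x a := by
  have h1 : (visits h t x a : ℝ) ≤ 2 * max 1 (visits h (epochStart h t) x a : ℝ) := by
    exact_mod_cast visits_le_epochStart h t x a
  have h2 := one_le_den h (epochStart h t) x a
  exact max_le (by linarith) h1

/-- The width contains the empirical `p`, but only a width in terms of the true `P` can be averaged
under `P`. Absorbing half of `p` in its own confidence interval gives `p ≤ 2 P + 35 l / N`, which is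
substituted back. -/
theorem empirical_width_le {P p N l : ℝ} (hP : 0 ≤ P) (hp : 0 ≤ p) (hN : 1 ≤ N) (hl : 1 ≤ l)
    (hd : |P - p| ≤ 4 * √(p * l / N) + 28 * l / (3 * N)) :
    4 * √(p * l / N) + 28 * l / (3 * N) ≤ 34 * l * (√(P / N) + 1 / N) := by
  have hN0 : 0 < N := by linarith
  have e1 : 28 * l / (3 * N) = 28 / 3 * (l / N) := by ring
  rw [e1] at hd ⊢
  set u := l / N with hu
  have hu0 : 0 ≤ u := by positivity
  have e2 : p * l / N = p * u := by rw [hu]; ring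
  rw [e2] at hd ⊢
  have h1 : 4 * √(p * u) ≤ p / 2 + 8 * u := by
    have := two_mul_sqrt_mul_le (u := p / 2) (w := 8 * u) (by positivity) (by positivity)
    rw [← Real.sqrt_mul (by positivity)] at this
    have e3 : p / 2 * (8 * u) = 2 ^ 2 * (p * u) := by ring
    rw [e3, Real.sqrt_mul (by positivity), Real.sqrt_sq (by norm_num)] at this
    linarith
  have h2 : p ≤ 2 * P + 35 * u := by linarith [(abs_le.1 hd).1]
  have h3 : √(p * u) ≤ 3 / 2 * √(P * u) + 6 * u := by
    refine Real.sqrt_le_iff.2 ⟨by positivity, ?_⟩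
    have h4 : √(P * u) ^ 2 = P * u := Real.sq_sqrt (by positivity)
    have h5 := mul_nonneg (Real.sqrt_nonneg (P * u)) hu0
    nlinarith [mul_nonneg hu0 hu0, mul_nonneg hP hu0]
  have h6 : √(P * u) ≤ l * √(P / N) := by
    refine Real.sqrt_le_iff.2 ⟨by positivity, ?_⟩
    rw [mul_pow, Real.sq_sqrt (by positivity), hu]
    have : P * (l / N) = l * (P / N) := by ring
    rw [this]
    refine mul_le_mul_of_nonneg_right ?_ (by positivity)
    nlinarith
  have e4 : 34 * l * (√(P / N) + 1 / N) = 34 * (l * √(P / N)) + 34 * u := by rw [hu]; ring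
  rw [e4]
  have := Real.sqrt_nonneg (P * u)
  linarith

theorem pHat_nonneg (h : ℕ → Episode X A L m) (t : ℕ) (x : X) (a : A) (x' : X) :
    0 ≤ pHat h t x a x' :=
  div_nonneg (Nat.cast_nonneg _) (den_pos h t x a).le

theorem TransGood.confWidth_le (hg : TransGood M T δ h) (hlog : 1 ≤ logTerm X A T δ) {t : ℕ}
    (ht : t < T) {x : X} {a : A} {x' : X} (hx : M.lay.layer x' = M.lay.layer x + 1) :
    confWidth T δ h t x a x' ≤
      34 * logTerm X A T δ * (√(M.P x a x' / den h t x a) + 1 / den h t x a) :=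
  empirical_width_le (M.isTransition.1 x a x') (pHat_nonneg h t x a x') (one_le_den h t x a) hlog
    (hg t ht x a x' hx)

theorem Regular.pHat_eq_zero (hr : Regular M T h) {t : ℕ} (ht : t ≤ T) {x : X} {a : A} {x' : X}
    (hx : M.lay.layer x' ≠ M.lay.layer x + 1) : pHat h t x a x' = 0 := by
  have h1 : transits h t x a x' = 0 := by
    refine Finset.card_eq_zero.2 (Finset.filter_eq_empty_iff.2 fun s hs hv => ?_)
    obtain ⟨k, rfl, -, rfl⟩ := hv
    have hf := (hr s ((Finset.mem_range.1 hs).trans_le ht)).1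
    exact hx (M.isTransition.2.1 _ _ _ (hf.2 k))
  rw [pHat, h1]
  simp

theorem Regular.sum_pHat_le_one (hr : Regular M T h) {t : ℕ} (ht : t ≤ T) (x : X) (a : A) :
    ∑ x', pHat h t x a x' ≤ 1 := by
  simp only [pHat]
  rw [← Finset.sum_div]
  refine div_le_one_of_le₀ ?_ (den_pos h t x a).le
  refine le_trans ?_ (le_max_right _ _)
  simp only [transits_eq_sum, visits_eq_sum]
  rw [Finset.sum_comm]
  refine Finset.sum_le_sum fun s hs => ?_
  have hf := (hr s ((Finset.mem_range.1 hs).trans_le ht)).1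
  by_cases hv : Visited (h s) x a
  · rw [if_pos hv]
    obtain ⟨k, hk, ha⟩ := hv
    have hkl := hf.eq_layer M.isTransition hk
    have h1 : ∀ x', VisitedTo (h s) x a x' → x' = (h s).1.state k.succ := fun x' hx' =>
      ((hf.hitsTo_iff M.isTransition x a x' hkl).1 hx').2.symm
    calc _ ≤ ∑ x', if x' = (h s).1.state k.succ then (1 : ℝ) else 0 := by
          refine Finset.sum_le_sum fun x' _ => ?_
          by_cases hx' : VisitedTo (h s) x a x'
          · rw [if_pos hx', if_pos (h1 x' hx')]
          · rw [if_neg hx']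
            split_ifs <;> norm_num
      _ = 1 := by simp
  · rw [if_neg hv]
    refine (Finset.sum_eq_zero fun x' _ => if_neg fun hx' => hv ?_).le
    exact HitsTo.hits (τ := (h s).1) hx'

/-- Here `34` would suffice; `136` is taken so that the empirical transition function and the
members of the confidence sets obey the same bound. -/
theorem TransGood.abs_pHat_sub_le (hg : TransGood M T δ h) (hr : Regular M T h)
    (hlog : 1 ≤ logTerm X A T δ) {t : ℕ} (ht : t < T) (x : X) (a : A) (x' : X) :
    |pHat h t x a x' - M.P x a x'| ≤
      136 * logTerm X A T δ * tolerance M.lay M.P (den h t) x a x' := by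
  unfold tolerance
  split_ifs with hx
  · rw [abs_sub_comm]
    refine ((hg t ht x a x' hx).trans (hg.confWidth_le hlog ht hx)).trans ?_
    have := den_pos h t x a
    have : 0 ≤ √(M.P x a x' / den h t x a) + 1 / den h t x a := by positivity
    exact mul_le_mul_of_nonneg_right (by linarith) this
  · rw [hr.pHat_eq_zero ht.le hx, M.isTransition.eq_zero hx]
    simp

/-- The constant is `34 · 2 · 2`: `P'` and the true function both lie within one width of the
empirical one, and that width belongs to the start of the epoch, where the counter is at least half
the current one. -/
theorem TransGood.abs_sub_le (hg : TransGood M T δ h) (hlog : 1 ≤ logTerm X A T δ) {t : ℕ}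
    (ht : t < T) {P' : X → A → X → ℝ} (hP' : P' ∈ confSet M.lay T δ h t) (x : X) (a : A) (x' : X) :
    |P' x a x' - M.P x a x'| ≤
      136 * logTerm X A T δ * tolerance M.lay M.P (den h t) x a x' := by
  unfold tolerance
  split_ifs with hx
  · have ht' : epochStart h t < T := (epochStart_le h t).trans_lt ht
    have h1 := hP'.2 x a x' hx
    have h2 := hg _ ht' x a x' hx
    have h3 := hg.confWidth_le hlog ht' hx (a := a)
    have h4 : |P' x a x' - M.P x a x'| ≤ 2 * confWidth T δ h (epochStart h t) x a x' := by
      rw [abs_sub_comm] at h2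
      have := _root_.abs_sub_le (P' x a x') (pHat h (epochStart h t) x a x') (M.P x a x')
      linarith
    have hd := den_le_epochStart h t x a
    have hd0 := den_pos h t x a
    have hd1 := den_pos h (epochStart h t) x a
    have h5 : 1 / den h (epochStart h t) x a ≤ 2 * (1 / den h t x a) := by
      rw [mul_one_div, div_le_div_iff₀ hd1 hd0]
      linarith
    have h6 : √(M.P x a x' / den h (epochStart h t) x a) ≤ 2 * √(M.P x a x' / den h t x a) := by
      have hP0 := M.isTransition.1 x a x'
      refine Real.sqrt_le_iff.2 ⟨by positivity, ?_⟩
      rw [mul_pow, Real.sq_sqrt (by positivity)]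
      have h7 := mul_le_mul_of_nonneg_left h5 hP0
      have h8 : 0 ≤ M.P x a x' * (1 / den h t x a) := by positivity
      rw [div_eq_mul_one_div, div_eq_mul_one_div (M.P x a x') (den h t x a)]
      linarith
    calc _ ≤ 2 * (34 * logTerm X A T δ * (√(M.P x a x' / den h (epochStart h t) x a) +
          1 / den h (epochStart h t) x a)) := by linarith
      _ ≤ 2 * (34 * logTerm X A T δ * (2 * √(M.P x a x' / den h t x a) +
          2 * (1 / den h t x a))) := by gcongr
      _ = _ := by ring
  · rw [hP'.1.eq_zero hx, M.isTransition.eq_zero hx]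
    simp

theorem VisitGood.sum_value_le [Nonempty A] (hv : VisitGood M T δ h) (hlog : 1 ≤ logTerm X A T δ) :
    ∑ t ∈ Finset.range T, value M.lay M.P (policy M T δ h t) (fun x a => 1 / den h t x a) ≤
      10 * (Fintype.card X * Fintype.card A) * logTerm X A T δ := by
  simp only [value_eq_sum_occ M.isTransition, mul_one_div]
  rw [Finset.sum_comm]
  calc _ = ∑ x ∈ M.lay.inner, ∑ a, ∑ t ∈ Finset.range T,
        occ M.lay M.P (policy M T δ h t) x a / den h t x a :=
        Finset.sum_congr rfl fun x _ => Finset.sum_comm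
    _ ≤ ∑ x ∈ M.lay.inner, ∑ _a : A, 10 * logTerm X A T δ :=
        Finset.sum_le_sum fun x hx => Finset.sum_le_sum fun a _ =>
          hv x a (Layering.mem_inner.1 hx)
    _ = M.lay.inner.card * (Fintype.card A * (10 * logTerm X A T δ)) := by
        simp only [Finset.sum_const, nsmul_eq_mul, Finset.card_univ]
    _ ≤ Fintype.card X * (Fintype.card A * (10 * logTerm X A T δ)) := by
        have : (M.lay.inner.card : ℝ) ≤ Fintype.card X := by exact_mod_cast Finset.card_le_univ _
        gcongr
    _ = _ := by ring

variable [Nonempty A]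

/-- The parameter `β = √(|A|/T)` balances the cost `β T` of the arithmetic-geometric inequality
against the discounted visits, of order `|A|/β` per state: both equal `√(|A| T)`. -/
theorem sqrt_ratio (hT : 0 < T) : 0 < √((Fintype.card A : ℝ) / T) ∧
    √((Fintype.card A : ℝ) / T) * T = √((Fintype.card A : ℝ) * T) ∧
    1 / √((Fintype.card A : ℝ) / T) * Fintype.card A = √((Fintype.card A : ℝ) * T) := by
  have hK : (0 : ℝ) < Fintype.card A := by exact_mod_cast Fintype.card_pos
  have hT' : (0 : ℝ) < T := by exact_mod_cast hT
  have h1 := Real.sq_sqrt hK.le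
  have h2 := Real.sq_sqrt hT'.le
  have h3 : 0 < √(Fintype.card A : ℝ) := Real.sqrt_pos.2 hK
  have h4 : 0 < √(T : ℝ) := Real.sqrt_pos.2 hT'
  rw [Real.sqrt_div hK.le, Real.sqrt_mul hK.le]
  refine ⟨by positivity, ?_, ?_⟩
  · nth_rewrite 2 [← h2]
    field_simp
  · nth_rewrite 2 [← h1]
    field_simp

/-- The sum of the widths of the rewards and costs. -/
theorem VisitGood.sum_value_sqrt_le (hv : VisitGood M T δ h) (hlog : 1 ≤ logTerm X A T δ)
    (hT : 0 < T) :
    ∑ t ∈ Finset.range T, value M.lay M.P (policy M T δ h t) (fun x a => √(1 / den h t x a)) ≤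
      11 * logTerm X A T δ * (Fintype.card X * √((Fintype.card A : ℝ) * T)) := by
  have hπ : ∀ t, IsPolicy (policy M T δ h t) := fun t => isPolicy_expWeights _ _
  obtain ⟨hβ, hβT, hβK⟩ := sqrt_ratio (A := A) hT
  set β := √((Fintype.card A : ℝ) / T)
  have hL : (L : ℝ) ≤ Fintype.card X := by
    have := card_gt_layers M.isTransition (hπ 0)
    exact_mod_cast by omega
  have h1 : ∀ t ∈ Finset.range T, value M.lay M.P (policy M T δ h t)
      (fun x a => √(1 / den h t x a)) ≤ L * β + 1 / β *
        value M.lay M.P (policy M T δ h t) (fun x a => 1 / den h t x a) := by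
    intro t _
    rw [← value_const M.isTransition (hπ t) β, ← value_smul, ← value_add]
    refine value_mono M.isTransition.1 (hπ t) fun x a => ?_
    have hd := den_pos h t x a
    have h2 := two_mul_sqrt_mul_le hβ.le (show 0 ≤ 1 / β * (1 / den h t x a) by positivity)
    rw [← Real.sqrt_mul hβ.le, ← mul_assoc, mul_one_div_cancel hβ.ne', one_mul] at h2
    have := Real.sqrt_nonneg (1 / den h t x a)
    linarith
  refine (Finset.sum_le_sum h1).trans ?_
  rw [Finset.sum_add_distrib, Finset.sum_const, ← Finset.mul_sum, nsmul_eq_mul,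
    Finset.card_range]
  have h3 := mul_le_mul_of_nonneg_left (hv.sum_value_le hlog) (one_div_pos.2 hβ).le
  have e1 : 1 / β * (10 * (Fintype.card X * Fintype.card A) * logTerm X A T δ) =
      10 * Fintype.card X * logTerm X A T δ * √((Fintype.card A : ℝ) * T) := by
    rw [← hβK]; ring
  have e2 : (T : ℝ) * (L * β) = L * √((Fintype.card A : ℝ) * T) := by
    rw [← hβT]; ring
  rw [e1] at h3
  rw [e2]
  have h4 : L * √((Fintype.card A : ℝ) * T) ≤
      logTerm X A T δ * (Fintype.card X * √((Fintype.card A : ℝ) * T)) := by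
    calc _ ≤ Fintype.card X * √((Fintype.card A : ℝ) * T) := by gcongr
      _ ≤ _ := le_mul_of_one_le_left (by positivity) hlog
  linarith

/-- The sum of the first-order errors of the transition function. -/
theorem VisitGood.sum_value_tolerance_le (hv : VisitGood M T δ h) (hlog : 1 ≤ logTerm X A T δ)
    (hT : 0 < T) (hbig : (Fintype.card X : ℝ) ^ 4 * (Fintype.card A : ℝ) ^ 2 ≤
      √((Fintype.card A : ℝ) * T)) :
    ∑ t ∈ Finset.range T, value M.lay M.P (policy M T δ h t)
        (fun x a => ∑ x', tolerance M.lay M.P (den h t) x a x') ≤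
      21 * logTerm X A T δ * (Fintype.card X * √((Fintype.card A : ℝ) * T)) := by
  have : Nonempty X := ⟨M.lay.start⟩
  have hS1 : (1 : ℝ) ≤ Fintype.card X := by exact_mod_cast Fintype.card_pos
  have hK1 : (1 : ℝ) ≤ Fintype.card A := by exact_mod_cast Fintype.card_pos
  have hπ : ∀ t, IsPolicy (policy M T δ h t) := fun t => isPolicy_expWeights _ _
  obtain ⟨hβ, hβT, hβK⟩ := sqrt_ratio (A := A) hT
  set β := √((Fintype.card A : ℝ) / T)
  refine (Finset.sum_le_sum fun t _ => value_tolerance_le M.isTransition (hπ t)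
    (fun x a => one_le_den h t x a) hβ).trans ?_
  rw [Finset.sum_add_distrib, Finset.sum_const, ← Finset.mul_sum, nsmul_eq_mul,
    Finset.card_range]
  have h3 := mul_le_mul_of_nonneg_left (hv.sum_value_le hlog)
    (show 0 ≤ 1 / β + (Fintype.card X : ℝ) by positivity)
  set S := (Fintype.card X : ℝ)
  set K := (Fintype.card A : ℝ)
  set l := logTerm X A T δ
  set R := √(K * T)
  have e1 : (1 / β + S) * (10 * (S * K) * l) = 10 * S * l * R + 10 * l * (S * (S * K)) := by
    rw [← hβK]; ring
  have e2 : (T : ℝ) * (β * S) = S * R := by rw [← hβT]; ring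
  have h5 : S * K ≤ R := by
    refine le_trans ?_ hbig
    have h6 : S ≤ S ^ 4 := le_self_pow₀ hS1 (by norm_num)
    have h7 : K ≤ K ^ 2 := le_self_pow₀ hK1 (by norm_num)
    exact mul_le_mul h6 h7 (by positivity) (by positivity)
  have h8 : 10 * l * (S * (S * K)) ≤ 10 * l * (S * R) := by gcongr
  have h9 : S * R ≤ l * (S * R) := le_mul_of_one_le_left (by positivity) hlog
  rw [e1] at h3
  rw [e2]
  linarith

/-- The sum of the widths of the occupancy bounds. -/
theorem sum_width_le (hg : TransGood M T δ h) (hv : VisitGood M T δ h)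
    (hlog : 1 ≤ logTerm X A T δ)
    (hT : 0 < T) (hbig : (Fintype.card X : ℝ) ^ 4 * (Fintype.card A : ℝ) ^ 2 ≤
      √((Fintype.card A : ℝ) * T)) :
    ∑ t ∈ Finset.range T, ∑ x ∈ M.lay.inner, ∑ a,
        (runUp M T δ h t x a - runLow M T δ h t x a) ≤
      2300000 * logTerm X A T δ ^ 3 * (L * (Fintype.card X * √((Fintype.card A : ℝ) * T))) := by
  have : Nonempty X := ⟨M.lay.start⟩
  have hπ : ∀ t, IsPolicy (policy M T δ h t) := fun t => isPolicy_expWeights _ _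
  have hS : ∀ t, ∀ P ∈ confSet M.lay T δ h t, IsTransition M.lay P := fun t P hP => hP.1
  have hLS : (L : ℝ) ≤ Fintype.card X := by
    have := card_gt_layers M.isTransition (hπ 0)
    exact_mod_cast by omega
  set c := 136 * logTerm X A T δ with hc
  have hc0 : 0 ≤ c := by positivity
  set ε : ℕ → X → A → X → ℝ := fun t x a x' => c * tolerance M.lay M.P (den h t) x a x' with hε
  have htol0 : ∀ t x a x', 0 ≤ tolerance M.lay M.P (den h t) x a x' := fun t x a x' =>
    tolerance_nonneg (one_le_den h t) x a x'
  have h1 : ∀ t ∈ Finset.range T, ∑ x ∈ M.lay.inner, ∑ a,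
      (runUp M T δ h t x a - runLow M T δ h t x a) ≤
      2 * (L * (c * value M.lay M.P (policy M T δ h t)
        (fun x a => ∑ x', tolerance M.lay M.P (den h t) x a x')) +
      Fintype.card X * Fintype.card A * L * (c ^ 2 * (6 * (Fintype.card X : ℝ) ^ 2 * L *
        value M.lay M.P (policy M T δ h t) (fun x a => 1 / den h t x a)))) := by
    intro t ht
    have ht := Finset.mem_range.1 ht
    have hne : (confSet M.lay T δ h t).Nonempty := ⟨_, hg.mem_confSet ht⟩
    -- The largest and the smallest occupancy each differ from the true one by at most `occDev`.
    have h2 : ∀ x ∈ M.lay.inner, ∀ a, runUp M T δ h t x a - runLow M T δ h t x a ≤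
        2 * occDev M.lay M.P (ε t) (policy M T δ h t) x a := by
      intro x hx a
      have hdev : ∀ P' ∈ confSet M.lay T δ h t, _ := fun P' hP' =>
        abs_le.1 (abs_occ_sub_occ_le M.isTransition (hS t P' hP') (hπ t)
          (hg.abs_sub_le hlog ht hP') (Layering.mem_inner.1 hx) a)
      have hup : runUp M T δ h t x a ≤ occ M.lay M.P (policy M T δ h t) x a +
          occDev M.lay M.P (ε t) (policy M T δ h t) x a := by
        refine csSup_le (hne.image _) ?_
        rintro _ ⟨P', hP', rfl⟩
        have := (hdev P' hP').2
        linarith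
      have hlo : occ M.lay M.P (policy M T δ h t) x a -
          occDev M.lay M.P (ε t) (policy M T δ h t) x a ≤ runLow M T δ h t x a := by
        refine le_csInf (hne.image _) ?_
        rintro _ ⟨P', hP', rfl⟩
        have := (hdev P' hP').1
        linarith
      linarith
    refine (Finset.sum_le_sum fun x hx => Finset.sum_le_sum fun a _ => h2 x hx a).trans ?_
    simp only [← Finset.mul_sum]
    refine mul_le_mul_of_nonneg_left ?_ zero_le_two
    refine (sum_occDev_le (ε := ε t) M.isTransition (hπ t)
      (fun x a x' => mul_nonneg hc0 (htol0 t x a x'))).trans ?_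
    have e2 : ∀ x a, ∑ x', ε t x a x' = c * ∑ x', tolerance M.lay M.P (den h t) x a x' :=
      fun x a => by rw [Finset.mul_sum]
    refine add_le_add ?_ ?_
    · simp only [e2, value_smul, le_refl]
    · refine mul_le_mul_of_nonneg_left ?_ (by positivity)
      have e1 : ∀ k y b, ∑ y', ε t y b y' * vgo M.P (policy M T δ h t)
          (fun x a => ∑ x', ε t x a x') (L - (k + 1)) y' =
          c ^ 2 * ∑ y', tolerance M.lay M.P (den h t) y b y' * vgo M.P (policy M T δ h t)
          (fun x a => ∑ x', tolerance M.lay M.P (den h t) x a x') (L - (k + 1)) y' := by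
        intro k y b
        rw [Finset.mul_sum]
        refine Finset.sum_congr rfl fun y' _ => ?_
        simp only [e2]
        rw [vgo_smul]
        ring
      simp only [e1]
      rw [stepSum_smul]
      exact mul_le_mul_of_nonneg_left (stepSum_tolerance_le M.isTransition (hπ t)
        (one_le_den h t)) (by positivity)
  refine (Finset.sum_le_sum h1).trans ?_
  simp only [← Finset.mul_sum, Finset.sum_add_distrib]
  have h3 := hv.sum_value_tolerance_le hlog hT hbig
  have h4 := hv.sum_value_le hlog
  set F := ∑ t ∈ Finset.range T, value M.lay M.P (policy M T δ h t)
        (fun x a => ∑ x', tolerance M.lay M.P (den h t) x a x')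
  set G := ∑ t ∈ Finset.range T, value M.lay M.P (policy M T δ h t) (fun x a => 1 / den h t x a)
  have hG0 : 0 ≤ G := Finset.sum_nonneg fun t _ => value_nonneg M.isTransition.1 (hπ t)
    fun x a => (one_div_pos.2 (den_pos h t x a)).le
  have hS1 : (1 : ℝ) ≤ Fintype.card X := by exact_mod_cast Fintype.card_pos
  have hK1 : (1 : ℝ) ≤ Fintype.card A := by exact_mod_cast Fintype.card_pos
  set S := (Fintype.card X : ℝ)
  set K := (Fintype.card A : ℝ)
  set l := logTerm X A T δ
  set R := √(K * T)
  have hR0 : 0 ≤ R := Real.sqrt_nonneg _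
  have hl3 : l ^ 2 ≤ l ^ 3 := pow_le_pow_right₀ hlog (by norm_num)
  have h5 : L * (c * F) ≤ 2856 * l ^ 3 * (L * (S * R)) := by
    calc _ ≤ L * (c * (21 * l * (S * R))) := by gcongr
      _ = 2856 * l ^ 2 * (L * (S * R)) := by rw [hc]; ring
      _ ≤ _ := by gcongr
  -- The second-order term. One `L` is bounded by `|X|`, and `|X|⁴ |A|² ≤ √(|A| T)` brings it to the
  -- order of the main term; this is where `T` must be large.
  have h6 : S * K * L * (c ^ 2 * (6 * S ^ 2 * L * G)) ≤ 1109760 * l ^ 3 * (L * (S * R)) := by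
    calc _ ≤ S * K * L * (c ^ 2 * (6 * S ^ 2 * S * (10 * (S * K) * l))) := by gcongr
      _ = 1109760 * l ^ 3 * (L * (S * (S ^ 4 * K ^ 2))) := by rw [hc]; ring
      _ ≤ _ := by gcongr
  have h7 : 0 ≤ l ^ 3 * (L * (S * R)) := by positivity
  linarith

end Widths

/-! ### The comparator and the constraint violation -/

section Comparator

variable {X A : Type*} [Fintype X] [Fintype A] {L m : ℕ}

/-- Mixtures of occupancy measures are occupancy measures. -/
theorem exists_mixture {𝓛 : Layering X L} {P : X → A → X → ℝ} (hP : IsTransition 𝓛 P)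
    {π σ : X → A → ℝ} (hπ : IsPolicy π) (hσ : IsPolicy σ) {c d : ℝ} (hc : 0 ≤ c) (hd : 0 ≤ d)
    (hcd : c + d = 1) :
    ∃ κ, IsPolicy κ ∧ ∀ v, value 𝓛 P κ v = c * value 𝓛 P π v + d * value 𝓛 P σ v := by
  set p : X → ℝ := fun x => stateProb 𝓛 P π (𝓛.layer x) x with hp
  set q : X → ℝ := fun x => stateProb 𝓛 P σ (𝓛.layer x) x with hq
  have hp0 : ∀ x, 0 ≤ c * p x := fun x => mul_nonneg hc (stateProb_nonneg hP.1 hπ _ x)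
  have hq0 : ∀ x, 0 ≤ d * q x := fun x => mul_nonneg hd (stateProb_nonneg hP.1 hσ _ x)
  -- The conditional law of the action under the mixture; at states of mixed occupancy zero the
  -- choice is immaterial.
  set κ : X → A → ℝ := fun x a => if c * p x + d * q x = 0 then π x a else
    (c * p x * π x a + d * q x * σ x a) / (c * p x + d * q x) with hκ
  have hκP : IsPolicy κ := by
    intro x
    by_cases h : c * p x + d * q x = 0
    · simp only [hκ, if_pos h]
      exact hπ x
    · simp only [hκ, if_neg h]
      refine ⟨fun a => div_nonneg (add_nonneg (mul_nonneg (hp0 x) ((hπ x).1 a))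
        (mul_nonneg (hq0 x) ((hσ x).1 a))) (add_nonneg (hp0 x) (hq0 x)), ?_⟩
      rw [← Finset.sum_div, Finset.sum_add_distrib, ← Finset.mul_sum, ← Finset.mul_sum, (hπ x).2,
        (hσ x).2, mul_one, mul_one, div_self h]
  have hmix : ∀ k x a, (c * stateProb 𝓛 P π k x + d * stateProb 𝓛 P σ k x) * κ x a =
      c * (stateProb 𝓛 P π k x * π x a) + d * (stateProb 𝓛 P σ k x * σ x a) := by
    intro k x a
    by_cases hk : 𝓛.layer x = k
    · subst hk
      change (c * p x + d * q x) * κ x a = c * (p x * π x a) + d * (q x * σ x a)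
      by_cases h : c * p x + d * q x = 0
      · have h1 : c * p x = 0 := by linarith [hp0 x, hq0 x]
        have h2 : d * q x = 0 := by linarith [hp0 x, hq0 x]
        rw [h, ← mul_assoc, ← mul_assoc, h1, h2]
        ring
      · simp only [hκ, if_neg h]
        rw [mul_div_cancel₀ _ h]
        ring
    · rw [stateProb_eq_zero hP hk, stateProb_eq_zero hP hk]
      ring
  have hsp : ∀ k x, stateProb 𝓛 P κ k x = c * stateProb 𝓛 P π k x + d * stateProb 𝓛 P σ k x := by
    intro k
    induction k with
    | zero =>
      intro x
      simp only [stateProb]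
      rw [← add_mul, hcd, one_mul]
    | succ k ih =>
      intro x'
      simp only [stateProb_succ_apply, ih, hmix, add_mul, Finset.sum_add_distrib, Finset.mul_sum,
        mul_assoc]
  refine ⟨κ, hκP, fun v => ?_⟩
  simp only [value, hsp, hmix, add_mul, Finset.sum_add_distrib, Finset.mul_sum, mul_assoc]

theorem continuous_value (𝓛 : Layering X L) (P : X → A → X → ℝ) (v : X → A → ℝ) :
    Continuous fun π : X → A → ℝ => value 𝓛 P π v := by
  have h : ∀ k x, Continuous fun π : X → A → ℝ => stateProb 𝓛 P π k x := fun k x =>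
    (continuous_stateProb 𝓛 k x).comp (Continuous.prodMk_left P)
  unfold value
  exact continuous_finsetSum _ fun k _ => continuous_finsetSum _ fun x _ =>
    continuous_finsetSum _ fun a _ => ((h k x).mul (by fun_prop)).mul continuous_const

theorem isCompact_isPolicy : IsCompact {π : X → A → ℝ | IsPolicy π} := by
  have hsub : {π : X → A → ℝ | IsPolicy π} ⊆
      Set.univ.pi fun _ => Set.univ.pi fun _ => Set.Icc 0 1 :=
    fun π hπ x _ a _ => ⟨(hπ x).1 a, hπ.le_one x a⟩
  refine (isCompact_univ_pi fun _ => isCompact_univ_pi fun _ => isCompact_Icc).of_isClosed_subset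
    ?_ hsub
  have hc : ∀ x a, Continuous fun π : X → A → ℝ => π x a := fun x a => by fun_prop
  simp only [IsPolicy, Set.ofPred_forall, Set.ofPred_and]
  exact isClosed_iInter fun x => (isClosed_iInter fun a =>
    isClosed_le continuous_const (hc x a)).inter
      (isClosed_eq (continuous_finsetSum _ fun a _ => hc x a) continuous_const)

/-- There is an optimal feasible policy, and the reward of every policy exceeds the optimum by at
most `L / ρ` times its largest violation. -/
theorem exists_comparator {M : Model X A L m} (hm : 0 < m) (hS : Slater M) :
    ∃ σ, IsPolicy σ ∧ (∀ i, value M.lay M.P σ (cost M i) ≤ M.thr i) ∧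
      ∀ π, IsPolicy π → ∀ w, 0 ≤ w → (∀ i, value M.lay M.P π (cost M i) - M.thr i ≤ w) →
        rho M * (value M.lay M.P π (rew M) - value M.lay M.P σ (rew M)) ≤ L * w := by
  obtain ⟨π₀, hπ₀, hπ₀'⟩ := id hS
  set F : Set (X → A → ℝ) := {π | IsPolicy π} ∩ {π | ∀ i, value M.lay M.P π (cost M i) ≤ M.thr i}
    with hF
  have hFc : IsCompact F := by
    refine isCompact_isPolicy.inter_right ?_
    simp only [Set.ofPred_forall]
    exact isClosed_iInter fun i => isClosed_le (continuous_value _ _ _) continuous_const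
  obtain ⟨σ, hσ, hmax⟩ := hFc.exists_isMaxOn ⟨π₀, hπ₀, fun i => (hπ₀' i).le⟩
    (continuous_value M.lay M.P (rew M)).continuousOn
  refine ⟨σ, hσ.1, hσ.2, fun π hπ w hw hviol => ?_⟩
  set D := value M.lay M.P π (rew M) - value M.lay M.P σ (rew M) with hD
  -- Some policy has slack at least `r`. With weights `r/(w+r)` on `π` and `w/(w+r)` on it, a
  -- violation of at most `w` and the slack cancel, so the mixture is feasible and its reward cannot
  -- exceed that of `σ`.
  have key : ∀ r, 0 < r → r < rho M → r * D ≤ L * w := by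
    intro r hr hrρ
    obtain ⟨_, ⟨π₁, hπ₁, rfl⟩, hlt⟩ := exists_lt_of_lt_csSup
      (show ((fun π : X → A → ℝ => ⨅ i, (M.thr i - value M.lay M.P π (cost M i))) ''
        {π | IsPolicy π}).Nonempty from ⟨_, π₀, hπ₀, rfl⟩) hrρ
    have hslack : ∀ i, r ≤ M.thr i - value M.lay M.P π₁ (cost M i) := fun i =>
      hlt.le.trans (ciInf_le (Set.finite_range _).bddBelow i)
    have hwr : 0 < w + r := by linarith
    obtain ⟨κ, hκ, hval⟩ := exists_mixture M.isTransition hπ hπ₁ (c := r / (w + r))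
      (d := w / (w + r)) (by positivity) (by positivity) (by field_simp; ring)
    have hκF : κ ∈ F := by
      refine ⟨hκ, fun i => ?_⟩
      rw [hval, div_mul_eq_mul_div, div_mul_eq_mul_div, ← add_div, div_le_iff₀ hwr]
      have h1 := mul_le_mul_of_nonneg_left (hviol i) hr.le
      have h2 := mul_le_mul_of_nonneg_left (hslack i) hw
      linarith
    have h3 : value M.lay M.P κ (rew M) ≤ value M.lay M.P σ (rew M) := hmax hκF
    rw [hval, div_mul_eq_mul_div, div_mul_eq_mul_div, ← add_div, div_le_iff₀ hwr] at h3
    have h4 : value M.lay M.P σ (rew M) ≤ L * 1 :=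
      value_le M.isTransition hσ.1 fun x a => (rew_mem M x a).2
    have h5 : 0 ≤ value M.lay M.P π₁ (rew M) :=
      value_nonneg M.isTransition.1 hπ₁ fun x a => (rew_mem M x a).1
    have h6 := mul_le_mul_of_nonneg_left h4 hw
    have h7 := mul_nonneg hw h5
    rw [hD]
    linarith
  have hρ := rho_pos hm hS
  -- The limit `r → ρ`: if the claim failed, the midpoint of `L w / D` and `ρ` would contradict
  -- `key`.
  by_contra! hcon
  have hD0 : 0 < D := by
    by_contra! hD0
    have h1 : 0 ≤ L * w := by positivity
    nlinarith
  have h1 : L * w / D < rho M := by rwa [div_lt_iff₀ hD0]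
  have h2 : 0 ≤ L * w / D := by positivity
  have h3 := key ((L * w / D + rho M) / 2) (by linarith) (by linarith)
  rw [← le_div_iff₀ hD0] at h3
  linarith

end Comparator

/-! ### From regret to violation in one episode -/

section Violation

variable {X A : Type*} [Fintype X] [Fintype A] {L m : ℕ} {M : Model X A L m} {T : ℕ} {δ : ℝ}
  {h : ℕ → Episode X A L m} {t : ℕ} {π σ : X → A → ℝ}

/-- The threshold enters each step as `thr / L`, and an episode has exactly `L` steps, so under the
true dynamics it adds up to `thr`. -/
theorem value_loss (hL : 0 < L) (hπ : IsPolicy π) (κ : X → A → ℝ) :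
    value M.lay M.P π (loss M T δ h t κ) = L * (((L : ℝ) + 1) * m / rho M) -
      value M.lay M.P π (rUp T δ h t) +
      ∑ i, dual M T δ h t κ i * (value M.lay M.P π (gLow T δ h t i) - M.thr i) := by
  have hL' : (L : ℝ) ≠ 0 := by exact_mod_cast hL.ne'
  have e1 : ∀ x a, loss M T δ h t κ x a = ((L : ℝ) + 1) * m / rho M + ((-1) * rUp T δ h t x a +
      ∑ i, dual M T δ h t κ i * (gLow T δ h t i x a + (-(M.thr i / L)))) := by
    intro x a
    simp only [loss, sub_eq_add_neg]
    ring
  have e2 : value M.lay M.P π (loss M T δ h t κ) = value M.lay M.P π (fun x a =>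
      ((L : ℝ) + 1) * m / rho M + ((-1) * rUp T δ h t x a +
      ∑ i, dual M T δ h t κ i * (gLow T δ h t i x a + (-(M.thr i / L))))) := by
    congr 1
    funext x a
    exact e1 x a
  rw [e2, value_add, value_add, value_const M.isTransition hπ, value_smul, value_sum]
  simp only [value_smul, value_add, value_const M.isTransition hπ]
  have e3 : ∀ i, (L : ℝ) * -(M.thr i / L) = - M.thr i := fun i => by field_simp
  simp only [e3]
  ring_nf

/-- Constants are collected by every policy for exactly `L` steps, so they cancel in a difference,
and undoing the rescaling only multiplies by the length of the interval. -/
theorem value_scaledLoss_sub (hL : 0 < L) (hρ : 0 < rho M) (hπ : IsPolicy π) (hσ : IsPolicy σ)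
    (κ : X → A → ℝ) :
    (3 * (((L : ℝ) + 1) * m / rho M) + 2) * (value M.lay M.P π (scaledLoss M T δ h t κ) -
        value M.lay M.P σ (scaledLoss M T δ h t κ)) =
      (value M.lay M.P σ (rUp T δ h t) - value M.lay M.P π (rUp T δ h t)) +
      ∑ i, dual M T δ h t κ i * (value M.lay M.P π (gLow T δ h t i) - M.thr i) -
      ∑ i, dual M T δ h t κ i * (value M.lay M.P σ (gLow T δ h t i) - M.thr i) := by
  set D := 3 * (((L : ℝ) + 1) * m / rho M) + 2 with hD
  have hD0 : 0 < D := by positivity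
  have e1 : ∀ τ, IsPolicy τ → D * value M.lay M.P τ (scaledLoss M T δ h t κ) =
      value M.lay M.P τ (loss M T δ h t κ) + L * (((L : ℝ) + 1) * m / rho M + 2) := by
    intro τ hτ
    rw [← value_smul, ← value_const M.isTransition hτ, ← value_add]
    congr 1
    funext x a
    rw [scaledLoss, ← hD, mul_div_cancel₀ _ hD0.ne']
  rw [mul_sub, e1 π hπ, e1 σ hσ, value_loss hL hπ, value_loss hL hσ]
  ring

/-- The effect of the dual variables on the violation in one episode. -/
theorem dual_mul_ge (hρ : 0 < rho M) (i : Fin m) {e₁ e₂ : ℝ}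
    (h₁ : |value M.lay (pHat h t) π (gLow T δ h t i) - value M.lay M.P π (gLow T δ h t i)| ≤ e₁)
    (h₂ : value M.lay M.P π (cost M i) ≤ value M.lay M.P π (gLow T δ h t i) + e₂)
    (he₂ : 0 ≤ e₂) :
    ((L : ℝ) + 1) / rho M * (max 0 (value M.lay M.P π (cost M i) - M.thr i) - e₁ - e₂) ≤
      dual M T δ h t π i * (value M.lay M.P π (gLow T δ h t i) - M.thr i) := by
  have hΛ : 0 ≤ ((L : ℝ) + 1) / rho M := by positivity
  have h3 := abs_le.1 h₁
  have he₁ := (abs_nonneg _).trans h₁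
  unfold dual
  split_ifs with hd
  · refine mul_le_mul_of_nonneg_left ?_ hΛ
    have : max 0 (value M.lay M.P π (cost M i) - M.thr i) ≤
        value M.lay M.P π (gLow T δ h t i) - M.thr i + e₁ + e₂ :=
      max_le (by linarith) (by linarith)
    linarith
  -- With the multiplier inactive, the estimated value is within the threshold. The true violation
  -- is then at most `e₁ + e₂`, so the left side is nonpositive.
  · rw [zero_mul]
    refine mul_nonpos_of_nonneg_of_nonpos hΛ ?_
    have : max 0 (value M.lay M.P π (cost M i) - M.thr i) ≤ e₁ + e₂ :=
      max_le (by linarith) (by linarith)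
    linarith

/-- One episode: the violations are bounded by the regret and the estimation errors. -/
theorem episode_violation (hL : 0 < L) (hρ : 0 < rho M) (hlog : 1 ≤ logTerm X A T δ)
    (hr : Regular M T h) (hg : TransGood M T δ h) (hmg : MeanGood M T δ h) (ht : t < T)
    (hπ : IsPolicy π) (hσ : IsPolicy σ) (hσf : ∀ i, value M.lay M.P σ (cost M i) ≤ M.thr i)
    (hσo : ∀ w, 0 ≤ w → (∀ i, value M.lay M.P π (cost M i) - M.thr i ≤ w) →
        rho M * (value M.lay M.P π (rew M) - value M.lay M.P σ (rew M)) ≤ L * w) :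
    ∑ i, max 0 (value M.lay M.P π (cost M i) - M.thr i) ≤
      (3 * (((L : ℝ) + 1) * m) + 2 * rho M) * (value M.lay M.P π (scaledLoss M T δ h t π) -
        value M.lay M.P σ (scaledLoss M T δ h t π)) +
      2 * rho M * value M.lay M.P π (phi T δ h t) +
      ((L : ℝ) + 1) * m * (L * (136 * logTerm X A T δ * value M.lay M.P π
          (fun x a => ∑ x', tolerance M.lay M.P (den h t) x a x')) +
        2 * value M.lay M.P π (xi (m := m) T δ h t)) := by
  set w : Fin m → ℝ := fun i => max 0 (value M.lay M.P π (cost M i) - M.thr i) with hw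
  have hw0 : ∀ i, 0 ≤ w i := fun i => le_max_left _ _
  set e₁ := L * (136 * logTerm X A T δ * value M.lay M.P π
    (fun x a => ∑ x', tolerance M.lay M.P (den h t) x a x')) with he₁
  set e₂ := 2 * value M.lay M.P π (xi (m := m) T δ h t) with he₂
  have hxi0 : 0 ≤ value M.lay M.P π (xi (m := m) T δ h t) :=
    value_nonneg M.isTransition.1 hπ fun x a => (xi_mem T δ h t x a).1
  have hP := M.isTransition
  -- The sum of the violations is used in place of the largest one, since the sum is what the dual
  -- terms control.
  have hopt := hσo (∑ i, w i) (Finset.sum_nonneg fun i _ => hw0 i) fun i =>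
    (le_max_right _ _).trans (Finset.single_le_sum (f := w) (fun i _ => hw0 i)
      (Finset.mem_univ i))
  have hmd := hmg t ht
  have hrσ : value M.lay M.P σ (rew M) ≤ value M.lay M.P σ (rUp T δ h t) :=
    value_mono hP.1 hσ fun x a => by
      have := (abs_le.1 (hmd.1 x a)).1
      rw [rUp]
      linarith
  have hrπ : value M.lay M.P π (rUp T δ h t) ≤ value M.lay M.P π (rew M) +
      2 * value M.lay M.P π (phi T δ h t) := by
    rw [← value_smul, ← value_add]
    refine value_mono hP.1 hπ fun x a => ?_
    have := (abs_le.1 (hmd.1 x a)).2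
    rw [rUp]
    linarith
  have hgσ : ∑ i, dual M T δ h t π i * (value M.lay M.P σ (gLow T δ h t i) - M.thr i) ≤ 0 := by
    refine Finset.sum_nonpos fun i _ => mul_nonpos_of_nonneg_of_nonpos (dual_mem hρ π i).1 ?_
    have : value M.lay M.P σ (gLow T δ h t i) ≤ value M.lay M.P σ (cost M i) :=
      value_mono hP.1 hσ fun x a => by
        have := (abs_le.1 (hmd.2 i x a)).2
        rw [gLow]
        linarith
    linarith [hσf i]
  have hgπ : ∑ i, ((L : ℝ) + 1) / rho M * (w i - e₁ - e₂) ≤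
      ∑ i, dual M T δ h t π i * (value M.lay M.P π (gLow T δ h t i) - M.thr i) := by
    refine Finset.sum_le_sum fun i _ => dual_mul_ge hρ i ?_ ?_ (by positivity)
    · have h1 := abs_value_sub_value_le (𝓛 := M.lay) hP.1 (pHat_nonneg h t)
        (hr.sum_pHat_le_one ht.le) hπ
        (fun x a => abs_le.2 (hr.gLow_mem (δ := δ) ht.le i x a)) (hg.abs_pHat_sub_le hr hlog ht)
      simp only [← Finset.mul_sum] at h1
      rwa [value_smul] at h1
    · rw [he₂, ← value_smul, ← value_add]
      refine value_mono hP.1 hπ fun x a => ?_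
      have := (abs_le.1 (hmd.2 i x a)).1
      rw [gLow]
      linarith
  have hid := value_scaledLoss_sub (T := T) (δ := δ) (h := h) (t := t) hL hρ hπ hσ π
  rw [← Finset.mul_sum, Finset.sum_sub_distrib, Finset.sum_sub_distrib] at hgπ
  simp only [Finset.sum_const, nsmul_eq_mul, Finset.card_univ, Fintype.card_fin] at hgπ
  set R := value M.lay M.P π (scaledLoss M T δ h t π) - value M.lay M.P σ (scaledLoss M T δ h t π)
  set W := ∑ i, w i
  have h8 : ((L : ℝ) + 1) / rho M * (W - m * e₁ - m * e₂) ≤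
      (3 * (((L : ℝ) + 1) * m / rho M) + 2) * R + (value M.lay M.P π (rew M) -
        value M.lay M.P σ (rew M)) + 2 * value M.lay M.P π (phi T δ h t) := by linarith
  -- Multiplication by `ρ` clears the multipliers. The left side then has `(L+1) W`, the reward gap
  -- is at most `L W` by `hopt`, and one `W` remains.
  have h9 := mul_le_mul_of_nonneg_left h8 hρ.le
  have e3 : rho M * (((L : ℝ) + 1) / rho M * (W - m * e₁ - m * e₂)) =
      (L + 1) * (W - m * e₁ - m * e₂) := by field_simp
  have e4 : rho M * ((3 * (((L : ℝ) + 1) * m / rho M) + 2) * R + (value M.lay M.P π (rew M) -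
        value M.lay M.P σ (rew M)) + 2 * value M.lay M.P π (phi T δ h t)) =
      (3 * (((L : ℝ) + 1) * m) + 2 * rho M) * R + rho M * (value M.lay M.P π (rew M) -
        value M.lay M.P σ (rew M)) + 2 * rho M * value M.lay M.P π (phi T δ h t) := by
    field_simp
  rw [e3, e4] at h9
  linarith

end Violation

/-! ### Summation over the episodes and the probability of the good event -/

section Total

variable {X A : Type*} [Fintype X] [Fintype A] {L m : ℕ} {M : Model X A L m} {T : ℕ} {δ : ℝ}
  {h : ℕ → Episode X A L m}

/-- The logarithmic factor of the cost estimates. -/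
abbrev costLogTerm (X A : Type*) [Fintype X] [Fintype A] (m T : ℕ) (δ : ℝ) : ℝ :=
  Real.log (T * Fintype.card X * Fintype.card A * m / δ)

theorem min_sqrt_le {l N : ℝ} (hl : 1 ≤ l) (hN : 1 ≤ N) :
    min 1 √(4 * l / N) ≤ 2 * l * √(1 / N) := by
  have hN0 : 0 < N := by linarith
  refine (min_le_right _ _).trans (Real.sqrt_le_iff.2 ⟨by positivity, ?_⟩)
  rw [mul_pow, Real.sq_sqrt (by positivity)]
  have e1 : 4 * l / N = 4 * l * (1 / N) := by ring
  rw [e1]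
  refine mul_le_mul_of_nonneg_right ?_ (by positivity)
  nlinarith

/-- The regret of `PO-DB` in terms of the parameters of the problem. -/
theorem podb_regret_le [Nonempty A] (hr : Regular M T h) (hg : TransGood M T δ h)
    (hv : VisitGood M T δ h) (hL : 0 < L)
    (hρ : 0 < rho M) (hδ : 0 < δ) (hδ1 : δ < 1) (hT : 0 < T) (hlog : 1 ≤ logTerm X A T δ)
    (hbig : (Fintype.card X : ℝ) ^ 4 * (Fintype.card A : ℝ) ^ 2 ≤ √((Fintype.card A : ℝ) * T))
    {σ : X → A → ℝ} (hσ : IsPolicy σ)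
    (hQ : ∀ x, M.lay.layer x < L → QHatGood M T δ σ h x) :
    ∑ t ∈ Finset.range T, (value M.lay M.P (policy M T δ h t) (fedLoss M T δ h t) -
        value M.lay M.P σ (fedLoss M T δ h t)) ≤
      14000000 * logTerm X A T δ ^ 3 *
        ((L : ℝ) ^ 2 * (Fintype.card X * √((Fintype.card A : ℝ) * T)) + (L : ℝ) ^ 4) := by
  have : Nonempty X := ⟨M.lay.start⟩
  have hreg := podb_regret hr hg hL hρ hδ hδ1 hT hlog hσ hQ
  have hwid := sum_width_le hg hv hlog hT hbig
  have hLS : (L : ℝ) ≤ Fintype.card X := by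
    have := card_gt_layers M.isTransition hσ
    exact_mod_cast by omega
  have hη : 0 < eta X A L T := eta_pos hL hT
  have hηdef : eta X A L T = min (1 / (24 * (L : ℝ) ^ 3))
    (1 / √((Fintype.card X : ℝ) * Fintype.card A * L * T)) := rfl
  have hγ : gam X A L T = 2 * eta X A L T * L := rfl
  have hL1 : (1 : ℝ) ≤ L := by exact_mod_cast hL
  have hT1 : (1 : ℝ) ≤ T := by exact_mod_cast hT
  have hS1 : (1 : ℝ) ≤ Fintype.card X := by exact_mod_cast Fintype.card_pos
  have hK1 : (1 : ℝ) ≤ Fintype.card A := by exact_mod_cast Fintype.card_pos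
  have hcard : (M.lay.inner.card : ℝ) ≤ Fintype.card X := by exact_mod_cast Finset.card_le_univ _
  have hsplit : ∑ t ∈ Finset.range T, ∑ x ∈ M.lay.inner, ∑ a, (3 * gam X A L T * L +
          L * (runUp M T δ h t x a - runLow M T δ h t x a)) =
      T * (M.lay.inner.card * (Fintype.card A * (3 * gam X A L T * L))) +
      L * ∑ t ∈ Finset.range T, ∑ x ∈ M.lay.inner, ∑ a,
        (runUp M T δ h t x a - runLow M T δ h t x a) := by
    simp only [Finset.mul_sum, Finset.sum_add_distrib, Finset.sum_const, nsmul_eq_mul,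
      Finset.card_univ, Finset.card_range]
  rw [hsplit] at hreg
  set W := ∑ t ∈ Finset.range T, ∑ x ∈ M.lay.inner, ∑ a,
        (runUp M T δ h t x a - runLow M T δ h t x a)
  set I := (M.lay.inner.card : ℝ)
  set S := (Fintype.card X : ℝ)
  set K := (Fintype.card A : ℝ)
  set l := logTerm X A T δ
  set R := √(K * T) with hR
  set η := eta X A L T
  set Z := √(S * K * L * T) with hZ
  have hR0 : 0 < R := Real.sqrt_pos.2 (by positivity)
  have hZ0 : 0 < Z := Real.sqrt_pos.2 (by positivity)
  -- Uses `L ≤ |X|`, which holds since every layer contains a state.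
  have hZle : Z ≤ S * R := by
    refine Real.sqrt_le_iff.2 ⟨by positivity, ?_⟩
    rw [mul_pow, Real.sq_sqrt (by positivity)]
    have : S * L * (K * T) ≤ S * S * (K * T) := by gcongr
    nlinarith
  have hZge : R ≤ Z := by
    refine Real.sqrt_le_sqrt ?_
    have : 1 * (K * T) ≤ S * L * (K * T) := by
      gcongr
      exact one_le_mul_of_one_le_of_one_le hS1 hL1
    linarith
  -- The inverse learning rate is the larger of two quantities, bounded by their sum; the first of
  -- them is the source of the additive `L⁴`.
  have hinv : 1 / η ≤ 24 * (L : ℝ) ^ 3 + Z := by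
    rw [hηdef]
    rcases min_choice (1 / (24 * (L : ℝ) ^ 3)) (1 / Z) with hc | hc <;> rw [hc, one_div_one_div]
    · linarith
    · have : 0 ≤ 24 * (L : ℝ) ^ 3 := by positivity
      linarith
  have h1 : L * (3 * l / η) ≤ 72 * l * (L : ℝ) ^ 4 + 3 * l * (L * (S * R)) := by
    calc _ = 3 * l * L * (1 / η) := by ring
      _ ≤ 3 * l * L * (24 * (L : ℝ) ^ 3 + S * R) := by
          gcongr
          exact hinv.trans (by gcongr)
      _ = _ := by ring
  have hηZ : η * Z ≤ 1 := by
    have : η ≤ 1 / Z := min_le_right _ _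
    rwa [le_div_iff₀ hZ0] at this
  have hηR : η * (K * T) ≤ R := by
    have e1 : K * T = R * R := (Real.mul_self_sqrt (by positivity)).symm
    rw [e1]
    calc η * (R * R) = η * R * R := by ring
      _ ≤ η * Z * R := by gcongr
      _ ≤ 1 * R := by gcongr
      _ = R := one_mul R
  have h2 : T * (I * (K * (3 * gam X A L T * L))) ≤ 6 * ((L : ℝ) ^ 2 * (S * R)) := by
    calc _ = 6 * ((L : ℝ) ^ 2 * (I * (η * (K * T)))) := by rw [hγ]; ring
      _ ≤ _ := by gcongr
  have h3 : L * W ≤ 2300000 * l ^ 3 * ((L : ℝ) ^ 2 * (S * R)) := by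
    calc L * W ≤ L * (2300000 * l ^ 3 * (L * (S * R))) := by gcongr
      _ = _ := by ring
  have hl3 : l ≤ l ^ 3 := le_self_pow₀ hlog (by norm_num)
  have hl1 : 1 ≤ l ^ 3 := one_le_pow₀ hlog
  have hB : 0 ≤ (L : ℝ) ^ 2 * (S * R) := by positivity
  have h4 : 3 * l * (L * (S * R)) ≤ 3 * l ^ 3 * ((L : ℝ) ^ 2 * (S * R)) := by
    gcongr
    exact le_self_pow₀ hL1 (by norm_num)
  have h5 : 72 * l * (L : ℝ) ^ 4 ≤ 72 * l ^ 3 * (L : ℝ) ^ 4 := by gcongr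
  have h6 : (L : ℝ) ^ 2 * (S * R) ≤ l ^ 3 * ((L : ℝ) ^ 2 * (S * R)) :=
    le_mul_of_one_le_left hB hl1
  have h7 : 0 ≤ l ^ 3 * (L : ℝ) ^ 4 := by positivity
  have h8 : 0 ≤ l ^ 3 * ((L : ℝ) ^ 2 * (S * R)) := by positivity
  linarith

/-- The bound on the violation on the good event. -/
theorem violation_le [Nonempty A] (hr : Regular M T h) (hg : TransGood M T δ h)
    (hv : VisitGood M T δ h) (hmg : MeanGood M T δ h) (hL : 0 < L) (hm : 0 < m)
    (hS : Slater M) (hδ : 0 < δ) (hδ1 : δ < 1) (hT : 0 < T) (hlog : 1 ≤ logTerm X A T δ)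
    (hlog' : logTerm X A T δ ≤ costLogTerm X A m T δ)
    (hbig : (Fintype.card X : ℝ) ^ 4 * (Fintype.card A : ℝ) ^ 2 ≤ √((Fintype.card A : ℝ) * T))
    {σ : X → A → ℝ} (hσ : IsPolicy σ) (hσf : ∀ i, value M.lay M.P σ (cost M i) ≤ M.thr i)
    (hσo : ∀ π, IsPolicy π → ∀ w, 0 ≤ w → (∀ i, value M.lay M.P π (cost M i) - M.thr i ≤ w) →
        rho M * (value M.lay M.P π (rew M) - value M.lay M.P σ (rew M)) ≤ L * w)
    (hQ : ∀ x, M.lay.layer x < L → QHatGood M T δ σ h x) :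
    violation M T δ h ≤ 200000000 * costLogTerm X A m T δ ^ 3 *
      ((L : ℝ) ^ 3 * m * Fintype.card X * √((Fintype.card A : ℝ) * T) + (L : ℝ) ^ 5 * m) := by
  have : Nonempty (Fin m) := ⟨⟨0, hm⟩⟩
  have hρ := rho_pos hm hS
  have hρL := rho_le hm hS
  have hπ : ∀ t, IsPolicy (policy M T δ h t) := fun t => isPolicy_expWeights _ _
  have hreg := podb_regret_le hr hg hv hL hρ hδ hδ1 hT hlog hbig hσ hQ
  have htol := hv.sum_value_tolerance_le hlog hT hbig
  have hsqrt := hv.sum_value_sqrt_le hlog hT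
  have hphi : ∑ t ∈ Finset.range T, value M.lay M.P (policy M T δ h t) (phi T δ h t) ≤
      2 * logTerm X A T δ * ∑ t ∈ Finset.range T,
        value M.lay M.P (policy M T δ h t) (fun x a => √(1 / den h t x a)) := by
    rw [Finset.mul_sum]
    refine Finset.sum_le_sum fun t _ => ?_
    rw [← value_smul]
    exact value_mono M.isTransition.1 (hπ t) fun x a => min_sqrt_le hlog (one_le_den h t x a)
  have hxi : ∑ t ∈ Finset.range T, value M.lay M.P (policy M T δ h t) (xi (m := m) T δ h t) ≤
      2 * costLogTerm X A m T δ * ∑ t ∈ Finset.range T,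
        value M.lay M.P (policy M T δ h t) (fun x a => √(1 / den h t x a)) := by
    rw [Finset.mul_sum]
    refine Finset.sum_le_sum fun t _ => ?_
    rw [← value_smul]
    exact value_mono M.isTransition.1 (hπ t) fun x a =>
      min_sqrt_le (hlog.trans hlog') (one_le_den h t x a)
  -- The maximum over the constraints is bounded by the sum, which is the quantity controlled in
  -- each episode.
  have htot : violation M T δ h ≤ ∑ t ∈ Finset.range T, ∑ i,
      max 0 (value M.lay M.P (policy M T δ h t) (cost M i) - M.thr i) := by
    refine ciSup_le fun i => Finset.sum_le_sum fun t _ => ?_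
    exact Finset.single_le_sum (f := fun i => max 0 (value M.lay M.P (policy M T δ h t)
      (cost M i) - M.thr i)) (fun i _ => le_max_left _ _) (Finset.mem_univ i)
  have hep := Finset.sum_le_sum fun t ht => episode_violation hL hρ hlog hr hg hmg
    (Finset.mem_range.1 ht) (hπ t) hσ hσf (hσo _ (hπ t))
  rw [Finset.sum_add_distrib, Finset.sum_add_distrib, ← Finset.mul_sum, ← Finset.mul_sum,
    ← Finset.mul_sum, Finset.sum_add_distrib, ← Finset.mul_sum, ← Finset.mul_sum,
    ← Finset.mul_sum] at hep
  refine htot.trans (hep.trans ?_)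
  have hL1 : (1 : ℝ) ≤ L := by exact_mod_cast hL
  have hm1 : (1 : ℝ) ≤ m := by exact_mod_cast hm
  change ∑ t ∈ Finset.range T, (value M.lay M.P (policy M T δ h t)
    (scaledLoss M T δ h t (policy M T δ h t)) - value M.lay M.P σ
    (scaledLoss M T δ h t (policy M T δ h t))) ≤ _ at hreg
  set Rg := ∑ t ∈ Finset.range T, (value M.lay M.P (policy M T δ h t)
    (scaledLoss M T δ h t (policy M T δ h t)) - value M.lay M.P σ
    (scaledLoss M T δ h t (policy M T δ h t)))
  set Φ := ∑ t ∈ Finset.range T, value M.lay M.P (policy M T δ h t) (phi T δ h t)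
  set Ξ := ∑ t ∈ Finset.range T, value M.lay M.P (policy M T δ h t) (xi (m := m) T δ h t)
  set F := ∑ t ∈ Finset.range T, value M.lay M.P (policy M T δ h t)
        (fun x a => ∑ x', tolerance M.lay M.P (den h t) x a x')
  set E := ∑ t ∈ Finset.range T,
        value M.lay M.P (policy M T δ h t) (fun x a => √(1 / den h t x a))
  have hΦ0 : 0 ≤ Φ := Finset.sum_nonneg fun t _ => value_nonneg M.isTransition.1 (hπ t)
    fun x a => (phi_mem T δ h t x a).1
  have hΞ0 : 0 ≤ Ξ := Finset.sum_nonneg fun t _ => value_nonneg M.isTransition.1 (hπ t)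
    fun x a => (xi_mem T δ h t x a).1
  have hF0 : 0 ≤ F := Finset.sum_nonneg fun t _ => value_nonneg M.isTransition.1 (hπ t)
    fun x a => Finset.sum_nonneg fun x' _ => tolerance_nonneg (one_le_den h t) x a x'
  have hE0 : 0 ≤ E := Finset.sum_nonneg fun t _ => value_nonneg M.isTransition.1 (hπ t)
    fun x a => Real.sqrt_nonneg _
  set S := (Fintype.card X : ℝ)
  set l := logTerm X A T δ
  set l' := costLogTerm X A m T δ
  set R := √((Fintype.card A : ℝ) * T)
  set k := (L : ℝ)
  set n := (m : ℝ)
  have hS0 : 0 ≤ S := Nat.cast_nonneg _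
  have hR0 : 0 ≤ R := Real.sqrt_nonneg _
  have hl0 : 0 ≤ l := by linarith
  have hl'1 : 1 ≤ l' := hlog.trans hlog'
  have hsq : l' ^ 2 ≤ l' ^ 3 := pow_le_pow_right₀ hl'1 (by norm_num)
  set B := k ^ 3 * n * (S * R) with hB
  have hB0 : 0 ≤ B := by positivity
  have hkn : k ≤ k * n := le_mul_of_one_le_right (by positivity) hm1
  have hnn : n ≤ k * n := le_mul_of_one_le_left (by positivity) hL1
  have hk3 : k ^ 2 ≤ k ^ 3 := pow_le_pow_right₀ hL1 (by norm_num)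
  have hk1 : k ≤ k ^ 3 := le_self_pow₀ hL1 (by norm_num)
  -- Since `ρ ≤ L`, the prefactor is at most `8 L m`; it raises the regret bound by one power of `L`
  -- and a factor `m`, and no inverse of `ρ` occurs.
  have p1 : (3 * ((k + 1) * n) + 2 * rho M) * Rg ≤ 112000000 * l' ^ 3 * (B + k ^ 5 * n) := by
    calc _ ≤ (3 * ((k + 1) * n) + 2 * rho M) *
          (14000000 * l ^ 3 * (k ^ 2 * (S * R) + k ^ 4)) := by gcongr
      _ ≤ (8 * (k * n)) * (14000000 * l' ^ 3 * (k ^ 2 * (S * R) + k ^ 4)) := by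
          gcongr
          linarith
      _ = _ := by rw [hB]; ring
  have hE : E ≤ 11 * l' * (S * R) := hsqrt.trans (by gcongr)
  have p2 : 2 * rho M * Φ ≤ 44 * l' ^ 3 * B := by
    calc _ ≤ 2 * k * (2 * l' * (11 * l' * (S * R))) := by
          gcongr
          refine hphi.trans ?_
          gcongr
      _ = 44 * l' ^ 2 * (k * 1 * (S * R)) := by ring
      _ ≤ 44 * l' ^ 3 * (k ^ 3 * n * (S * R)) := by gcongr
      _ = _ := rfl
  have p3 : (k + 1) * n * (k * (136 * l * F) + 2 * Ξ) ≤ 6000 * l' ^ 3 * B := by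
    have hF : k * (136 * l * F) ≤ 2856 * l' ^ 2 * (k * (S * R)) := by
      calc _ ≤ k * (136 * l' * (21 * l' * (S * R))) := by
            gcongr
            exact htol.trans (by gcongr)
        _ = _ := by ring
    have hX : 2 * Ξ ≤ 44 * l' ^ 2 * (k * (S * R)) := by
      calc _ ≤ 2 * (2 * l' * (11 * l' * (S * R))) := by
            gcongr
            exact hxi.trans (by gcongr)
        _ = 44 * l' ^ 2 * (1 * (S * R)) := by ring
        _ ≤ _ := by gcongr
    calc _ ≤ (k + k) * n * (2856 * l' ^ 2 * (k * (S * R)) + 44 * l' ^ 2 * (k * (S * R))) :=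
          mul_le_mul (by gcongr) (add_le_add hF hX) (by positivity) (by positivity)
      _ = 5800 * l' ^ 2 * (k ^ 2 * n * (S * R)) := by ring
      _ ≤ 5800 * l' ^ 3 * (k ^ 3 * n * (S * R)) := by gcongr
      _ ≤ 6000 * l' ^ 3 * B := by gcongr; norm_num
  have hfin : 0 ≤ l' ^ 3 * B := by positivity
  have hfin' : 0 ≤ l' ^ 3 * (k ^ 5 * n) := by positivity
  have e1 : k ^ 3 * n * S * R = B := by rw [hB]; ring
  rw [e1]
  linarith

/-- With high probability the run is good, and the violation is bounded. -/
theorem IsRun.violation_bound {Ω : Type*} [MeasurableSpace Ω] {μ : Measure Ω}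
    [IsProbabilityMeasure μ] {H : ℕ → Ω → Episode X A L m} (hL : 0 < L) (hm : 0 < m)
    (hS : Slater M) (hδ : 0 < δ) (hδ1 : δ < 1)
    (hbig : (Fintype.card X * Fintype.card A) ^ 8 ≤ T) (hH : IsRun M T δ μ H) :
    1 - 10 * δ ≤ μ.real {ω | violation M T δ (fun t => H t ω) ≤
      200000000 * costLogTerm X A m T δ ^ 3 * ((L : ℝ) ^ 3 * m * Fintype.card X *
        √((Fintype.card A : ℝ) * T) + (L : ℝ) ^ 5 * m)} := by
  obtain ⟨π₀, hπ₀, -⟩ := id hS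
  have : Nonempty A := by
    by_contra hA
    rw [not_nonempty_iff] at hA
    simpa using (hπ₀ M.lay.start).2
  have : Nonempty X := ⟨M.lay.start⟩
  have hX2 : 2 ≤ Fintype.card X := by
    have := card_gt_layers M.isTransition hπ₀
    omega
  have hA1 : 1 ≤ Fintype.card A := Fintype.card_pos
  -- At least one layer transition forces two states, so `T ≥ 2⁸`, which is more than enough for the
  -- logarithms to be at least one.
  have hT256 : 256 ≤ T := by
    refine le_trans ?_ hbig
    calc 256 = (2 * 1) ^ 8 := by norm_num
      _ ≤ _ := Nat.pow_le_pow_left (Nat.mul_le_mul hX2 hA1) 8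
  have hT : 0 < T := by omega
  have hK1 : (1 : ℝ) ≤ Fintype.card A := by exact_mod_cast hA1
  have hX1 : (1 : ℝ) ≤ Fintype.card X := by exact_mod_cast (show 1 ≤ Fintype.card X by omega)
  have hlog : 1 ≤ logTerm X A T δ := by
    refine le_trans ?_ (log_le_logTerm hδ hδ1 hT)
    rw [Real.le_log_iff_exp_le (by exact_mod_cast hT)]
    have : (256 : ℝ) ≤ T := by exact_mod_cast hT256
    linarith [Real.exp_one_lt_d9]
  have hlog' : logTerm X A T δ ≤ costLogTerm X A m T δ := by
    refine Real.log_le_log (by positivity) (div_le_div_of_nonneg_right ?_ hδ.le)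
    exact le_mul_of_one_le_right (by positivity) (by exact_mod_cast hm)
  -- The exponent eight comes from squaring `|X|⁴ |A|²`.
  have hbig' : (Fintype.card X : ℝ) ^ 4 * (Fintype.card A : ℝ) ^ 2 ≤
      √((Fintype.card A : ℝ) * T) := by
    refine Real.le_sqrt_of_sq_le ?_
    have h1 : ((Fintype.card X : ℝ) * Fintype.card A) ^ 8 ≤ T := by exact_mod_cast hbig
    have h2 : (Fintype.card A : ℝ) ^ 4 ≤ (Fintype.card A : ℝ) ^ 8 :=
      pow_le_pow_right₀ hK1 (by norm_num)
    calc ((Fintype.card X : ℝ) ^ 4 * (Fintype.card A : ℝ) ^ 2) ^ 2 =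
          (Fintype.card X : ℝ) ^ 8 * (Fintype.card A : ℝ) ^ 4 := by ring
      _ ≤ (Fintype.card X : ℝ) ^ 8 * (Fintype.card A : ℝ) ^ 8 := by gcongr
      _ = ((Fintype.card X : ℝ) * Fintype.card A) ^ 8 := by ring
      _ ≤ T := h1
      _ ≤ _ := le_mul_of_one_le_left (by positivity) hK1
  have hρ := rho_pos hm hS
  obtain ⟨σ, hσ, hσf, hσo⟩ := exists_comparator hm hS
  have b0 : μ.real {ω | ¬ Regular M T (fun s => H s ω)} ≤ 0 := by
    have h1 : μ {ω | ¬ Regular M T (fun s => H s ω)} = 0 := hH.ae_regular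
    rw [measureReal_def, h1]
    simp
  have b1 := hH.measure_not_transGood hδ hδ1 hT hlog
  have b2 := hH.measure_not_meanGood hm hδ hδ1 hT hlog (hlog.trans hlog')
  have b3 := hH.measure_not_visitGood hδ hδ1 hT hlog
  have b4 := hH.measure_not_qHatGood hL hρ hδ hT hσ
  -- The failure probabilities add up to `0 + 2δ + 4δ + δ + 3δ = 10δ`.
  have hbad := measureReal_or_le b0 (measureReal_or_le b1 (measureReal_or_le b2
    (measureReal_or_le b3 b4)))
  set G : Ω → Prop := fun ω => violation M T δ (fun t => H t ω) ≤
      200000000 * costLogTerm X A m T δ ^ 3 * ((L : ℝ) ^ 3 * m * Fintype.card X *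
        √((Fintype.card A : ℝ) * T) + (L : ℝ) ^ 5 * m) with hG
  have hall := measureReal_or_le (p := G) (c := μ.real {ω | G ω}) le_rfl hbad
  -- The event and the failures cover the whole space. Subadditivity alone then gives the lower
  -- bound, so the event need not be shown measurable.
  have huniv : {ω | G ω ∨ ¬ Regular M T (fun s => H s ω) ∨ ¬ TransGood M T δ (fun s => H s ω) ∨
      ¬ (Regular M T (fun s => H s ω) → MeanGood M T δ (fun s => H s ω)) ∨
      ¬ VisitGood M T δ (fun s => H s ω) ∨
      ¬ (Regular M T (fun s => H s ω) → ∀ x, M.lay.layer x < L →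
        QHatGood M T δ σ (fun s => H s ω) x)} = Set.univ := by
    refine Set.eq_univ_of_forall fun ω => ?_
    by_contra hω
    simp only [Set.mem_ofPred_eq, not_or, not_not] at hω
    obtain ⟨h0, h1, h2, h3, h4, h5⟩ := hω
    exact h0 (violation_le h1 h2 h4 (h3 h1) hL hm hS hδ hδ1 hT hlog hlog' hbig' hσ hσf hσo (h5 h1))
  rw [huniv, probReal_univ] at hall
  linarith

end Total

end CMDP

end

theorem theorem2 :
    ∃ (C : ℝ) (p q : ℕ), 0 < C ∧
      ∀ (X A Ω : Type*) [Fintype X] [Fintype A] [MeasurableSpace Ω] (L m : ℕ)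
        (M : CMDP.Model X A L m) (T : ℕ) (δ : ℝ) (μ : MeasureTheory.Measure Ω)
        [MeasureTheory.IsProbabilityMeasure μ] (H : ℕ → Ω → CMDP.Episode X A L m),
        0 < L → 0 < m → CMDP.Slater M → 0 < δ → δ < 1 →
        (Fintype.card X * Fintype.card A) ^ q ≤ T →
        CMDP.IsRun M T δ μ H →
        1 - C * δ ≤ μ.real {ω | CMDP.violation M T δ (fun t => H t ω) ≤
          C * Real.log (T * Fintype.card X * Fintype.card A * m / δ) ^ p *
            ((L : ℝ) ^ 3 * m * Fintype.card X * √((Fintype.card A : ℝ) * T) +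
              (L : ℝ) ^ 5 * m)} := by
  refine ⟨200000000, 3, 8, by norm_num, ?_⟩
  intro X A Ω _ _ _ L m M T δ μ _ H hL hm hS hδ hδ1 hbig hH
  refine le_trans ?_ (hH.violation_bound hL hm hS hδ hδ1 hbig)
  linarith
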